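/- Let $d\in\mathbb N$, let $\alpha,\beta<0$, and let $f\in\mathcal C^\alpha_{\mathrm{loc}}(\mathbb R^d)$ and $g\in\mathcal C^\beta_{\mathrm{loc}}(\mathbb R^d)$ be (complex-valued) distributions with $\operatorname{singsupp}(f)\cap\operatorname{singsupp}(g)=\emptyset$. Then there exists a unique canonical product $f\cdot g\in\mathcal D'(\mathbb R^d)$, and $f\cdot g\in\mathcal C^{\alpha+\beta}_{\mathrm{loc}}(\mathbb R^d)$. Here the following definitions are used. For $\gamma<0$ let $r_\gamma$ be the smallest integer strictly larger than $-\gamma$. The space $\mathcal C^\gamma_{\mathrm{loc}}(\mathbb R^d)$ consists of all $u\in\mathcal D'(\mathbb R^d)$ such that for every compact $K\subset\mathbb R^d$ there is a constant $C$ with $|u(\varphi^\lambda_x)|\le C\lambda^\gamma$ for all $x\in K$, $\lambda\in(0,1]$ and all test functions $\varphi\in\mathcal D(B(0,1))$ with $\|\varphi\|_{C^{r_\gamma}}\le 1$, where $\varphi^\lambda_x(y)=\lambda^{-d}\varphi\big(\tfrac{x-y}{\lambda}\big)$. A point $x$ is outside $\operatorname{singsupp}(u)$ if and only if $u$ coincides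 with a smooth function on some open neighbourhood of $x$. A distribution $p$ is a canonical product of $f$ and $g$ if $p=\Delta^*(f\otimes g)$, the pull-back along the diagonal map $\Delta:x\mapsto(x,x)$ of the distribution $f\otimes g\in\mathcal D'(\mathbb R^d\times\mathbb R^d)$ determined by $(f\otimes g)(\varphi\otimes\psi)=f(\varphi)g(\psi)$. The pull-back is understood in the sense of Hörmander: call admissible for $T\in\mathcal D'(\mathbb R^d\times\mathbb R^d)$ a closed conic subset $\Gamma$ of $(\mathbb R^d\times\mathbb R^d)\times(\mathbb R^{2d}\setminus\{0\})$ which contains the smooth wave front set $\mathrm{WF}(T)$ and contains no conormal $((x,x),(\xi,-\xi))$ of the diagonal. Let $\mathcal D'_\Gamma$ be the space of distributions with wave front set in $\Gamma$; $T_j\to T$ in $\mathcal D'_\Gamma$ means that $T_j\to T$ weakly and that $\sup_{\xi\in V}|\xi|^N|\widehat{\varphi T_j}(\xi)-\widehat{\varphi T}(\xi)|\to0$ for every $N\in\mathbb N$, every test function $\varphi$ and every closed cone $V$ with $\Gamma\cap(\operatorname{supp}\varphi\times V)=\emptyset$. Then $p=\Delta^*T$ means that $T$ is, for some admissible $\Gamma$,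 the limit in $\mathcal D'_\Gamma$ of a sequence of smooth functions and that, for every admissible $\Gamma$ and every sequence of smooth functions $w_j$ converging to $T$ in $\mathcal D'_\Gamma$, the functions $x\mapsto w_j(x,x)$ converge to $p$ in $\mathcal D'(\mathbb R^d)$. -/

import Mathlib

open scoped Distributions ContDiff Topology

namespace HolderProduct

noncomputable section

/-- Real test functions on the whole space `F`. -/
abbrev Test (F : Type*) [NormedAddCommGroup F] [NormedSpace ℝ F] :=
  𝓓((⊤ : TopologicalSpace.Opens F), ℝ)

/-- Complex-valued distributions on the whole space `F`. -/
abbrev Distr (F : Type*) [NormedAddCommGroup F] [NormedSpace ℝ F] :=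
  𝓓'((⊤ : TopologicalSpace.Opens F), ℂ)

section General

variable {F : Type*} [NormedAddCommGroup F] [NormedSpace ℝ F]

/-- The test function `φ · a`, for `a` smooth. -/
def mulSmooth (φ : Test F) (a : F → ℝ) (ha : ContDiff ℝ ∞ a) : Test F where
  toFun x := φ x * a x
  contDiff' := φ.contDiff.mul ha
  hasCompactSupport' := φ.hasCompactSupport.mul_right
  tsupport_subset' := fun _ _ => trivial

theorem contDiff_cos_clm (ξ : F →L[ℝ] ℝ) : ContDiff ℝ ∞ (fun x => Real.cos (ξ x)) :=
  Real.contDiff_cos.comp ξ.contDiff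

theorem contDiff_sin_clm (ξ : F →L[ℝ] ℝ) : ContDiff ℝ ∞ (fun x => Real.sin (ξ x)) :=
  Real.contDiff_sin.comp ξ.contDiff

/-- The Fourier transform of the compactly supported distribution `φ u` at the covector `ξ`,
i.e. `u` applied to `x ↦ φ x * exp (- i ξ x) = φ x * cos (ξ x) - i φ x * sin (ξ x)`. -/
def localFourier (u : Distr F) (φ : Test F) (ξ : F →L[ℝ] ℝ) : ℂ :=
  u (mulSmooth φ (fun x => Real.cos (ξ x)) (contDiff_cos_clm ξ))
    - Complex.I * u (mulSmooth φ (fun x => Real.sin (ξ x)) (contDiff_sin_clm ξ))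

/-- A set of covectors is conic if it is stable under multiplication by positive scalars. -/
def IsConic (V : Set (F →L[ℝ] ℝ)) : Prop :=
  ∀ ξ ∈ V, ∀ t : ℝ, 0 < t → t • ξ ∈ V

/-- The smooth wave front set, a subset of the cotangent space with the zero section removed. -/
def waveFrontSet (u : Distr F) : Set (F × (F →L[ℝ] ℝ)) :=
  {p | p.2 ≠ 0 ∧ ¬ ∃ φ : Test F, φ p.1 ≠ 0 ∧
    ∃ V : Set (F →L[ℝ] ℝ), IsOpen V ∧ IsConic V ∧ p.2 ∈ V ∧
      ∀ N : ℕ, ∃ C : ℝ, ∀ ξ ∈ V, (1 + ‖ξ‖) ^ N * ‖localFourier u φ ξ‖ ≤ C}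

/-- `Γ` is a closed conic subset of the cotangent space with the zero section removed
(closed relative to the complement of the zero section). -/
structure IsClosedCone (Γ : Set (F × (F →L[ℝ] ℝ))) : Prop where
  ne_zero : ∀ p ∈ Γ, p.2 ≠ 0
  conic : ∀ p ∈ Γ, ∀ t : ℝ, 0 < t → (p.1, t • p.2) ∈ Γ
  closed : IsClosed (Γ ∪ {p | p.2 = 0})

/-- Convergence `U j → u` in the space `𝓓'_Γ` of distributions with wave front set in `Γ`:
convergence as distributions, and, for every test function `φ` and every closed cone `V` such that
`Γ` does not meet `supp φ × V`, convergence of the Fourier transforms of `φ U j` to that of `φ u`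
on `V`, uniformly with respect to any polynomial weight. -/
structure TendstoIn (Γ : Set (F × (F →L[ℝ] ℝ))) (U : ℕ → Distr F) (u : Distr F) : Prop where
  mem_seq : ∀ j, waveFrontSet (U j) ⊆ Γ
  mem_limit : waveFrontSet u ⊆ Γ
  weak : ∀ φ : Test F, Filter.Tendsto (fun j => U j φ) Filter.atTop (𝓝 (u φ))
  fourier : ∀ (φ : Test F) (V : Set (F →L[ℝ] ℝ)), IsClosed V → IsConic V →
    Disjoint Γ (tsupport φ ×ˢ V) →
    ∀ (N : ℕ) (ε : ℝ), 0 < ε → ∀ᶠ j in Filter.atTop, ∀ ξ ∈ V,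
      ‖ξ‖ ^ N * ‖localFourier (U j) φ ξ - localFourier u φ ξ‖ ≤ ε

/-- The tensor product of two real test functions. -/
def tensorTest (φ ψ : Test F) : Test (F × F) where
  toFun z := φ z.1 * ψ z.2
  contDiff' := (φ.contDiff.comp contDiff_fst).mul (ψ.contDiff.comp contDiff_snd)
  hasCompactSupport' := by
    refine HasCompactSupport.intro (φ.hasCompactSupport.isCompact.prod
      ψ.hasCompactSupport.isCompact) ?_
    intro z hz
    by_cases h1 : z.1 ∈ tsupport φ
    · have h2 : z.2 ∉ tsupport ψ := fun h2 => hz ⟨h1, h2⟩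
      simp [image_eq_zero_of_notMem_tsupport h2]
    · simp [image_eq_zero_of_notMem_tsupport h1]
  tsupport_subset' := fun _ _ => trivial

/-- `T` is the tensor product `f ⊗ g`: the distribution on `F × F` with
`T (φ ⊗ ψ) = f φ * g ψ` for all test functions `φ`, `ψ`. -/
def IsTensorProduct (f g : Distr F) (T : Distr (F × F)) : Prop :=
  ∀ φ ψ : Test F, T (tensorTest φ ψ) = f φ * g ψ

/-- The conormal bundle of the diagonal map `x ↦ (x, x)`, without the zero section. -/
def diagonalConormal : Set ((F × F) × (F × F →L[ℝ] ℝ)) :=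
  {p | p.1.1 = p.1.2 ∧ p.2 ≠ 0 ∧ ∀ v : F, p.2 (v, v) = 0}

end General

section Measure

variable {F : Type*} [NormedAddCommGroup F] [NormedSpace ℝ F] [MeasureTheory.MeasureSpace F]
  [BorelSpace F]

/-- The distribution `φ ↦ ∫ φ w` defined by a (locally integrable) function `w`. -/
def ofFunction (w : F → ℂ) : Distr F :=
  ContinuousLinearMap.toUniformConvergenceCLM (RingHom.id ℝ) ℂ
    {S : Set (Test F) | IsCompact S}
    (TestFunction.integralAgainstBilinCLM (ContinuousLinearMap.lsmul ℝ ℝ)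
      MeasureTheory.volume w)

theorem ofFunction_apply
    [MeasureTheory.IsLocallyFiniteMeasure (MeasureTheory.volume : MeasureTheory.Measure F)]
    {w : F → ℂ} (hw : Continuous w) (φ : Test F) :
    ofFunction w φ = ∫ x, φ x • w x := by
  have h : MeasureTheory.LocallyIntegrableOn w ((⊤ : TopologicalSpace.Opens F) : Set F) :=
    hw.locallyIntegrable.locallyIntegrableOn _
  exact TestFunction.integralAgainstBilinCLM_eq_integral (B := ContinuousLinearMap.lsmul ℝ ℝ) h

variable [SecondCountableTopology F]

/-- The singular support: `x` is outside it iff `u` is given by a smooth function near `x`. -/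
def singularSupport (u : Distr F) : Set F :=
  {x | ¬ ∃ U : Set F, IsOpen U ∧ x ∈ U ∧ ∃ a : F → ℂ, ContDiffOn ℝ ∞ a U ∧
    ∀ φ : Test F, tsupport φ ⊆ U → u φ = ∫ y, φ y • a y}

/-- The closed cones `Γ` for which the pull-back along the diagonal map is defined on `𝓓'_Γ`,
and such that `T` lies in `𝓓'_Γ`. -/
def IsAdmissible (T : Distr (F × F)) (Γ : Set ((F × F) × (F × F →L[ℝ] ℝ))) : Prop :=
  IsClosedCone Γ ∧ Disjoint Γ diagonalConormal ∧ waveFrontSet T ⊆ Γ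

/-- `p` is the pull-back of `T` along the diagonal map `Δ x = (x, x)`, i.e. the value at `T` of the
sequentially continuous extension to the spaces `𝓓'_Γ` of the map `w ↦ w ∘ Δ` on smooth functions:
`T` is, for an admissible `Γ`, a limit in `𝓓'_Γ` of smooth functions, and whenever smooth functions
`w j` converge to `T` in `𝓓'_Γ`, with `Γ` admissible, then `w j ∘ Δ` converges to `p`. -/
def IsDiagonalPullback (T : Distr (F × F)) (p : Distr F) : Prop :=
  (∃ Γ, IsAdmissible T Γ ∧ ∃ w : ℕ → F × F → ℂ, (∀ j, ContDiff ℝ ∞ (w j)) ∧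
    TendstoIn Γ (fun j => ofFunction (w j)) T) ∧
  ∀ Γ, IsAdmissible T Γ → ∀ w : ℕ → F × F → ℂ, (∀ j, ContDiff ℝ ∞ (w j)) →
    TendstoIn Γ (fun j => ofFunction (w j)) T →
    ∀ φ : Test F, Filter.Tendsto (fun j => ofFunction (fun x => w j (x, x)) φ)
      Filter.atTop (𝓝 (p φ))

/-- `p` is the canonical product of `f` and `g`: the pull-back of `f ⊗ g` along the diagonal. -/
def IsCanonicalProduct (f g p : Distr F) : Prop :=
  ∃ T : Distr (F × F), IsTensorProduct f g T ∧ IsDiagonalPullback T p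

end Measure

section Holder

variable {d : ℕ}

/-- The test function `y ↦ lam ^ (-d) * φ ((x - y) / lam)`. -/
def rescale (φ : Test (EuclideanSpace ℝ (Fin d))) (x : EuclideanSpace ℝ (Fin d))
    (lam : ℝ) (hlam : 0 < lam) : Test (EuclideanSpace ℝ (Fin d)) where
  toFun y := (lam ^ d)⁻¹ * φ (lam⁻¹ • (x - y))
  contDiff' := contDiff_const.mul
    (φ.contDiff.comp ((contDiff_const.sub contDiff_id).const_smul lam⁻¹))
  hasCompactSupport' := by
    have h := φ.hasCompactSupport.comp_homeomorph
      ((Homeomorph.subLeft x).trans (Homeomorph.smulOfNeZero lam⁻¹ (inv_ne_zero hlam.ne')))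
    exact h.mul_left (f := fun _ => (lam ^ d)⁻¹)
  tsupport_subset' := fun _ _ => trivial

/-- The largest integer strictly less than `α`. -/
def strictFloor (α : ℝ) : ℤ := ⌈α⌉ - 1

theorem strictFloor_isGreatest (α : ℝ) : IsGreatest {n : ℤ | (n : ℝ) < α} (strictFloor α) := by
  constructor
  · have := Int.ceil_lt_add_one α
    simp only [strictFloor, Set.mem_ofPred_eq]
    push_cast
    linarith
  · intro n hn
    have : n < ⌈α⌉ := Int.lt_ceil.2 hn
    unfold strictFloor
    omega

/-- Test functions supported in the open unit ball, with `C^r` norm at most `1`. -/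
def unitTests (d r : ℕ) : Set (Test (EuclideanSpace ℝ (Fin d))) :=
  {φ | tsupport φ ⊆ Metric.ball 0 1 ∧ ∀ i ≤ r, ∀ x, ‖iteratedFDeriv ℝ i φ x‖ ≤ 1}

/-- The local Hölder space `C^α_loc` of negative exponent `α`. -/
def negHolderLoc (d : ℕ) (α : ℝ) : Set (Distr (EuclideanSpace ℝ (Fin d))) :=
  {u | ∀ K : Set (EuclideanSpace ℝ (Fin d)), IsCompact K → ∃ C : ℝ,
    ∀ x ∈ K, ∀ (lam : ℝ) (hlam : 0 < lam), lam ≤ 1 →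
      ∀ φ ∈ unitTests d (-strictFloor α).toNat,
        ‖u (rescale φ x lam hlam)‖ ≤ C * lam ^ α}

end Holder

end

end HolderProduct

open scoped Distributions ContDiff Topology

namespace HolderProduct

open scoped BoundedContinuousFunction
open MeasureTheory Filter Set

set_option linter.unusedSectionVars false

noncomputable section

/-! At every point one of the two factors is smooth, and a smooth function may multiply any
distribution. Take a smooth `χ` that is zero near singsupp f and one near singsupp g. Then f equals
a smooth function a near supp χ, and g a smooth function b near supp (1 - χ). The product is p = χ a
g + (1 - χ) b f (`exists_product`). Smooth multipliers preserve the Hölder bounds, and negative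
exponents only get weaker when added, since λ ≤ 1 (`exists_bound_pair_rescale_mul`).

To see that p is the pull-back of T = f ⊗ g, an approximating sequence is needed. The cone
`tensorCone` consists of the nonzero covectors over singsupp f × singsupp g and of those with a
vanishing component. Disjointness of the singular supports keeps it away from the conormals (ξ, -ξ).
It contains WF(T): where f = a, T is a(x) (1 ⊗ g), and 1 ⊗ g is invariant under translations in x.
Integration by parts then gives rapid decay wherever the first component of the covector controls
its norm; the other factor is symmetric. The estimates are uniform under small translations of the
cutoff, so mollifications of T, being averages of translates, converge in 𝓓'_Γ
(`IsIterated.tendstoIn_mollify`). For product kernels they are tensor products of mollifications of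
f and g, and their diagonal values converge to p.

The limit does not depend on the sequence (`TendstoIn.tendsto_integral_diagonal`). By Parseval,
integrating w against φ along the diagonal map D gives ∫ φ^(-D*ξ) w^(ξ) dξ. Near the conormals,
where |D*ξ| ≤ c|ξ|, the transforms w_j^ converge with all polynomial weights; elsewhere φ^(-D*ξ)
decays rapidly in ξ and weak convergence is enough. Sequences belonging to different admissible
cones are compared in the union of the cones.

Derivatives and integrals are moved through a distribution by factoring it, over a fixed compact
set, through a continuous functional on a Banach space of jets (`exists_extension_of_jet`). -/

/-- Smooth functions with compact support. -/
structure IsTest {E G : Type*} [NormedAddCommGroup E] [NormedSpace ℝ E] [NormedAddCommGroup G]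
    [NormedSpace ℝ G] (ψ : E → G) : Prop where
  smooth : ContDiff ℝ ∞ ψ
  compact : HasCompactSupport ψ

/-! ### Test functions of two variables as smooth curves in a Banach space. -/

section Curves

variable {X Y G : Type*} [NormedAddCommGroup X] [NormedSpace ℝ X] [NormedAddCommGroup Y]
  [NormedSpace ℝ Y] [NormedAddCommGroup G] [NormedSpace ℝ G]

open Classical in
/-- A compactly supported continuous function as a bounded continuous function
(zero if the function is not of this kind). -/
def toBCF (h : Y → G) : Y →ᵇ G :=
  if hh : Continuous h ∧ HasCompactSupport h then
    BoundedContinuousFunction.ofNormedAddCommGroup h hh.1 _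
      (hh.1.bounded_above_of_compact_support hh.2).choose_spec
  else 0

theorem toBCF_apply {h : Y → G} (hc : Continuous h) (hs : HasCompactSupport h) (y : Y) :
    toBCF h y = h y := by
  simp [toBCF, hc, hs]

theorem IsTest.continuous {ψ : Y → G} (h : IsTest ψ) : Continuous ψ := h.smooth.continuous

theorem IsTest.slice {Ψ : X × Y → G} (h : IsTest Ψ) (x : X) : IsTest (fun y => Ψ (x, y)) where
  smooth := h.smooth.comp (contDiff_const.prodMk contDiff_id)
  compact := by
    refine HasCompactSupport.intro (h.compact.isCompact.image continuous_snd) ?_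
    intro y hy
    by_contra hne
    exact hy ⟨(x, y), subset_tsupport _ hne, rfl⟩

theorem IsTest.swap {Ψ : X × Y → G} (h : IsTest Ψ) : IsTest (fun z : Y × X => Ψ (z.2, z.1)) where
  smooth := h.smooth.comp (contDiff_snd.prodMk contDiff_fst)
  compact := h.compact.comp_homeomorph (Homeomorph.prodComm Y X)

theorem IsTest.fderiv {ψ : Y → G} (h : IsTest ψ) : IsTest (fderiv ℝ ψ) where
  smooth := h.smooth.fderiv_right (by simp)
  compact := h.compact.fderiv ℝ

theorem IsTest.lineDeriv {ψ : Y → G} (h : IsTest ψ) (v : Y) :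
    IsTest (fun y => _root_.fderiv ℝ ψ y v) where
  smooth := h.fderiv.smooth.clm_apply contDiff_const
  compact := h.compact.fderiv_apply ℝ v

theorem IsTest.iteratedFDeriv {ψ : Y → G} (h : IsTest ψ) (i : ℕ) :
    IsTest (iteratedFDeriv ℝ i ψ) where
  smooth := h.smooth.iteratedFDeriv_right (m := ∞) (by exact_mod_cast le_top)
  compact := h.compact.iteratedFDeriv i

theorem IsTest.bounded {ψ : Y → G} (h : IsTest ψ) : ∃ C, 0 ≤ C ∧ ∀ y, ‖ψ y‖ ≤ C := by
  obtain ⟨C, hC⟩ := h.continuous.bounded_above_of_compact_support h.compact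
  exact ⟨C, (norm_nonneg _).trans (hC 0), hC⟩

theorem IsTest.bounded_iteratedFDeriv {ψ : Y → G} (h : IsTest ψ) (N : ℕ) :
    ∃ C, 0 ≤ C ∧ ∀ i ≤ N, ∀ y, ‖_root_.iteratedFDeriv ℝ i ψ y‖ ≤ C := by
  choose C hC0 hC using fun i => (h.iteratedFDeriv i).bounded
  refine ⟨∑ i ∈ Finset.range (N + 1), C i, Finset.sum_nonneg fun i _ => hC0 i, ?_⟩
  intro i hi y
  exact (hC i y).trans (Finset.single_le_sum (f := C) (fun i _ => hC0 i)
    (Finset.mem_range.2 (Nat.lt_succ_of_le hi)))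

/-- The curve `x ↦ Ψ (x, ·)` of bounded continuous functions. -/
def curve (Ψ : X × Y → G) (x : X) : Y →ᵇ G := toBCF fun y => Ψ (x, y)

theorem curve_apply {Ψ : X × Y → G} (h : IsTest Ψ) (x : X) (y : Y) : curve Ψ x y = Ψ (x, y) :=
  toBCF_apply (h.slice x).continuous (h.slice x).compact y

/-- The derivative of Ψ is uniformly continuous by compact support, so the mean value inequality
makes the remainder small uniformly in y. Finite dimension of `X` makes the candidate derivative
continuous. -/
theorem hasFDerivAt_curve [FiniteDimensional ℝ X] {Ψ : X × Y → G} (h : IsTest Ψ) (x : X) :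
    ∃ A : X →L[ℝ] (Y →ᵇ G), HasFDerivAt (curve Ψ) A x ∧
      ∀ v, A v = curve (fun z => fderiv ℝ Ψ z (v, 0)) x := by
  let A₀ : X →ₗ[ℝ] (Y →ᵇ G) :=
    { toFun := fun v => curve (fun z => fderiv ℝ Ψ z (v, 0)) x
      map_add' := by
        intro v w
        ext y
        simp only [BoundedContinuousFunction.coe_add, Pi.add_apply]
        rw [curve_apply (h.lineDeriv _), curve_apply (h.lineDeriv _), curve_apply (h.lineDeriv _),
          ← map_add]
        simp
      map_smul' := by
        intro c v
        ext y
        simp only [BoundedContinuousFunction.coe_smul, RingHom.id_apply]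
        rw [curve_apply (h.lineDeriv _), curve_apply (h.lineDeriv _), ← map_smul]
        simp }
  refine ⟨LinearMap.toContinuousLinearMap A₀, ?_, fun v => rfl⟩
  rw [hasFDerivAt_iff_isLittleO_nhds_zero, Asymptotics.isLittleO_iff]
  intro ε hε
  have huc := h.fderiv.compact.uniformContinuous_of_continuous h.fderiv.continuous
  obtain ⟨δ, hδ, hd⟩ := Metric.uniformContinuous_iff.1 huc ε hε
  filter_upwards [Metric.ball_mem_nhds (0 : X) hδ] with v hv
  rw [mem_ball_zero_iff] at hv
  rw [BoundedContinuousFunction.norm_le (by positivity)]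
  intro y
  simp only [BoundedContinuousFunction.coe_sub, Pi.sub_apply]
  change ‖curve Ψ (x + v) y - curve Ψ x y - curve (fun z => fderiv ℝ Ψ z (v, 0)) x y‖ ≤ _
  rw [curve_apply h, curve_apply h, curve_apply (h.lineDeriv _)]
  have key := (convex_ball (x, y) δ).norm_image_sub_le_of_norm_hasFDerivWithin_le' (C := ε)
    (f := Ψ) (f' := fderiv ℝ Ψ) (φ := fderiv ℝ Ψ (x, y)) (x := (x, y)) (y := (x + v, y))
    (fun z _ => (h.smooth.differentiable (by simp) z).hasFDerivAt.hasFDerivWithinAt)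
    (fun z hz => by
      rw [← dist_eq_norm]
      exact (hd hz).le) (Metric.mem_ball_self hδ) (by
      rw [Metric.mem_ball, dist_eq_norm]
      simpa using hv)
  simpa using key

/-- Directional derivatives of a curve are curves of partial derivatives, again test functions, so
induction on the order applies. -/
theorem contDiff_curve [FiniteDimensional ℝ X] {Ψ : X × Y → G} (h : IsTest Ψ) :
    ContDiff ℝ ∞ (curve Ψ) := by
  rw [contDiff_infty]
  intro n
  induction n generalizing Ψ with
  | zero =>
    rw [Nat.cast_zero, contDiff_zero, continuous_iff_continuousAt]
    intro x
    obtain ⟨A, hA, -⟩ := hasFDerivAt_curve h x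
    exact hA.continuousAt
  | succ n ih =>
    push_cast
    rw [contDiff_succ_iff_fderiv_apply]
    refine ⟨fun x => ?_, by simp, fun v => ?_⟩
    · obtain ⟨A, hA, -⟩ := hasFDerivAt_curve h x
      exact hA.differentiableAt
    · have : (fun x => fderiv ℝ (curve Ψ) x v) = curve (fun z => fderiv ℝ Ψ z (v, 0)) := by
        ext1 x
        obtain ⟨A, hA, hv⟩ := hasFDerivAt_curve h x
        rw [hA.fderiv, hv]
      rw [this]
      exact ih (h.lineDeriv _)

theorem iteratedFDeriv_curve_apply [FiniteDimensional ℝ X] {Ψ : X × Y → G} (h : IsTest Ψ) (k : ℕ)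
    (x : X) (m : Fin k → X) (y : Y) :
    iteratedFDeriv ℝ k (curve Ψ) x m y = iteratedFDeriv ℝ k (fun x => Ψ (x, y)) x m := by
  have h1 : (fun x => Ψ (x, y)) = BoundedContinuousFunction.evalCLM ℝ y ∘ curve Ψ := by
    ext x
    simp [curve_apply h]
  rw [h1, ContinuousLinearMap.iteratedFDeriv_comp_left _
    ((contDiff_curve h).contDiffAt (x := x)) (i := k) (by exact_mod_cast le_top)]
  simp

end Curves

/-! ### Complex-linear extension of distributions to complex test functions. -/

section Pairing

variable {E : Type*} [NormedAddCommGroup E] [NormedSpace ℝ E]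

theorem IsTest.re {ψ : E → ℂ} (h : IsTest ψ) : IsTest (fun x => (ψ x).re) where
  smooth := Complex.reCLM.contDiff.comp h.smooth
  compact := h.compact.comp_left (g := Complex.re) rfl

theorem IsTest.im {ψ : E → ℂ} (h : IsTest ψ) : IsTest (fun x => (ψ x).im) where
  smooth := Complex.imCLM.contDiff.comp h.smooth
  compact := h.compact.comp_left (g := Complex.im) rfl

theorem IsTest.ofReal {φ : E → ℝ} (h : IsTest φ) : IsTest (fun x => (φ x : ℂ)) where
  smooth := Complex.ofRealCLM.contDiff.comp h.smooth
  compact := h.compact.comp_left (g := ((↑) : ℝ → ℂ)) rfl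

theorem isTest_test (φ : Test E) : IsTest φ := ⟨φ.contDiff, φ.hasCompactSupport⟩

theorem IsTest.add {G : Type*} [NormedAddCommGroup G] [NormedSpace ℝ G] {ψ χ : E → G}
    (h : IsTest ψ) (h' : IsTest χ) : IsTest (fun x => ψ x + χ x) where
  smooth := h.smooth.add h'.smooth
  compact := h.compact.add h'.compact

theorem IsTest.mul {ψ χ : E → ℂ} (h : IsTest ψ) (h' : ContDiff ℝ ∞ χ) :
    IsTest (fun x => ψ x * χ x) where
  smooth := h.smooth.mul h'
  compact := h.compact.mul_right

theorem IsTest.mul_left {ψ χ : E → ℂ} (h : IsTest ψ) (h' : ContDiff ℝ ∞ χ) :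
    IsTest (fun x => χ x * ψ x) where
  smooth := h'.mul h.smooth
  compact := h.compact.mul_left

theorem isTest_zero {G : Type*} [NormedAddCommGroup G] [NormedSpace ℝ G] :
    IsTest (fun _ : E => (0 : G)) where
  smooth := contDiff_const
  compact := HasCompactSupport.zero

/-- Bundling of a real test function. -/
def toTest (φ : E → ℝ) (h : IsTest φ) : Test E where
  toFun := φ
  contDiff' := h.smooth
  hasCompactSupport' := h.compact
  tsupport_subset' := fun _ _ => trivial

@[simp]
theorem toTest_apply (φ : E → ℝ) (h : IsTest φ) (x : E) : toTest φ h x = φ x := rfl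

open Classical in
/-- The `ℂ`-linear extension of a distribution to complex test functions. -/
def pair (u : Distr E) (ψ : E → ℂ) : ℂ :=
  if h : IsTest ψ then u (toTest _ h.re) + Complex.I * u (toTest _ h.im) else 0

theorem pair_eq (u : Distr E) {ψ : E → ℂ} (h : IsTest ψ) :
    pair u ψ = u (toTest _ h.re) + Complex.I * u (toTest _ h.im) := by
  simp [pair, h]

theorem pair_ofReal (u : Distr E) (φ : Test E) : pair u (fun x => (φ x : ℂ)) = u φ := by
  rw [pair_eq u (isTest_test φ).ofReal]
  have h1 : toTest (fun x => ((φ x : ℂ)).re) (isTest_test φ).ofReal.re = φ := by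
    ext x; simp
  have h2 : toTest (fun x => ((φ x : ℂ)).im) (isTest_test φ).ofReal.im = 0 := by
    ext x; simp
  rw [h1, h2]
  simp

theorem pair_add (u : Distr E) {ψ χ : E → ℂ} (h : IsTest ψ) (h' : IsTest χ) :
    pair u (fun x => ψ x + χ x) = pair u ψ + pair u χ := by
  rw [pair_eq u h, pair_eq u h', pair_eq u (h.add h')]
  have h1 : toTest _ (h.add h').re = toTest _ h.re + toTest _ h'.re := by
    ext x; simp
  have h2 : toTest _ (h.add h').im = toTest _ h.im + toTest _ h'.im := by
    ext x; simp
  rw [h1, h2, map_add, map_add]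
  ring

theorem IsTest.const_mul {ψ : E → ℂ} (h : IsTest ψ) (c : ℂ) : IsTest (fun x => c * ψ x) :=
  h.mul_left contDiff_const

theorem pair_const_mul (u : Distr E) {ψ : E → ℂ} (h : IsTest ψ) (c : ℂ) :
    pair u (fun x => c * ψ x) = c * pair u ψ := by
  rw [pair_eq u h, pair_eq u (h.const_mul c)]
  have h1 : toTest _ (h.const_mul c).re = c.re • toTest _ h.re - c.im • toTest _ h.im := by
    ext x; simp
  have h2 : toTest _ (h.const_mul c).im = c.re • toTest _ h.im + c.im • toTest _ h.re := by
    ext x; simp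
  rw [h1, h2, map_add, map_sub, map_smul, map_smul, map_smul, map_smul]
  simp only [Complex.real_smul]
  conv_rhs => rw [← Complex.re_add_im c]
  linear_combination (-(c.im : ℂ) * u (toTest _ h.im)) * Complex.I_sq

theorem pair_sub (u : Distr E) {ψ χ : E → ℂ} (h : IsTest ψ) (h' : IsTest χ) :
    pair u (fun x => ψ x - χ x) = pair u ψ - pair u χ := by
  have := pair_add u h (h'.const_mul (-1))
  rw [pair_const_mul u h'] at this
  simpa [sub_eq_add_neg] using this

theorem pair_zero (u : Distr E) : pair u (fun _ => 0) = 0 := by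
  have := pair_const_mul u (isTest_zero (E := E)) 0
  simpa using this

/-- The exponential `x ↦ exp (- i ξ x)`. -/
def expChar (ξ : E →L[ℝ] ℝ) (x : E) : ℂ := Complex.exp (-(Complex.I * (ξ x : ℂ)))

theorem contDiff_expChar (ξ : E →L[ℝ] ℝ) : ContDiff ℝ ∞ (expChar ξ) :=
  (contDiff_const.mul (Complex.ofRealCLM.contDiff.comp ξ.contDiff)).neg.cexp

theorem norm_expChar (ξ : E →L[ℝ] ℝ) (x : E) : ‖expChar ξ x‖ = 1 := by
  rw [expChar, show -(Complex.I * (ξ x : ℂ)) = ((-(ξ x) : ℝ) : ℂ) * Complex.I by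
    push_cast; ring]
  exact Complex.norm_exp_ofReal_mul_I _

theorem localFourier_eq_pair (u : Distr E) (φ : Test E) (ξ : E →L[ℝ] ℝ) :
    localFourier u φ ξ = pair u (fun x => (φ x : ℂ) * expChar ξ x) := by
  rw [localFourier, ← pair_ofReal, ← pair_ofReal, ← pair_const_mul u (isTest_test _).ofReal,
    ← pair_sub u (isTest_test _).ofReal ((isTest_test _).ofReal.const_mul _)]
  congr 1
  ext x
  have h1 : mulSmooth φ (fun x => Real.cos (ξ x)) (contDiff_cos_clm ξ) x
    = φ x * Real.cos (ξ x) := rfl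
  have h2 : mulSmooth φ (fun x => Real.sin (ξ x)) (contDiff_sin_clm ξ) x
    = φ x * Real.sin (ξ x) := rfl
  rw [h1, h2, expChar, show -(Complex.I * (ξ x : ℂ)) = -(ξ x : ℂ) * Complex.I by ring,
    Complex.exp_mul_I]
  push_cast
  rw [Complex.cos_neg, Complex.sin_neg]
  ring

end Pairing

/-! ### Local finite order, and factorization through jets. -/

section Representation

variable {E : Type*} [NormedAddCommGroup E] [NormedSpace ℝ E]

/-- The space of jets of order `M` of bounded functions. -/
def JetSpace (E : Type*) [NormedAddCommGroup E] [NormedSpace ℝ E] (M : ℕ) : Type _ :=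
  (i : Fin (M + 1)) → (E →ᵇ (E [×i.1]→L[ℝ] ℂ))

set_option synthInstance.maxHeartbeats 200000 in
instance (M : ℕ) : NormedAddCommGroup (JetSpace E M) :=
  inferInstanceAs (NormedAddCommGroup ((i : Fin (M + 1)) → (E →ᵇ (E [×i.1]→L[ℝ] ℂ))))

set_option synthInstance.maxHeartbeats 200000 in
instance (M : ℕ) : NormedSpace ℝ (JetSpace E M) :=
  inferInstanceAs (NormedSpace ℝ ((i : Fin (M + 1)) → (E →ᵇ (E [×i.1]→L[ℝ] ℂ))))

set_option synthInstance.maxHeartbeats 200000 in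
instance (M : ℕ) : CompleteSpace (JetSpace E M) :=
  inferInstanceAs (CompleteSpace ((i : Fin (M + 1)) → (E →ᵇ (E [×i.1]→L[ℝ] ℂ))))

/-- The coordinates of a jet. -/
def JetSpace.proj (M : ℕ) (i : Fin (M + 1)) : JetSpace E M →L[ℝ] (E →ᵇ (E [×i.1]→L[ℝ] ℂ)) :=
  ContinuousLinearMap.proj (R := ℝ) (φ := fun i : Fin (M + 1) => (E →ᵇ (E [×i.1]→L[ℝ] ℂ))) i

theorem JetSpace.norm_le {M : ℕ} {J : JetSpace E M} {B : ℝ} (hB : 0 ≤ B)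
    (h : ∀ i, ‖JetSpace.proj M i J‖ ≤ B) : ‖J‖ ≤ B :=
  (pi_norm_le_iff_of_nonneg (x := (J : (i : Fin (M + 1)) → (E →ᵇ (E [×i.1]→L[ℝ] ℂ)))) hB).2 h

theorem JetSpace.norm_proj_le {M : ℕ} (J : JetSpace E M) (i : Fin (M + 1)) :
    ‖JetSpace.proj M i J‖ ≤ ‖J‖ :=
  norm_le_pi_norm (f := (J : (i : Fin (M + 1)) → (E →ᵇ (E [×i.1]→L[ℝ] ℂ)))) i

theorem JetSpace.ext {M : ℕ} {J J' : JetSpace E M}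
    (h : ∀ i, JetSpace.proj M i J = JetSpace.proj M i J') : J = J' :=
  funext h

/-- Evaluation of a coordinate of a jet at a point. -/
def JetSpace.eval (M : ℕ) (i : Fin (M + 1)) (y : E) : JetSpace E M →L[ℝ] (E [×i.1]→L[ℝ] ℂ) :=
  LinearMap.mkContinuous
    { toFun := fun J => JetSpace.proj M i J y
      map_add' := fun _ _ => rfl
      map_smul' := fun _ _ => rfl } 1 (fun J => by
      rw [one_mul]
      exact (BoundedContinuousFunction.norm_coe_le_norm _ _).trans (JetSpace.norm_proj_le _ _))

/-- The jet of order `M` of a test function. -/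
def jet (M : ℕ) (ψ : E → ℂ) : JetSpace E M := fun i => toBCF (iteratedFDeriv ℝ i.1 ψ)

theorem proj_jet (M : ℕ) (ψ : E → ℂ) (i : Fin (M + 1)) :
    JetSpace.proj M i (jet M ψ) = toBCF (iteratedFDeriv ℝ i.1 ψ) := rfl

open TopologicalSpace (Compacts)

/-- Continuity on functions supported in `K` gives a bound by finitely many derivatives. Hence the
pairing is a bounded functional on the image of the jet map, and Hahn–Banach extends it to the whole
Banach space. -/
theorem exists_extension_of_jet (u : Distr E) {K : Set E} (hK : IsCompact K) :
    ∃ (M : ℕ) (L : JetSpace E M →L[ℝ] ℂ),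
      ∀ ψ : E → ℂ, IsTest ψ → tsupport ψ ⊆ K → pair u ψ = L (jet M ψ) := by
  let K' : Compacts E := ⟨K, hK⟩
  have hKtop : (K' : Set E) ⊆ (⊤ : TopologicalSpace.Opens E) := fun _ _ => trivial
  let u' : Test E →L[ℝ] ℂ := u
  let ℓ : 𝓓_{K'}(E, ℂ) →L[ℝ] ℂ :=
    u' ∘L (TestFunction.ofSupportedInCLM ℝ hKtop) ∘L
      (ContDiffMapSupportedIn.postcompCLM Complex.reCLM) +
    Complex.I • (u' ∘L (TestFunction.ofSupportedInCLM ℝ hKtop) ∘L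
      (ContDiffMapSupportedIn.postcompCLM Complex.imCLM))
  have hℓ : ∀ (ψ : 𝓓_{K'}(E, ℂ)), ℓ ψ = pair u ψ := by
    intro ψ
    rw [pair_eq u ⟨ψ.contDiff, ψ.hasCompactSupport⟩]
    rfl
  obtain ⟨s, C, -, hC⟩ := Seminorm.bound_of_continuous
    (ContDiffMapSupportedIn.withSeminorms' ℝ E ℂ ⊤ K') ((normSeminorm ℝ ℂ).comp ℓ.toLinearMap)
    (continuous_norm.comp ℓ.continuous)
  let M := s.sup id
  have htest : ∀ ψ : 𝓓_{K'}(E, ℂ), IsTest (ψ : E → ℂ) := fun ψ => ⟨ψ.contDiff, ψ.hasCompactSupport⟩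
  have hproj : ∀ (ψ : 𝓓_{K'}(E, ℂ)) (i : Fin (M + 1)) (x : E),
      JetSpace.proj M i (jet M ψ) x = iteratedFDeriv ℝ i.1 ψ x := fun ψ i x => by
    rw [proj_jet, toBCF_apply ((htest ψ).iteratedFDeriv _).continuous
      ((htest ψ).iteratedFDeriv _).compact]
  let J : 𝓓_{K'}(E, ℂ) →ₗ[ℝ] JetSpace E M :=
    { toFun := fun ψ => jet M ψ
      map_add' := by
        intro ψ χ
        refine JetSpace.ext fun i => ?_
        ext1 x
        rw [map_add, BoundedContinuousFunction.add_apply, hproj, hproj, hproj]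
        exact iteratedFDeriv_add_apply (ψ.contDiff.contDiffAt.of_le (by exact_mod_cast le_top))
          (χ.contDiff.contDiffAt.of_le (by exact_mod_cast le_top))
      map_smul' := by
        intro c ψ
        refine JetSpace.ext fun i => ?_
        ext1 x
        rw [RingHom.id_apply, map_smul, BoundedContinuousFunction.smul_apply, hproj, hproj]
        exact iteratedFDeriv_const_smul_apply
          (ψ.contDiff.contDiffAt.of_le (by exact_mod_cast le_top)) }
  -- The zeroth coordinate of the jet recovers the function.
  have hJ : Function.Injective J := by
    intro ψ χ h
    ext x
    have h0 := congrArg (fun j : JetSpace E M => JetSpace.proj M 0 j x 0) h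
    change JetSpace.proj M 0 (jet M ψ) x 0 = JetSpace.proj M 0 (jet M χ) x 0 at h0
    rw [hproj, hproj] at h0
    exact h0
  let e := LinearEquiv.ofInjective J hJ
  let g₀ : LinearMap.range J →L[ℝ] ℂ := (ℓ.toLinearMap ∘ₗ e.symm.toLinearMap).mkContinuous C (by
    intro j
    obtain ⟨ψ, rfl⟩ := e.surjective j
    have h1 : ‖ℓ ψ‖ ≤ C * (s.sup (ContDiffMapSupportedIn.supSeminorm ℝ E ℂ ⊤ K')) ψ := hC ψ
    have h2 : (s.sup (ContDiffMapSupportedIn.supSeminorm ℝ E ℂ ⊤ K')) ψ ≤ ‖jet M ψ‖ := by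
      refine Seminorm.finset_sup_apply_le (norm_nonneg _) fun n hn => ?_
      refine Seminorm.finset_sup_apply_le (norm_nonneg _) fun i hi => ?_
      have hi' : i < M + 1 := Nat.lt_succ_of_le ((Finset.mem_Iic.1 hi).trans
        (Finset.le_sup (f := id) hn))
      refine (ContDiffMapSupportedIn.seminorm_top_le_iff ℝ (norm_nonneg _) i ψ).2 fun x _ => ?_
      rw [← hproj ψ ⟨i, hi'⟩ x]
      exact (BoundedContinuousFunction.norm_coe_le_norm _ _).trans (JetSpace.norm_proj_le _ _)
    change ‖ℓ (e.symm (e ψ))‖ ≤ C * ‖jet M ψ‖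
    rw [LinearEquiv.symm_apply_apply]
    exact h1.trans (mul_le_mul_of_nonneg_left h2 C.2))
  obtain ⟨L, hL⟩ := g₀.exist_extension_of_finiteDimensional_range
  refine ⟨M, L, fun ψ hψ hK => ?_⟩
  let ψ' : 𝓓_{K'}(E, ℂ) :=
    ContDiffMapSupportedIn.of_support_subset hψ.smooth ((subset_tsupport _).trans hK)
  have h3 : L (jet M ψ) = g₀ (e ψ') := by
    rw [hL]
    rfl
  rw [h3]
  change pair u ψ' = ℓ (e.symm (e ψ'))
  rw [LinearEquiv.symm_apply_apply, hℓ]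

end Representation

/-! ### Pairings depending on a parameter: smoothness, bounds, integration. -/

section Parameters

variable {X E G : Type*} [NormedAddCommGroup X] [NormedSpace ℝ X] [NormedAddCommGroup E]
  [NormedSpace ℝ E] [NormedAddCommGroup G] [NormedSpace ℝ G]

theorem norm_iteratedFDeriv_isometry_comp_le {A B : Type*} [NormedAddCommGroup A] [NormedSpace ℝ A]
    [NormedAddCommGroup B] [NormedSpace ℝ B] (f : E → A) (g : E → B) (e : A → B)
    (hadd : ∀ x y, e (x + y) = e x + e y) (hsmul : ∀ (c : ℝ) x, e (c • x) = c • e x)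
    (hnorm : ∀ x, ‖e x‖ = ‖x‖) (hf : ContDiff ℝ ∞ f) (hg : g = e ∘ f) (k : ℕ) (x : E) :
    ‖iteratedFDeriv ℝ k g x‖ ≤ ‖iteratedFDeriv ℝ k f x‖ := by
  let e' : A →ₗᵢ[ℝ] B := ⟨⟨⟨e, hadd⟩, hsmul⟩, hnorm⟩
  have : g = e' ∘ f := hg
  rw [this, LinearIsometry.norm_iteratedFDeriv_comp_left _ hf.contDiffAt
    (by exact_mod_cast le_top)]

/-- Currying is an isometry, so the inner derivatives can be moved to the outer ones one at a time.
-/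
theorem norm_iteratedFDeriv_iteratedFDeriv_le {f : E → G} (hf : ContDiff ℝ ∞ f) (k i : ℕ) (x : E) :
    ‖iteratedFDeriv ℝ k (iteratedFDeriv ℝ i f) x‖ ≤ ‖iteratedFDeriv ℝ (k + i) f x‖ := by
  induction i generalizing k with
  | zero =>
    rw [iteratedFDeriv_zero_eq_comp, LinearIsometryEquiv.norm_iteratedFDeriv_comp_left]
    rfl
  | succ i ih =>
    have hs : ContDiff ℝ ∞ (fderiv ℝ (iteratedFDeriv ℝ i f)) :=
      (hf.iteratedFDeriv_right (m := ∞) (by exact_mod_cast le_top)).fderiv_right (by simp)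
    have h1 : ‖iteratedFDeriv ℝ k (iteratedFDeriv ℝ (i + 1) f) x‖ ≤
        ‖iteratedFDeriv ℝ k (fderiv ℝ (iteratedFDeriv ℝ i f)) x‖ := by
      refine norm_iteratedFDeriv_isometry_comp_le _ _
        ((continuousMultilinearCurryLeftEquiv ℝ (fun _ : Fin (i + 1) => E) G).symm)
        ?_ ?_ ?_ hs iteratedFDeriv_succ_eq_comp_left k x
      · exact map_add _
      · exact map_smul _
      · exact LinearIsometryEquiv.norm_map _
    rw [norm_iteratedFDeriv_fderiv] at h1
    refine (h1.trans (ih (k + 1))).trans (le_of_eq ?_)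
    rw [show k + 1 + i = k + (i + 1) by omega]

theorem iteratedFDeriv_comp_affine {f : E → G} (h : ContDiff ℝ ∞ f) (A : X →L[ℝ] E) (c : E)
    (k : ℕ) (x : X) :
    iteratedFDeriv ℝ k (fun x => f (c + A x)) x =
      (iteratedFDeriv ℝ k f (c + A x)).compContinuousLinearMap (fun _ => A) := by
  have hc : ContDiff ℝ ∞ (fun z => f (c + z)) := h.comp (contDiff_const.add contDiff_id)
  have h2 := A.iteratedFDeriv_comp_right hc x (i := k) (by exact_mod_cast le_top)
  rw [iteratedFDeriv_comp_add_left] at h2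
  exact h2

theorem norm_iteratedFDeriv_comp_affine_le {f : E → G} (h : ContDiff ℝ ∞ f) (A : X →L[ℝ] E)
    (c : E) (k : ℕ) (x : X) :
    ‖iteratedFDeriv ℝ k (fun x => f (c + A x)) x‖ ≤
      ‖iteratedFDeriv ℝ k f (c + A x)‖ * ‖A‖ ^ k := by
  rw [iteratedFDeriv_comp_affine h]
  refine (ContinuousMultilinearMap.norm_compContinuousLinearMap_le _ _).trans ?_
  simp

theorem norm_iteratedFDeriv_slice_le {Ψ : X × E → G} (h : ContDiff ℝ ∞ Ψ) (k : ℕ) (x : X) (y : E) :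
    ‖iteratedFDeriv ℝ k (fun y => Ψ (x, y)) y‖ ≤ ‖iteratedFDeriv ℝ k Ψ (x, y)‖ := by
  have h1 := norm_iteratedFDeriv_comp_affine_le h (ContinuousLinearMap.inr ℝ X E) (x, 0) k y
  simp only [ContinuousLinearMap.inr_apply, Prod.mk_add_mk, add_zero, zero_add] at h1
  refine h1.trans (mul_le_of_le_one_right (norm_nonneg _) (pow_le_one₀ (norm_nonneg _) ?_))
  refine ContinuousLinearMap.opNorm_le_bound _ zero_le_one fun v => ?_
  simp [Prod.norm_def]

theorem norm_iteratedFDeriv_slice_fst_le {Ψ : X × E → G} (h : ContDiff ℝ ∞ Ψ) (k : ℕ) (x : X)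
    (y : E) :
    ‖iteratedFDeriv ℝ k (fun x => Ψ (x, y)) x‖ ≤ ‖iteratedFDeriv ℝ k Ψ (x, y)‖ := by
  have h1 := norm_iteratedFDeriv_comp_affine_le h (ContinuousLinearMap.inl ℝ X E) (0, y) k x
  simp only [ContinuousLinearMap.inl_apply, Prod.mk_add_mk, add_zero, zero_add] at h1
  refine h1.trans (mul_le_of_le_one_right (norm_nonneg _) (pow_le_one₀ (norm_nonneg _) ?_))
  refine ContinuousLinearMap.opNorm_le_bound _ zero_le_one fun v => ?_
  simp [Prod.norm_def]

theorem iteratedFDeriv_slice {Ψ : X × E → G} (h : ContDiff ℝ ∞ Ψ) (k : ℕ) (x : X) (y : E) :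
    iteratedFDeriv ℝ k (fun y => Ψ (x, y)) y =
      (iteratedFDeriv ℝ k Ψ (x, y)).compContinuousLinearMap
        (fun _ => ContinuousLinearMap.inr ℝ X E) := by
  have h1 := iteratedFDeriv_comp_affine h (ContinuousLinearMap.inr ℝ X E) (x, 0) k y
  simpa using h1

/-- The partial derivatives of order `k` in the second variable. -/
def partialDeriv (k : ℕ) (Ψ : X × E → G) (z : X × E) : E [×k]→L[ℝ] G :=
  iteratedFDeriv ℝ k (fun y => Ψ (z.1, y)) z.2

theorem partialDeriv_eq {Ψ : X × E → G} (h : ContDiff ℝ ∞ Ψ) (k : ℕ) :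
    partialDeriv k Ψ = (ContinuousMultilinearMap.compContinuousLinearMapL
      (fun _ => ContinuousLinearMap.inr ℝ X E)) ∘ iteratedFDeriv ℝ k Ψ := by
  ext1 z
  exact iteratedFDeriv_slice h k z.1 z.2

theorem IsTest.partialDeriv {Ψ : X × E → G} (h : IsTest Ψ) (k : ℕ) :
    IsTest (partialDeriv k Ψ) := by
  rw [partialDeriv_eq h.smooth]
  exact ⟨(ContinuousLinearMap.contDiff _).comp (h.iteratedFDeriv k).smooth,
    (h.iteratedFDeriv k).compact.comp_left (map_zero _)⟩

theorem tsupport_slice_subset {Ψ : X × E → G} (h : IsTest Ψ) (x : X) :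
    tsupport (fun y => Ψ (x, y)) ⊆ Prod.snd '' tsupport Ψ := by
  refine closure_minimal ?_ (h.compact.isCompact.image continuous_snd).isClosed
  intro y hy
  exact ⟨(x, y), subset_tsupport _ hy, rfl⟩

theorem slice_eq_zero {Ψ : X × E → G} {x : X} (hx : x ∉ Prod.fst '' tsupport Ψ) :
    (fun y => Ψ (x, y)) = fun _ => 0 := by
  ext y
  by_contra hne
  exact hx ⟨(x, y), subset_tsupport _ hne, rfl⟩

theorem exists_bound_pair (u : Distr E) {K : Set E} (hK : IsCompact K) :
    ∃ (M : ℕ) (C : ℝ), 0 ≤ C ∧ ∀ ψ : E → ℂ, IsTest ψ → tsupport ψ ⊆ K → ∀ B, 0 ≤ B →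
      (∀ i ≤ M, ∀ y, ‖iteratedFDeriv ℝ i ψ y‖ ≤ B) → ‖pair u ψ‖ ≤ C * B := by
  obtain ⟨M, L, hL⟩ := exists_extension_of_jet u hK
  refine ⟨M, ‖L‖, norm_nonneg _, fun ψ hψ hs B hB hb => ?_⟩
  rw [hL ψ hψ hs]
  refine (L.le_opNorm _).trans (mul_le_mul_of_nonneg_left ?_ (norm_nonneg _))
  refine JetSpace.norm_le hB fun i => ?_
  rw [proj_jet, BoundedContinuousFunction.norm_le hB]
  intro y
  rw [toBCF_apply (hψ.iteratedFDeriv _).continuous (hψ.iteratedFDeriv _).compact]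
  exact hb _ (Nat.lt_succ_iff.1 i.2) y

theorem contDiff_jet_slice [FiniteDimensional ℝ X] {Ψ : X × E → ℂ} (h : IsTest Ψ) (M : ℕ) :
    ContDiff ℝ ∞ (fun x => jet M (fun y => Ψ (x, y))) :=
  contDiff_pi (𝕜 := ℝ) (ι := Fin (M + 1)) (F' := fun i => (E →ᵇ (E [×i.1]→L[ℝ] ℂ)))
    |>.2 fun i => contDiff_curve (h.partialDeriv i.1)

/-- The jets of the slices form a smooth curve in a Banach space, to which a fixed continuous linear
functional is applied. -/
theorem contDiff_pair_slice [FiniteDimensional ℝ X] (u : Distr E) {Ψ : X × E → ℂ}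
    (h : IsTest Ψ) : ContDiff ℝ ∞ (fun x => pair u (fun y => Ψ (x, y))) := by
  obtain ⟨M, L, hL⟩ := exists_extension_of_jet u (h.compact.isCompact.image continuous_snd)
  have : (fun x => pair u (fun y => Ψ (x, y))) = L ∘ (fun x => jet M (fun y => Ψ (x, y))) := by
    ext x
    exact hL _ (h.slice x) (tsupport_slice_subset h x)
  rw [this]
  exact L.contDiff.comp (contDiff_jet_slice h M)

theorem isTest_pair_slice [FiniteDimensional ℝ X] (u : Distr E) {Ψ : X × E → ℂ}
    (h : IsTest Ψ) : IsTest (fun x => pair u (fun y => Ψ (x, y))) where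
  smooth := contDiff_pair_slice u h
  compact := by
    refine HasCompactSupport.intro (h.compact.isCompact.image continuous_fst) fun x hx => ?_
    rw [slice_eq_zero hx, pair_zero]

theorem jet_zero (M : ℕ) : jet M (fun _ : E => (0 : ℂ)) = 0 := by
  refine JetSpace.ext fun i => ?_
  rw [proj_jet, map_zero]
  ext1 y
  rw [toBCF_apply (isTest_zero.iteratedFDeriv _).continuous (isTest_zero.iteratedFDeriv _).compact]
  simp [iteratedFDeriv_fun_zero]

/-- Bound on the derivatives of `x ↦ u (Ψ (x, ·))`. -/
theorem exists_bound_pair_slice [FiniteDimensional ℝ X] (u : Distr E) {K : Set E}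
    (hK : IsCompact K) (k : ℕ) :
    ∃ (M : ℕ) (C : ℝ), 0 ≤ C ∧ ∀ Ψ : X × E → ℂ, IsTest Ψ → Prod.snd '' tsupport Ψ ⊆ K →
      ∀ B, 0 ≤ B → (∀ i ≤ M, ∀ z, ‖iteratedFDeriv ℝ i Ψ z‖ ≤ B) →
      ∀ x, ‖iteratedFDeriv ℝ k (fun x => pair u (fun y => Ψ (x, y))) x‖ ≤ C * B := by
  obtain ⟨M, L, hL⟩ := exists_extension_of_jet u hK
  -- `k` derivatives in the parameter come on top of the `M` derivatives that the distribution sees.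
  refine ⟨k + M, ‖L‖, norm_nonneg _, fun Ψ h hs B hB hb x => ?_⟩
  have h1 : (fun x => pair u (fun y => Ψ (x, y))) = L ∘ (fun x => jet M (fun y => Ψ (x, y))) := by
    ext x
    exact hL _ (h.slice x) ((tsupport_slice_subset h x).trans hs)
  rw [h1]
  refine (L.norm_iteratedFDeriv_comp_left (contDiff_jet_slice h M).contDiffAt
    (n := k) (by exact_mod_cast le_top)).trans (mul_le_mul_of_nonneg_left ?_ (norm_nonneg _))
  refine ContinuousMultilinearMap.opNorm_le_bound hB fun m => ?_
  refine JetSpace.norm_le (by positivity) fun i => ?_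
  rw [BoundedContinuousFunction.norm_le (by positivity)]
  intro y
  have h2 : JetSpace.proj M i (iteratedFDeriv ℝ k (fun x => jet M fun y => Ψ (x, y)) x m) y =
      iteratedFDeriv ℝ k (curve (partialDeriv i.1 Ψ)) x m y := by
    have h3 := (JetSpace.eval (E := E) M i y).iteratedFDeriv_comp_left
      ((contDiff_jet_slice h M).contDiffAt (x := x)) (i := k) (by exact_mod_cast le_top)
    have h4 := congrArg (fun q => q m) h3
    refine h4.symm.trans ?_
    have h5 : (JetSpace.eval M i y ∘ fun x => jet M fun y => Ψ (x, y)) =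
        fun x => partialDeriv i.1 Ψ (x, y) := by
      ext1 x
      exact curve_apply (h.partialDeriv _) x y
    rw [h5, iteratedFDeriv_curve_apply (h.partialDeriv _)]
  rw [h2]
  rw [iteratedFDeriv_curve_apply (h.partialDeriv _)]
  refine (ContinuousMultilinearMap.le_opNorm _ _).trans
    (mul_le_mul_of_nonneg_right ?_ (by positivity))
  refine (norm_iteratedFDeriv_slice_fst_le (h.partialDeriv _).smooth _ _ _).trans ?_
  rw [partialDeriv_eq h.smooth]
  refine (ContinuousLinearMap.norm_iteratedFDeriv_comp_left _
    (h.iteratedFDeriv i.1).smooth.contDiffAt (n := k) (by exact_mod_cast le_top)).trans ?_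
  refine (mul_le_of_le_one_left (norm_nonneg _) ?_).trans
    ((norm_iteratedFDeriv_iteratedFDeriv_le h.smooth _ _ _).trans <| hb _ (Nat.add_le_add_left (Nat.lt_succ_iff.1 i.2) k) _)
  refine (ContinuousMultilinearMap.norm_compContinuousLinearMapL_le _ _).trans ?_
  refine Finset.prod_le_one (fun _ _ => norm_nonneg _) fun _ _ => ?_
  refine ContinuousLinearMap.opNorm_le_bound _ zero_le_one fun v => ?_
  simp [Prod.norm_def]

section Integral

variable [FiniteDimensional ℝ X] [FiniteDimensional ℝ E] [MeasurableSpace X] [BorelSpace X]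
  (μ : Measure X) [IsLocallyFiniteMeasure μ]

/-- Integration over a set as a continuous functional on bounded continuous functions. -/
def setIntegralBCF (μ : Measure X) (K : Set X) [IsFiniteMeasure (μ.restrict K)] :
    (X →ᵇ ℂ) →L[ℝ] ℂ :=
  LinearMap.mkContinuous
    { toFun := fun h => ∫ x in K, h x ∂μ
      map_add' := fun h h' => integral_add (h.integrable _) (h'.integrable _)
      map_smul' := fun c h => integral_smul c _ } ((μ.restrict K).real univ) (fun h => by
      rw [mul_comm]
      exact norm_integral_le_of_norm_le_const (ae_of_all _ h.norm_coe_le_norm))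

theorem setIntegralBCF_apply (K : Set X) [IsFiniteMeasure (μ.restrict K)] (h : X →ᵇ ℂ) :
    setIntegralBCF μ K h = ∫ x in K, h x ∂μ := rfl

theorem integral_slice_eq {Ψ : X × E → ℂ} (h : IsTest Ψ) {K : Set X}
    (hs : Prod.fst '' tsupport Ψ ⊆ K) [IsFiniteMeasure (μ.restrict K)] :
    (fun y => ∫ x, Ψ (x, y) ∂μ) =
      setIntegralBCF μ K ∘ curve (fun z : E × X => Ψ (z.2, z.1)) := by
  ext y
  rw [Function.comp_apply, setIntegralBCF_apply]
  simp_rw [curve_apply h.swap]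
  rw [setIntegral_eq_integral_of_forall_compl_eq_zero]
  intro x hx
  by_contra hne
  exact hx (hs ⟨(x, y), subset_tsupport _ hne, rfl⟩)

theorem isTest_integral_slice {Ψ : X × E → ℂ} (h : IsTest Ψ) :
    IsTest (fun y => ∫ x, Ψ (x, y) ∂μ) where
  smooth := by
    have hK := h.compact.isCompact.image continuous_fst
    have : IsFiniteMeasure (μ.restrict (Prod.fst '' tsupport Ψ)) :=
      isFiniteMeasure_restrict.2 hK.measure_lt_top.ne
    rw [integral_slice_eq μ h subset_rfl]
    exact (ContinuousLinearMap.contDiff _).comp (contDiff_curve h.swap)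
  compact := by
    refine HasCompactSupport.intro (h.compact.isCompact.image continuous_snd) fun y hy => ?_
    have : ∀ x, Ψ (x, y) = 0 := fun x => by
      by_contra hne
      exact hy ⟨(x, y), subset_tsupport _ hne, rfl⟩
    simp [this]

theorem iteratedFDeriv_integral_slice {Ψ : X × E → ℂ} (h : IsTest Ψ) (k : ℕ) (y : E)
    (m : Fin k → E) :
    iteratedFDeriv ℝ k (fun y => ∫ x, Ψ (x, y) ∂μ) y m =
      ∫ x, iteratedFDeriv ℝ k (fun y => Ψ (x, y)) y m ∂μ := by
  have hK := h.compact.isCompact.image continuous_fst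
  have : IsFiniteMeasure (μ.restrict (Prod.fst '' tsupport Ψ)) :=
    isFiniteMeasure_restrict.2 hK.measure_lt_top.ne
  rw [integral_slice_eq μ h subset_rfl, ContinuousLinearMap.iteratedFDeriv_comp_left _
    (contDiff_curve h.swap).contDiffAt (by exact_mod_cast le_top)]
  rw [ContinuousLinearMap.compContinuousMultilinearMap_coe, Function.comp_apply,
    setIntegralBCF_apply]
  simp_rw [iteratedFDeriv_curve_apply h.swap]
  rw [setIntegral_eq_integral_of_forall_compl_eq_zero]
  intro x hx
  rw [slice_eq_zero hx, iteratedFDeriv_fun_zero]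
  rfl

/-- A distribution commutes with integration with respect to a parameter. -/
theorem pair_integral (u : Distr E) {Ψ : X × E → ℂ} (h : IsTest Ψ) :
    pair u (fun y => ∫ x, Ψ (x, y) ∂μ) = ∫ x, pair u (fun y => Ψ (x, y)) ∂μ := by
  obtain ⟨M, L, hL⟩ := exists_extension_of_jet u (h.compact.isCompact.image continuous_snd)
  have hcomp : IsCompact (Prod.snd '' tsupport Ψ) := h.compact.isCompact.image continuous_snd
  have hs : tsupport (fun y => ∫ x, Ψ (x, y) ∂μ) ⊆ Prod.snd '' tsupport Ψ := by
    refine closure_minimal (fun y hy => ?_) hcomp.isClosed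
    by_contra hy'
    refine hy ?_
    have : ∀ x, Ψ (x, y) = 0 := fun x => by
      by_contra hne
      exact hy' ⟨(x, y), subset_tsupport _ hne, rfl⟩
    simp [this]
  have hint : Integrable (fun x => jet M (fun y => Ψ (x, y))) μ := by
    refine (contDiff_jet_slice h M).continuous.integrable_of_hasCompactSupport ?_
    refine HasCompactSupport.intro (h.compact.isCompact.image continuous_fst) fun x hx => ?_
    rw [slice_eq_zero hx, jet_zero]
  rw [hL _ (isTest_integral_slice μ h) hs]
  simp_rw [fun x => hL _ (h.slice x) (tsupport_slice_subset h x)]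
  -- The functional passes through the Bochner integral of jets. It remains to identify this
  -- integral with the jet of the integrated function, coordinate by coordinate and point by point.
  rw [L.integral_comp_comm hint]
  congr 1
  refine JetSpace.ext fun i => ?_
  ext1 y
  have h0 := fun x => curve_apply (h.partialDeriv i.1) x y
  have h1 : JetSpace.proj M i (∫ x, jet M (fun y => Ψ (x, y)) ∂μ) y
      = ∫ x, partialDeriv i.1 Ψ (x, y) ∂μ := by
    refine ((JetSpace.eval M i y).integral_comp_comm hint).symm.trans ?_
    exact integral_congr_ae (ae_of_all _ h0)
  have hint'' : Integrable (fun x => partialDeriv i.1 Ψ (x, y)) μ :=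
    ((JetSpace.eval M i y).integrable_comp hint).congr (ae_of_all _ h0)
  rw [h1, proj_jet, toBCF_apply ((isTest_integral_slice μ h).iteratedFDeriv _).continuous
    ((isTest_integral_slice μ h).iteratedFDeriv _).compact]
  ext m
  rw [iteratedFDeriv_integral_slice μ h, ContinuousMultilinearMap.integral_apply hint'']
  rfl

end Integral

end Parameters

/-! ### Constructing distributions: smooth multiples and tensor products. -/

section Construction

variable {X E : Type*} [NormedAddCommGroup X] [NormedSpace ℝ X] [NormedAddCommGroup E]
  [NormedSpace ℝ E]

open TopologicalSpace (Compacts)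

/-- A linear functional on test functions which is bounded in terms of finitely many derivatives
on every compact set is a distribution. -/
theorem exists_distr (A : (E → ℂ) → ℂ)
    (hadd : ∀ ψ χ, IsTest ψ → IsTest χ → A (fun x => ψ x + χ x) = A ψ + A χ)
    (hmul : ∀ (c : ℂ) ψ, IsTest ψ → A (fun x => c * ψ x) = c * A ψ)
    (hbd : ∀ K : Set E, IsCompact K → ∃ (M : ℕ) (C : ℝ), 0 ≤ C ∧ ∀ ψ : E → ℂ, IsTest ψ →
      tsupport ψ ⊆ K → ∀ B, 0 ≤ B → (∀ i ≤ M, ∀ y, ‖iteratedFDeriv ℝ i ψ y‖ ≤ B) →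
      ‖A ψ‖ ≤ C * B) :
    ∃ u : Distr E, ∀ ψ, IsTest ψ → pair u ψ = A ψ := by
  let u₀ : Test E →L[ℝ] ℂ := TestFunction.mkCLM ℝ (fun φ => A fun x => (φ x : ℂ))
    (fun φ χ => by
      rw [← hadd _ _ (isTest_test φ).ofReal (isTest_test χ).ofReal]
      congr 1
      ext x
      simp)
    (fun c φ => by
      rw [Complex.real_smul, ← hmul _ _ (isTest_test φ).ofReal]
      congr 1
      ext x
      simp)
    (fun K hK => by
      let A' : 𝓓_{K}(E, ℝ) → ℂ := fun φ => A fun x => (φ x : ℂ)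
      have htest : ∀ φ : 𝓓_{K}(E, ℝ), IsTest (φ : E → ℝ) := fun φ =>
        ⟨φ.contDiff, φ.hasCompactSupport⟩
      obtain ⟨M, C, hC0, hC⟩ := hbd K K.isCompact
      exact (ContDiffMapSupportedIn.mkCLMtoNormedSpace (𝕜 := ℝ) A'
        (fun φ χ => by
          rw [← hadd _ _ (htest φ).ofReal (htest χ).ofReal]
          change A _ = A _
          congr 1
          ext x
          simp)
        (fun c φ => by
          rw [Complex.real_smul, ← hmul _ _ (htest φ).ofReal]
          change A _ = A _
          congr 1
          ext x
          simp)
        ⟨Finset.range (M + 1), C, hC0, fun φ => by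
          refine hC _ (htest φ).ofReal ?_ _ (apply_nonneg _ _) fun i hi y => ?_
          · exact (tsupport_comp_subset (g := ((↑) : ℝ → ℂ)) rfl _).trans φ.tsupport_subset
          · have h1 : ‖iteratedFDeriv ℝ i (fun x => (φ x : ℂ)) y‖ = ‖iteratedFDeriv ℝ i φ y‖ :=
              Complex.ofRealLI.norm_iteratedFDeriv_comp_left φ.contDiff.contDiffAt
                (by exact_mod_cast le_top)
            rw [h1]
            refine (ContDiffMapSupportedIn.norm_iteratedFDeriv_apply_le_seminorm_top ℝ).trans ?_
            exact Seminorm.le_finset_sup_apply (Finset.mem_range.2 (Nat.lt_succ_of_le hi))⟩).cont)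
  let u : Distr E := ContinuousLinearMap.toUniformConvergenceCLM (RingHom.id ℝ) ℂ
    {S : Set (Test E) | IsCompact S} u₀
  have hu : ∀ φ : Test E, u φ = A fun x => (φ x : ℂ) := fun φ => rfl
  refine ⟨u, fun ψ h => ?_⟩
  rw [pair_eq u h, hu, hu, ← hmul _ _ (isTest_test _).ofReal,
    ← hadd _ _ (isTest_test _).ofReal ((isTest_test _).ofReal.const_mul _)]
  congr 1
  ext x
  simp only [toTest_apply]
  rw [mul_comm]
  exact Complex.re_add_im _

/-- Leibniz' rule, whose binomial coefficients sum to at most `2 ^ M`. Off the support of ψ the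
derivatives vanish, so bounds for `m` are needed on `K` only. -/
theorem norm_iteratedFDeriv_mul_le_of_tsupport_subset {ψ m : E → ℂ} (hψ : IsTest ψ)
    (hm : ContDiff ℝ ∞ m) {K : Set E} (hK : tsupport ψ ⊆ K) {M : ℕ} {B C : ℝ} (hC0 : 0 ≤ C)
    (hB : ∀ i ≤ M, ∀ y, ‖iteratedFDeriv ℝ i ψ y‖ ≤ B)
    (hC : ∀ i ≤ M, ∀ y ∈ K, ‖iteratedFDeriv ℝ i m y‖ ≤ C) (i : ℕ) (hi : i ≤ M) (y : E) :
    ‖iteratedFDeriv ℝ i (fun x => ψ x * m x) y‖ ≤ 2 ^ M * C * B := by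
  have hB0 : 0 ≤ B := (norm_nonneg _).trans (hB 0 (Nat.zero_le _) y)
  by_cases hy : y ∈ tsupport ψ
  · refine (norm_iteratedFDeriv_mul_le hψ.smooth hm y (n := i)
      (by exact_mod_cast le_top)).trans ?_
    calc ∑ j ∈ Finset.range (i + 1), (i.choose j : ℝ) * ‖iteratedFDeriv ℝ j ψ y‖ *
          ‖iteratedFDeriv ℝ (i - j) m y‖
        ≤ ∑ j ∈ Finset.range (i + 1), (i.choose j : ℝ) * (B * C) := by
          refine Finset.sum_le_sum fun j hj => ?_
          rw [mul_assoc]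
          refine mul_le_mul_of_nonneg_left ?_ (Nat.cast_nonneg _)
          exact mul_le_mul (hB _ (by rw [Finset.mem_range] at hj; omega) _)
            (hC _ (by omega) _ (hK hy)) (norm_nonneg _) hB0
      _ = 2 ^ i * C * B := by
          rw [← Finset.sum_mul]
          have : ∑ j ∈ Finset.range (i + 1), (i.choose j : ℝ) = 2 ^ i := by
            exact_mod_cast Nat.sum_range_choose i
          rw [this]
          ring
      _ ≤ 2 ^ M * C * B := by
          gcongr
          norm_num
  · have h0 : iteratedFDeriv ℝ i (fun x => ψ x * m x) y = 0 := by
      have : y ∉ tsupport (iteratedFDeriv ℝ i (fun x => ψ x * m x)) := fun h =>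
        hy (closure_mono (Function.support_mul_subset_left ψ m)
          (tsupport_iteratedFDeriv_subset i h))
      exact image_eq_zero_of_notMem_tsupport this
    rw [h0, norm_zero]
    positivity

theorem exists_bound_iteratedFDeriv_on {m : E → ℂ} (hm : ContDiff ℝ ∞ m) {K : Set E}
    (hK : IsCompact K) (M : ℕ) :
    ∃ C, 0 ≤ C ∧ ∀ i ≤ M, ∀ y ∈ K, ‖iteratedFDeriv ℝ i m y‖ ≤ C := by
  have h : ∀ i : ℕ, ∃ C, 0 ≤ C ∧ ∀ y ∈ K, ‖iteratedFDeriv ℝ i m y‖ ≤ C := fun i => by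
    obtain ⟨C, hC⟩ := hK.exists_bound_of_continuousOn
      (hm.continuous_iteratedFDeriv (m := i) (by exact_mod_cast le_top)).continuousOn
    exact ⟨max C 0, le_max_right _ _, fun y hy => (hC y hy).trans (le_max_left _ _)⟩
  choose C hC0 hC using h
  refine ⟨∑ i ∈ Finset.range (M + 1), C i, Finset.sum_nonneg fun i _ => hC0 i, ?_⟩
  intro i hi y hy
  exact (hC i y hy).trans (Finset.single_le_sum (f := C) (fun i _ => hC0 i)
    (Finset.mem_range.2 (Nat.lt_succ_of_le hi)))

/-- The product of a distribution and a smooth function. -/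
theorem exists_mul_distr (u : Distr E) {m : E → ℂ} (hm : ContDiff ℝ ∞ m) :
    ∃ v : Distr E, ∀ ψ, IsTest ψ → pair v ψ = pair u (fun x => ψ x * m x) := by
  refine exists_distr _ (fun ψ χ h h' => ?_) (fun c ψ h => ?_) fun K hK => ?_
  · rw [← pair_add u (h.mul hm) (h'.mul hm)]
    simp_rw [add_mul]
  · rw [← pair_const_mul u (h.mul hm)]
    simp_rw [mul_assoc]
  · obtain ⟨M, C, hC0, hC⟩ := exists_bound_pair u hK
    obtain ⟨C', hC'0, hC'⟩ := exists_bound_iteratedFDeriv_on hm hK M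
    refine ⟨M, C * (2 ^ M * C'), by positivity, fun ψ h hs B hB0 hB => ?_⟩
    rw [mul_assoc]
    refine hC _ (h.mul hm) ((tsupport_mul_subset_left).trans hs) _ (by positivity) fun i hi y => ?_
    exact norm_iteratedFDeriv_mul_le_of_tsupport_subset h hm hs hC'0 hB hC' i hi y

theorem pair_add_distr (u v : Distr E) {ψ : E → ℂ} (h : IsTest ψ) :
    pair (u + v) ψ = pair u ψ + pair v ψ := by
  have hadd : ∀ φ : Test E, (u + v) φ = u φ + v φ := fun _ => rfl
  rw [pair_eq _ h, pair_eq _ h, pair_eq _ h, hadd, hadd]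
  ring

/-- The tensor product of two distributions. -/
theorem exists_tensor [FiniteDimensional ℝ X] (f : Distr X) (g : Distr E) :
    ∃ T : Distr (X × E), ∀ Ψ, IsTest Ψ →
      pair T Ψ = pair f (fun x => pair g (fun y => Ψ (x, y))) := by
  refine exists_distr _ (fun Ψ Φ h h' => ?_) (fun c Ψ h => ?_) fun K hK => ?_
  · rw [← pair_add f (isTest_pair_slice g h) (isTest_pair_slice g h')]
    simp_rw [fun x => pair_add g (h.slice x) (h'.slice x)]
  · rw [← pair_const_mul f (isTest_pair_slice g h)]
    simp_rw [fun x => pair_const_mul g (h.slice x)]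
  · obtain ⟨M, C, hC0, hC⟩ := exists_bound_pair f (hK.image continuous_fst)
    -- `f` sees at most `M` derivatives in x, and the k-th of these costs `N k` derivatives of Ψ
    -- under `g`. Sums over k ≤ M dominate all the orders and constants.
    choose N D hD0 hD using fun k : ℕ =>
      exists_bound_pair_slice (X := X) g (hK.image continuous_snd) k
    let S := ∑ k ∈ Finset.range (M + 1), D k
    refine ⟨∑ k ∈ Finset.range (M + 1), N k, C * S,
      mul_nonneg hC0 (Finset.sum_nonneg fun k _ => hD0 k), fun Ψ h hs B hB0 hB => ?_⟩
    rw [mul_assoc]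
    refine hC _ (isTest_pair_slice g h) ?_ _
      (mul_nonneg (Finset.sum_nonneg fun k _ => hD0 k) hB0) fun k hk x => ?_
    · refine closure_minimal (fun x hx => ?_) (hK.image continuous_fst).isClosed
      by_contra hx'
      refine hx ?_
      change pair g (fun y => Ψ (x, y)) = 0
      rw [slice_eq_zero fun hx'' => hx' (image_mono hs hx''), pair_zero]
    · have hk' : k ∈ Finset.range (M + 1) := Finset.mem_range.2 (Nat.lt_succ_of_le hk)
      refine (hD k Ψ h (image_mono hs) B hB0 (fun i hi z => hB i (hi.trans ?_) z) x).trans ?_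
      · exact Finset.single_le_sum (f := N) (fun _ _ => Nat.zero_le _) hk'
      · exact mul_le_mul_of_nonneg_right
          (Finset.single_le_sum (f := D) (fun i _ => hD0 i) hk') hB0

theorem IsTest.tensor {ψ : X → ℂ} {χ : E → ℂ} (h : IsTest ψ) (h' : IsTest χ) :
    IsTest (fun z : X × E => ψ z.1 * χ z.2) where
  smooth := (h.smooth.comp contDiff_fst).mul (h'.smooth.comp contDiff_snd)
  compact := by
    refine HasCompactSupport.intro (h.compact.isCompact.prod h'.compact.isCompact) ?_
    intro z hz
    by_cases h1 : z.1 ∈ tsupport ψ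
    · have h2 : z.2 ∉ tsupport χ := fun h2 => hz ⟨h1, h2⟩
      simp [image_eq_zero_of_notMem_tsupport h2]
    · simp [image_eq_zero_of_notMem_tsupport h1]

theorem IsTensorProduct.pair_tensor {f g : Distr E} {T : Distr (E × E)}
    (hT : IsTensorProduct f g T) {φ ψ : E → ℝ} (hφ : IsTest φ) (hψ : IsTest ψ) :
    pair T (fun z => (φ z.1 : ℂ) * (ψ z.2 : ℂ)) =
      pair f (fun x => (φ x : ℂ)) * pair g (fun x => (ψ x : ℂ)) := by
  have h1 := hT (toTest φ hφ) (toTest ψ hψ)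
  rw [← pair_ofReal, ← pair_ofReal, ← pair_ofReal] at h1
  have h2 : (fun z : E × E => ((tensorTest (toTest φ hφ) (toTest ψ hψ) z : ℝ) : ℂ)) =
      fun z => (φ z.1 : ℂ) * (ψ z.2 : ℂ) := by
    ext z
    exact Complex.ofReal_mul _ _
  rw [h2] at h1
  exact h1

theorem isTensorProduct_of_pair [FiniteDimensional ℝ E] {f g : Distr E} {T : Distr (E × E)}
    (hT : ∀ Ψ, IsTest Ψ → pair T Ψ = pair f (fun x => pair g (fun y => Ψ (x, y)))) :
    IsTensorProduct f g T := by
  intro φ ψ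
  have h1 := (isTest_test φ).ofReal
  have h2 := (isTest_test ψ).ofReal
  have h3 : (fun z : E × E => ((tensorTest φ ψ z : ℝ) : ℂ)) =
      fun z => (φ z.1 : ℂ) * (ψ z.2 : ℂ) := by
    ext z
    exact Complex.ofReal_mul _ _
  rw [← pair_ofReal, h3, hT _ (h1.tensor h2)]
  simp only
  simp_rw [fun x => pair_const_mul g h2 (φ x : ℂ), pair_ofReal, mul_comm _ (g ψ)]
  rw [pair_const_mul f h1, pair_ofReal, mul_comm]

end Construction

/-! ### Polynomial growth of localized Fourier transforms. -/

section Exponentials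

variable {E : Type*} [NormedAddCommGroup E] [NormedSpace ℝ E]

theorem norm_iteratedFDeriv_expChar_le (ξ : E →L[ℝ] ℝ) (i : ℕ) (x : E) :
    ‖iteratedFDeriv ℝ i (expChar ξ) x‖ ≤ ‖ξ‖ ^ i := by
  let f : ℝ → ℂ := fun t => Complex.exp (-(Complex.I * (t : ℂ)))
  have hf : ContDiff ℝ ∞ f :=
    (contDiff_const.mul Complex.ofRealCLM.contDiff).neg.cexp
  have hd : ∀ i : ℕ, iteratedDeriv i f = fun t => (-Complex.I) ^ i * f t := by
    intro i
    induction i with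
    | zero => simp
    | succ i ih =>
      rw [iteratedDeriv_succ, ih]
      ext t
      have h1 : HasDerivAt (fun t : ℝ => -(Complex.I * (t : ℂ))) (-Complex.I) t := by
        exact ((Complex.ofRealCLM.hasDerivAt (x := t)).const_mul Complex.I).neg.congr_deriv
          (by simp)
      have h2 : HasDerivAt (fun t => (-Complex.I) ^ i * f t)
          ((-Complex.I) ^ i * (f t * -Complex.I)) t := h1.cexp.const_mul _
      rw [h2.deriv]
      ring
  have hn : ∀ t, ‖f t‖ = 1 := fun t => by
    change ‖Complex.exp (-(Complex.I * (t : ℂ)))‖ = 1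
    rw [show -(Complex.I * (t : ℂ)) = ((-t : ℝ) : ℂ) * Complex.I by push_cast; ring]
    exact Complex.norm_exp_ofReal_mul_I _
  have h1 := norm_iteratedFDeriv_comp_affine_le hf ξ 0 i x
  simp only [zero_add] at h1
  refine h1.trans (le_of_eq ?_)
  rw [norm_iteratedFDeriv_eq_norm_iteratedDeriv, hd]
  simp [hn]

/-- The growth exponent is the order of the distribution on `K`; it does not depend on the cutoff ψ,
which enters through `B` alone. -/
theorem exists_bound_pair_expChar (u : Distr E) {K : Set E} (hK : IsCompact K) :
    ∃ (M : ℕ) (C : ℝ), 0 ≤ C ∧ ∀ ψ : E → ℂ, IsTest ψ → tsupport ψ ⊆ K → ∀ B, 0 ≤ B →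
      (∀ i ≤ M, ∀ y, ‖iteratedFDeriv ℝ i ψ y‖ ≤ B) → ∀ ξ : E →L[ℝ] ℝ,
      ‖pair u (fun x => ψ x * expChar ξ x)‖ ≤ C * B * (1 + ‖ξ‖) ^ M := by
  obtain ⟨M, C, hC0, hC⟩ := exists_bound_pair u hK
  refine ⟨M, C * 2 ^ M, by positivity, fun ψ h hs B hB0 hB ξ => ?_⟩
  refine (hC _ (h.mul (contDiff_expChar ξ)) (tsupport_mul_subset_left.trans hs)
    (2 ^ M * (1 + ‖ξ‖) ^ M * B) (by positivity) ?_).trans (le_of_eq (by ring))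
  refine norm_iteratedFDeriv_mul_le_of_tsupport_subset h (contDiff_expChar ξ) subset_rfl
    (by positivity) hB fun i hi y _ => ?_
  refine (norm_iteratedFDeriv_expChar_le ξ i y).trans ?_
  exact (pow_le_pow_left₀ (norm_nonneg _) (by linarith) i).trans
    (pow_le_pow_right₀ (by linarith [norm_nonneg ξ]) hi)

end Exponentials

/-! ### Smooth cutoffs and mollification. -/

section Mollification

variable {X E G : Type*} [NormedAddCommGroup X] [NormedSpace ℝ X] [NormedAddCommGroup E]
  [NormedSpace ℝ E] [NormedAddCommGroup G] [NormedSpace ℝ G]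

theorem IsTest.comp_equiv {ψ : E → G} (h : IsTest ψ) (e : X ≃L[ℝ] E) :
    IsTest (fun x => ψ (e x)) where
  smooth := h.smooth.comp e.contDiff
  compact := h.compact.comp_homeomorph e.toHomeomorph

theorem IsTest.comp_add_right {ψ : E → G} (h : IsTest ψ) (s : E) : IsTest (fun y => ψ (y + s)) where
  smooth := h.smooth.comp (contDiff_id.add contDiff_const)
  compact := h.compact.comp_homeomorph (Homeomorph.addRight s)

theorem IsTest.comp_sub_left {ψ : E → G} (h : IsTest ψ) (s : E) : IsTest (fun y => ψ (s - y)) where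
  smooth := h.smooth.comp (contDiff_const.sub contDiff_id)
  compact := h.compact.comp_homeomorph (Homeomorph.subLeft s)

/-- The involution `(x, y) ↦ (x, x - y)`. -/
def shearSub (E : Type*) [NormedAddCommGroup E] [NormedSpace ℝ E] : (E × E) ≃L[ℝ] (E × E) where
  toFun z := (z.1, z.1 - z.2)
  invFun z := (z.1, z.1 - z.2)
  map_add' z w := by ext <;> simp; abel
  map_smul' c z := by ext <;> simp [smul_sub]
  left_inv z := by simp
  right_inv z := by simp
  continuous_toFun := by fun_prop
  continuous_invFun := by fun_prop

/-- The shear `(x, y) ↦ (x, y + x)`. -/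
def shearAdd (E : Type*) [NormedAddCommGroup E] [NormedSpace ℝ E] : (E × E) ≃L[ℝ] (E × E) where
  toFun z := (z.1, z.2 + z.1)
  invFun z := (z.1, z.2 - z.1)
  map_add' z w := by ext <;> simp; abel
  map_smul' c z := by ext <;> simp
  left_inv z := by simp
  right_inv z := by simp
  continuous_toFun := by fun_prop
  continuous_invFun := by fun_prop

theorem IsTest.mul_comp_sub {ψ χ : E → ℂ} (h : IsTest ψ) (h' : IsTest χ) :
    IsTest (fun z : E × E => ψ z.1 * χ (z.1 - z.2)) :=
  (h.tensor h').comp_equiv (shearSub E)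

theorem IsTest.mul_comp_add {ψ χ : E → ℂ} (h : IsTest ψ) (h' : IsTest χ) :
    IsTest (fun z : E × E => ψ z.1 * χ (z.2 + z.1)) :=
  (h.tensor h').comp_equiv (shearAdd E)

theorem distr_ext {u v : Distr E} (h : ∀ ψ, IsTest ψ → pair u ψ = pair v ψ) : u = v := by
  refine DFunLike.ext u v fun φ => ?_
  rw [← pair_ofReal, ← pair_ofReal, h _ (isTest_test φ).ofReal]

/-- A sequence of smooth probability densities concentrating at the origin. -/
structure IsMollifier [MeasureSpace E] (R : ℕ → E → ℝ) : Prop where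
  test : ∀ j, IsTest (R j)
  nonneg : ∀ j z, 0 ≤ R j z
  integral_eq_one : ∀ j, ∫ z, R j z = 1
  support : ∀ δ : ℝ, 0 < δ → ∀ᶠ j in atTop, ∀ z, R j z ≠ 0 → ‖z‖ < δ

/-- The mollification of a distribution. -/
def mollify (u : Distr E) (r : E → ℝ) (x : E) : ℂ := pair u (fun y => (r (x - y) : ℂ))

variable [FiniteDimensional ℝ E]

/-- A smooth Urysohn function f / (f + g), where f and g are nonnegative and vanish exactly on `s`
and on `t`. -/
theorem exists_contDiff_zero_one {s t : Set E} (hs : IsClosed s) (ht : IsClosed t)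
    (hst : Disjoint s t) : ∃ h : E → ℝ, ContDiff ℝ ∞ h ∧ EqOn h 0 s ∧ EqOn h 1 t := by
  obtain ⟨f, hf, hfs, hf0⟩ := hs.isOpen_compl.exists_contDiff_support_eq (n := ⊤)
  obtain ⟨g, hg, hgs, hg0⟩ := ht.isOpen_compl.exists_contDiff_support_eq (n := ⊤)
  have hf0' : ∀ x, 0 ≤ f x := fun x => (hf0 (mem_range_self x)).1
  have hg0' : ∀ x, 0 ≤ g x := fun x => (hg0 (mem_range_self x)).1
  have hfz : ∀ x, f x = 0 ↔ x ∈ s := fun x => by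
    rw [← not_iff_not, ← mem_compl_iff, ← hf, Function.mem_support]
  have hgz : ∀ x, g x = 0 ↔ x ∈ t := fun x => by
    rw [← not_iff_not, ← mem_compl_iff, ← hg, Function.mem_support]
  have hne : ∀ x, f x + g x ≠ 0 := fun x h => by
    have h1 : f x = 0 := by linarith [hf0' x, hg0' x]
    have h2 : g x = 0 := by linarith [hf0' x, hg0' x]
    exact hst.le_bot ⟨(hfz x).1 h1, (hgz x).1 h2⟩
  refine ⟨fun x => f x / (f x + g x), hfs.div (hfs.add hgs) hne, fun x hx => ?_, fun x hx => ?_⟩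
  · simp [(hfz x).2 hx]
  · have h2 := (hgz x).2 hx
    have h3 := hne x
    rw [h2, add_zero] at h3
    simp [h2, h3]

theorem exists_contDiff_zero_one_nhdsSet {s t : Set E} (hs : IsClosed s) (ht : IsClosed t)
    (hst : Disjoint s t) : ∃ h : E → ℝ, ContDiff ℝ ∞ h ∧ (∀ᶠ y in 𝓝ˢ s, h y = 0) ∧
      ∀ᶠ y in 𝓝ˢ t, h y = 1 := by
  obtain ⟨U, V, hU, hV, hsU, htV, hUV⟩ := normal_separation hs ht hst
  obtain ⟨U', hU', hsU', hU'U⟩ := normal_exists_closure_subset hs hU hsU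
  obtain ⟨V', hV', htV', hV'V⟩ := normal_exists_closure_subset ht hV htV
  obtain ⟨h, hsm, h0, h1⟩ := exists_contDiff_zero_one (E := E) (isClosed_closure (s := U'))
    (isClosed_closure (s := V')) (hUV.mono hU'U hV'V)
  exact ⟨h, hsm, mem_of_superset (hU'.mem_nhdsSet.2 hsU') fun y hy => h0 (subset_closure hy),
    mem_of_superset (hV'.mem_nhdsSet.2 htV') fun y hy => h1 (subset_closure hy)⟩

theorem exists_isTest_eq_one_nhdsSet {K U : Set E} (hK : IsCompact K) (hU : IsOpen U)
    (hKU : K ⊆ U) : ∃ χ : E → ℝ, IsTest χ ∧ tsupport χ ⊆ U ∧ ∀ᶠ y in 𝓝ˢ K, χ y = 1 := by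
  obtain ⟨K₁, hK₁, hKK₁, hK₁U⟩ := exists_compact_between hK hU hKU
  obtain ⟨K₂, hK₂, hK₁₂, hK₂U⟩ := exists_compact_between hK₁ hU hK₁U
  obtain ⟨h, hsm, h0, h1⟩ := exists_contDiff_zero_one (E := E) (s := (interior K₂)ᶜ) (t := K₁)
    isOpen_interior.isClosed_compl hK₁.isClosed (disjoint_compl_left_iff_subset.2 hK₁₂)
  have hsupp : tsupport h ⊆ K₂ := by
    refine closure_minimal (fun y hy => ?_) hK₂.isClosed
    by_contra hy'
    exact hy (h0 fun hy'' => hy' (interior_subset hy''))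
  refine ⟨h, ⟨hsm, hK₂.of_isClosed_subset (isClosed_tsupport _) hsupp⟩, hsupp.trans hK₂U, ?_⟩
  exact mem_of_superset (isOpen_interior.mem_nhdsSet.2 hKK₁) fun y hy => h1 (interior_subset hy)

/-- The function r (x - y) is not compactly supported in (x, y) jointly. A cutoff in x, equal to one
near the given point, makes it a test function without changing the pairing there. The same device
serves the later continuity lemmas. -/
theorem contDiff_mollify (u : Distr E) {r : E → ℝ} (hr : IsTest r) :
    ContDiff ℝ ∞ (mollify u r) := by
  rw [contDiff_iff_contDiffAt]
  intro x
  obtain ⟨χ, hχ, -, hχ1⟩ := exists_isTest_eq_one_nhdsSet (isCompact_singleton (x := x)) isOpen_univ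
    (subset_univ _)
  rw [nhdsSet_singleton] at hχ1
  have h1 := contDiff_pair_slice u (hχ.ofReal.mul_comp_sub hr.ofReal)
  refine h1.contDiffAt.congr_of_eventuallyEq ?_
  filter_upwards [hχ1] with y hy
  simp [mollify, hy]

variable [MeasureSpace E] [BorelSpace E] [(volume : Measure E).IsAddHaarMeasure]

theorem pair_ofFunction {w : E → ℂ} (hw : Continuous w) {ψ : E → ℂ} (h : IsTest ψ) :
    pair (ofFunction w) ψ = ∫ x, ψ x * w x := by
  have hi : ∀ φ : E → ℝ, IsTest φ → Integrable (fun x => φ x • w x) := fun φ hφ =>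
    (hφ.continuous.smul hw).integrable_of_hasCompactSupport hφ.compact.smul_right
  rw [pair_eq _ h, ofFunction_apply hw, ofFunction_apply hw, ← integral_const_mul,
    ← integral_add (f := fun x => toTest _ h.re x • w x)
      (g := fun x => Complex.I * toTest _ h.im x • w x) (hi _ h.re) ((hi _ h.im).const_mul _)]
  refine integral_congr_ae (ae_of_all _ fun x => ?_)
  simp only [toTest_apply, Complex.real_smul]
  conv_rhs => rw [← Complex.re_add_im (ψ x)]
  ring

/-- Both sides are `u` applied to an integral over the parameter, and the two integrals agree after
substituting x = y + s. Mollification thus appears as an average over translations of the test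
function, the form in which all limits are taken. -/
theorem pair_ofFunction_mollify (u : Distr E) {r : E → ℝ} (hr : IsTest r) {ψ : E → ℂ}
    (h : IsTest ψ) :
    pair (ofFunction (mollify u r)) ψ = ∫ s, (r s : ℂ) * pair u (fun y => ψ (y + s)) := by
  rw [pair_ofFunction (contDiff_mollify u hr).continuous h]
  have h1 : ∀ x, ψ x * mollify u r x = pair u (fun y => ψ x * (r (x - y) : ℂ)) := fun x =>
    (pair_const_mul u (hr.ofReal.comp_sub_left x) _).symm
  have h2 : ∀ s, (r s : ℂ) * pair u (fun y => ψ (y + s)) =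
      pair u (fun y => (r s : ℂ) * ψ (y + s)) := fun s =>
    (pair_const_mul u (h.comp_add_right s) _).symm
  simp_rw [h1, h2]
  rw [← pair_integral volume u (h.mul_comp_sub hr.ofReal),
    ← pair_integral volume u (hr.ofReal.mul_comp_add h)]
  congr 1
  ext y
  simp only
  rw [← integral_add_left_eq_self (μ := volume) _ y]
  simp [mul_comm]

theorem IsMollifier.norm_integral_sub_le {R : ℕ → E → ℝ} (hR : IsMollifier R) (j : ℕ) {h : E → ℂ}
    (hh : Continuous h) (c : ℂ) {ε : ℝ} (hε : ∀ z, R j z ≠ 0 → ‖h z - c‖ ≤ ε) :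
    ‖(∫ z, (R j z : ℂ) * h z) - c‖ ≤ ε := by
  have h1 : c = ∫ z, (R j z : ℂ) * c := by
    rw [integral_mul_const, integral_complex_ofReal, hR.integral_eq_one]
    simp
  have hi : ∀ g : E → ℂ, Continuous g → Integrable (fun z => (R j z : ℂ) * g z) := fun g hg =>
    ((hR.test j).ofReal.continuous.mul hg).integrable_of_hasCompactSupport
      (hR.test j).ofReal.compact.mul_right
  have hRi : Integrable (R j) := (hR.test j).continuous.integrable_of_hasCompactSupport
    (hR.test j).compact
  conv_lhs => rw [h1]
  rw [← integral_sub (hi _ hh) (hi _ continuous_const)]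
  calc ‖∫ z, ((R j z : ℂ) * h z - (R j z : ℂ) * c)‖ ≤ ∫ z, R j z * ε := by
        refine norm_integral_le_of_norm_le (hRi.mul_const _) (ae_of_all _ fun z => ?_)
        rw [← mul_sub, norm_mul, Complex.norm_real, Real.norm_of_nonneg (hR.nonneg j z)]
        by_cases hz : R j z = 0
        · simp [hz]
        · exact mul_le_mul_of_nonneg_left (hε z hz) (hR.nonneg j z)
    _ = ε := by rw [integral_mul_const, hR.integral_eq_one, one_mul]

theorem IsMollifier.tendsto_integral {R : ℕ → E → ℝ} (hR : IsMollifier R) {h : E → ℂ}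
    (hh : Continuous h) : Tendsto (fun j => ∫ z, (R j z : ℂ) * h z) atTop (𝓝 (h 0)) := by
  rw [Metric.tendsto_nhds]
  intro ε hε
  obtain ⟨δ, hδ, hd⟩ := Metric.continuousAt_iff.1 (hh.continuousAt (x := 0)) (ε / 2) (by positivity)
  filter_upwards [hR.support δ hδ] with j hj
  rw [dist_eq_norm]
  refine (hR.norm_integral_sub_le j hh _ (ε := ε / 2) fun z hz => ?_).trans_lt (by linarith)
  have := hd (x := z) (by simpa using hj z hz)
  rw [dist_eq_norm] at this
  exact this.le

theorem continuous_pair_translate (u : Distr E) {ψ : E → ℂ} (h : IsTest ψ) :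
    Continuous (fun s => pair u (fun y => ψ (y + s))) := by
  rw [continuous_iff_continuousAt]
  intro x
  obtain ⟨χ, hχ, -, hχ1⟩ := exists_isTest_eq_one_nhdsSet (isCompact_singleton (x := x)) isOpen_univ
    (subset_univ _)
  rw [nhdsSet_singleton] at hχ1
  have h1 := contDiff_pair_slice u (hχ.ofReal.mul_comp_add h)
  refine h1.continuous.continuousAt.congr ?_
  filter_upwards [hχ1] with y hy
  simp [hy]

theorem IsMollifier.tendsto_pair {R : ℕ → E → ℝ} (hR : IsMollifier R) (u : Distr E) {ψ : E → ℂ}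
    (h : IsTest ψ) :
    Tendsto (fun j => pair (ofFunction (mollify u (R j))) ψ) atTop (𝓝 (pair u ψ)) := by
  simp_rw [fun j => pair_ofFunction_mollify u (hR.test j) h]
  simpa using hR.tendsto_integral (continuous_pair_translate u h)

theorem IsTest.tensor_real {φ : X → ℝ} {ψ : E → ℝ} (h : IsTest φ) (h' : IsTest ψ) :
    IsTest (fun z : X × E => φ z.1 * ψ z.2) where
  smooth := (h.smooth.comp contDiff_fst).mul (h'.smooth.comp contDiff_snd)
  compact := by
    refine HasCompactSupport.intro (h.compact.isCompact.prod h'.compact.isCompact) ?_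
    intro z hz
    by_cases h1 : z.1 ∈ tsupport φ
    · have h2 : z.2 ∉ tsupport ψ := fun h2 => hz ⟨h1, h2⟩
      simp [image_eq_zero_of_notMem_tsupport h2]
    · simp [image_eq_zero_of_notMem_tsupport h1]

theorem IsMollifier.prod {R : ℕ → E → ℝ} (hR : IsMollifier R) :
    IsMollifier (fun j (z : E × E) => R j z.1 * R j z.2) where
  test j := (hR.test j).tensor_real (hR.test j)
  nonneg j z := mul_nonneg (hR.nonneg j _) (hR.nonneg j _)
  integral_eq_one j := by
    rw [Measure.volume_eq_prod, integral_prod_mul, hR.integral_eq_one, one_mul]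
  support δ hδ := by
    filter_upwards [hR.support δ hδ] with j hj z hz
    rw [Prod.norm_def, max_lt_iff]
    exact ⟨hj _ (left_ne_zero_of_mul hz), hj _ (right_ne_zero_of_mul hz)⟩

theorem exists_isMollifier [HasContDiffBump E] : ∃ R : ℕ → E → ℝ, IsMollifier R := by
  let b : ℕ → ContDiffBump (0 : E) := fun j =>
    ⟨((j : ℝ) + 2)⁻¹, ((j : ℝ) + 1)⁻¹, by positivity, by gcongr; norm_num⟩
  refine ⟨fun j => (b j).normed volume, fun j => ⟨(b j).contDiff_normed, (b j).hasCompactSupport_normed⟩,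
    fun j z => (b j).nonneg_normed z, fun j => (b j).integral_normed, fun δ hδ => ?_⟩
  have h1 : Tendsto (fun j : ℕ => ((j : ℝ) + 1)⁻¹) atTop (𝓝 0) := by
    simpa using tendsto_one_div_add_atTop_nhds_zero_nat (𝕜 := ℝ)
  filter_upwards [h1.eventually (gt_mem_nhds hδ)] with j hj z hz
  have : z ∈ Function.support ((b j).normed volume) := hz
  rw [(b j).support_normed_eq, mem_ball_zero_iff] at this
  exact this.trans hj

instance : (volume : Measure (E × E)).IsAddHaarMeasure :=
  inferInstanceAs (((volume : Measure E).prod (volume : Measure E)).IsAddHaarMeasure)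

theorem IsTensorProduct.mollify_eq {f g : Distr E} {T : Distr (E × E)} (hT : IsTensorProduct f g T)
    {r : E → ℝ} (hr : IsTest r) :
    mollify T (fun z => r z.1 * r z.2) = fun z => mollify f r z.1 * mollify g r z.2 := by
  ext z
  rw [mollify, mollify, mollify, ← hT.pair_tensor (hr.comp_sub_left z.1) (hr.comp_sub_left z.2)]
  congr 1
  ext w
  simp

/-- A product kernel tests `T` on tensor products only, so `T` and `T'` have the same
mollifications, which converge weakly to both. -/
theorem IsTensorProduct.unique [HasContDiffBump E] {f g : Distr E} {T T' : Distr (E × E)}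
    (hT : IsTensorProduct f g T) (hT' : IsTensorProduct f g T') : T = T' := by
  obtain ⟨R, hR⟩ := exists_isMollifier (E := E)
  refine distr_ext fun ψ h => ?_
  refine tendsto_nhds_unique (hR.prod.tendsto_pair T h) ?_
  have h1 := hR.prod.tendsto_pair T' h
  simp_rw [hT'.mollify_eq (hR.test _)] at h1
  simp_rw [hT.mollify_eq (hR.test _)]
  exact h1

end Mollification

section

open scoped Manifold

/-! ### Smooth representatives away from the singular support. -/

section SingularSupport

variable {E : Type*} [NormedAddCommGroup E] [NormedSpace ℝ E] [FiniteDimensional ℝ E]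
  [MeasureSpace E] [BorelSpace E] [(volume : Measure E).IsAddHaarMeasure]

theorem isClosed_singularSupport (u : Distr E) : IsClosed (singularSupport u) := by
  rw [← isOpen_compl_iff, isOpen_iff_mem_nhds]
  intro x hx
  obtain ⟨U, hU, hxU, a, ha, hua⟩ := not_not.1 hx
  exact mem_of_superset (hU.mem_nhds hxU) fun y hy => not_not.2 ⟨U, hU, hy, a, ha, hua⟩

theorem integrable_mul_of_continuousOn {ψ a : E → ℂ} (h : IsTest ψ)
    (ha : ContinuousOn a (tsupport ψ)) : Integrable (fun x => ψ x * a x) := by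
  have h1 : IntegrableOn (fun x => ψ x * a x) (tsupport ψ) :=
    (h.continuous.continuousOn.mul ha).integrableOn_compact h.compact
  refine (integrableOn_iff_integrable_of_support_subset fun x hx => ?_).1 h1
  exact subset_tsupport _ (left_ne_zero_of_mul hx)

theorem pair_eq_integral_of_forall_test {u : Distr E} {U : Set E} {a : E → ℂ}
    (ha : ContinuousOn a U)
    (hua : ∀ φ : Test E, tsupport φ ⊆ U → u φ = ∫ y, φ y • a y) {ψ : E → ℂ} (h : IsTest ψ)
    (hs : tsupport ψ ⊆ U) : pair u ψ = ∫ y, ψ y * a y := by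
  have hre : tsupport (fun x => (ψ x).re) ⊆ tsupport ψ :=
    tsupport_comp_subset (g := Complex.re) rfl _
  have him : tsupport (fun x => (ψ x).im) ⊆ tsupport ψ :=
    tsupport_comp_subset (g := Complex.im) rfl _
  have hofReal : ∀ φ : E → ℝ, tsupport (fun x => (φ x : ℂ)) ⊆ tsupport φ := fun φ =>
    tsupport_comp_subset (g := ((↑) : ℝ → ℂ)) rfl _
  rw [pair_eq u h, hua _ (hre.trans hs), hua _ (him.trans hs), ← integral_const_mul]
  simp only [toTest_apply, Complex.real_smul]
  rw [← integral_add
    (integrable_mul_of_continuousOn h.re.ofReal (ha.mono ((hofReal _).trans (hre.trans hs))))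
    ((integrable_mul_of_continuousOn h.im.ofReal
      (ha.mono ((hofReal _).trans (him.trans hs)))).const_mul _)]
  refine integral_congr_ae (ae_of_all _ fun x => ?_)
  simp only
  conv_rhs => rw [← Complex.re_add_im (ψ x)]
  ring

theorem isTest_sum {ι : Type*} (I : Finset ι) {ψ : ι → E → ℂ} (h : ∀ i ∈ I, IsTest (ψ i)) :
    IsTest (fun x => ∑ i ∈ I, ψ i x) := by
  classical
  induction I using Finset.induction_on with
  | empty => simpa using isTest_zero
  | insert i I hi ih =>
    simp_rw [Finset.sum_insert hi]
    exact (h i (Finset.mem_insert_self i I)).add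
      (ih fun j hj => h j (Finset.mem_insert_of_mem hj))

theorem pair_sum (u : Distr E) {ι : Type*} (I : Finset ι) {ψ : ι → E → ℂ}
    (h : ∀ i ∈ I, IsTest (ψ i)) :
    pair u (fun x => ∑ i ∈ I, ψ i x) = ∑ i ∈ I, pair u (ψ i) := by
  classical
  induction I using Finset.induction_on with
  | empty => simpa using pair_zero u
  | insert i I hi ih =>
    have h' : ∀ j ∈ I, IsTest (ψ j) := fun j hj => h j (Finset.mem_insert_of_mem hj)
    simp_rw [Finset.sum_insert hi]
    rw [pair_add u (h i (Finset.mem_insert_self i I)) (isTest_sum I h'), ih h']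

/-- Away from its singular support, a distribution is given by a globally defined smooth
function. -/
theorem exists_contDiff_eq_near (u : Distr E) {s : Set E} (hs : IsClosed s)
    (hsu : Disjoint s (singularSupport u)) :
    ∃ a : E → ℂ, ContDiff ℝ ∞ a ∧ ∃ O : Set E, IsOpen O ∧ s ⊆ O ∧
      ∀ ψ, IsTest ψ → tsupport ψ ⊆ O → pair u ψ = ∫ y, ψ y * a y := by
  -- The closure of `O` still avoids the singular support; the local smooth densities are glued by a
  -- partition of unity on this closure.
  obtain ⟨O, hO, hsO, hOu⟩ := normal_exists_closure_subset hs
    (isClosed_singularSupport u).isOpen_compl (subset_compl_iff_disjoint_right.2 hsu)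
  have hloc : ∀ x : ((singularSupport u)ᶜ : Set E), ∃ U : Set E, IsOpen U ∧ x.1 ∈ U ∧ ∃ a : E → ℂ,
      ContDiffOn ℝ ∞ a U ∧ ∀ φ : Test E, tsupport φ ⊆ U → u φ = ∫ y, φ y • a y := fun x =>
    not_not.1 x.2
  choose U hU hxU a ha hua using hloc
  obtain ⟨θ, hθ⟩ := SmoothPartitionOfUnity.exists_isSubordinate 𝓘(ℝ, E)
    (isClosed_closure (s := O)) U hU (fun x hx => mem_iUnion.2 ⟨⟨x, hOu hx⟩, hxU _⟩)
  have hθs : ∀ i, ContDiff ℝ ∞ (θ i) := fun i => (θ i).contMDiff.contDiff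
  refine ⟨fun y => ∑ᶠ i, θ i y • a i y, ?_, O, hO, hsO, fun ψ h hψ => ?_⟩
  · rw [contDiff_iff_contDiffAt]
    intro x
    exact θ.contDiffAt_finsum fun i hx => (ha i).contDiffAt ((hU i).mem_nhds (hθ i hx))
  -- By local finiteness and compactness, only finitely many members of the partition meet the
  -- support of ψ, so ψ is a finite sum of pieces on which a local density is available.
  · have hfin : {i | (Function.support (θ i) ∩ tsupport ψ).Nonempty}.Finite :=
      θ.locallyFinite.finite_nonempty_inter_compact h.compact
    let I := hfin.toFinset
    have hI : ∀ y ∈ tsupport ψ, ∀ i, θ i y ≠ 0 → i ∈ I := fun y hy i hi =>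
      hfin.mem_toFinset.2 ⟨y, hi, hy⟩
    have htest : ∀ i, IsTest (fun y => ψ y * (θ i y : ℂ)) := fun i =>
      h.mul (Complex.ofRealCLM.contDiff.comp (hθs i))
    have hsupp : ∀ i, tsupport (fun y => ψ y * (θ i y : ℂ)) ⊆ U i := fun i =>
      (tsupport_mul_subset_right.trans (tsupport_comp_subset (g := ((↑) : ℝ → ℂ)) rfl _)).trans
        (hθ i)
    have h1 : ψ = fun y => ∑ i ∈ I, ψ y * (θ i y : ℂ) := by
      ext y
      by_cases hy : y ∈ tsupport ψ
      · rw [← Finset.mul_sum, ← Complex.ofReal_sum]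
        have := θ.sum_eq_one (subset_closure (hψ hy))
        rw [finsum_eq_sum_of_support_subset _ (s := I) (fun i hi => hI y hy i hi)] at this
        rw [this]
        simp
      · simp [image_eq_zero_of_notMem_tsupport hy]
    have h2 : ∀ y, ψ y * ∑ᶠ i, θ i y • a i y = ∑ i ∈ I, (ψ y * (θ i y : ℂ)) * a i y := by
      intro y
      by_cases hy : y ∈ tsupport ψ
      · rw [finsum_eq_sum_of_support_subset _ (s := I)
          (fun i hi => hI y hy i (left_ne_zero_of_smul hi)), Finset.mul_sum]
        simp [mul_assoc]
      · simp [image_eq_zero_of_notMem_tsupport hy]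
    simp_rw [h2]
    rw [integral_finsetSum _ fun i _ => integrable_mul_of_continuousOn (htest i)
      ((ha i).continuousOn.mono (hsupp i))]
    conv_lhs => rw [h1]
    rw [pair_sum u I fun i _ => htest i]
    refine Finset.sum_congr rfl fun i _ => ?_
    exact pair_eq_integral_of_forall_test (ha i).continuousOn (hua i) (htest i) (hsupp i)

end SingularSupport

end

/-! ### Rapid decay of Fourier transforms in directions of invariance. -/

section Decay

variable {P E : Type*} [NormedAddCommGroup P] [NormedSpace ℝ P] [NormedAddCommGroup E]
  [NormedSpace ℝ E]

/-- The distribution `S` is invariant under translations in the direction `v`. -/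
def IsInvariant (S : Distr E) (v : E) : Prop :=
  ∀ ψ : E → ℂ, IsTest ψ → pair S (fun y => fderiv ℝ ψ y v) = 0

theorem fderiv_mul_expChar {ψ : E → ℂ} (h : IsTest ψ) (ζ : E →L[ℝ] ℝ) (v y : E) :
    fderiv ℝ (fun y => ψ y * expChar ζ y) y v =
      fderiv ℝ ψ y v * expChar ζ y - (Complex.I * (ζ v : ℂ)) * (ψ y * expChar ζ y) := by
  have h1 : HasFDerivAt (fun y => -(Complex.I * (ζ y : ℂ)))
      (-(Complex.I • (Complex.ofRealCLM ∘L ζ))) y :=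
    ((Complex.ofRealCLM ∘L ζ).hasFDerivAt.const_mul Complex.I).neg
  have h2 := (h.smooth.differentiable (by simp) y).hasFDerivAt.mul h1.cexp
  have h3 : fderiv ℝ (fun y => ψ y * expChar ζ y) y = _ := h2.fderiv
  rw [h3]
  simp [expChar]
  ring

/-- Integration by parts: `S` kills the v-derivative of the product of ψ and the exponential, so a
factor ζ(v) is traded for a derivative of ψ. -/
theorem IsInvariant.pair_fderiv {S : Distr E} {v : E} (hS : IsInvariant S v) {ψ : E → ℂ}
    (h : IsTest ψ) (ζ : E →L[ℝ] ℝ) :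
    pair S (fun y => fderiv ℝ ψ y v * expChar ζ y) =
      (Complex.I * (ζ v : ℂ)) * pair S (fun y => ψ y * expChar ζ y) := by
  have hc := contDiff_expChar ζ
  have h1 := hS _ (h.mul hc)
  simp_rw [fderiv_mul_expChar h] at h1
  rw [pair_sub S ((h.lineDeriv v).mul hc) ((h.mul hc).const_mul _),
    pair_const_mul S (h.mul hc)] at h1
  exact sub_eq_zero.1 h1

/-- The growth exponent `M` is chosen before `H` and `N`: each integration by parts replaces `H` by
a derivative with support still over `K`, where the order of `S` is fixed. The parameter p will be a
translation. -/
theorem IsInvariant.exists_bound {S : Distr E} {v : E} (hS : IsInvariant S v) {K : Set E}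
    (hK : IsCompact K) : ∃ M : ℕ, ∀ H : P × E → ℂ, IsTest H → Prod.snd '' tsupport H ⊆ K → ∀ N : ℕ,
      ∃ C, 0 ≤ C ∧ ∀ (p : P) (ζ : E →L[ℝ] ℝ),
        |ζ v| ^ N * ‖pair S (fun y => H (p, y) * expChar ζ y)‖ ≤ C * (1 + ‖ζ‖) ^ M := by
  obtain ⟨M, C, hC0, hC⟩ := exists_bound_pair_expChar S hK
  refine ⟨M, fun H h hs N => ?_⟩
  induction N generalizing H with
  | zero =>
    obtain ⟨B, hB0, hB⟩ := h.bounded_iteratedFDeriv M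
    refine ⟨C * B, by positivity, fun p ζ => ?_⟩
    rw [pow_zero, one_mul]
    exact hC _ (h.slice p) ((tsupport_slice_subset h p).trans hs) B hB0
      (fun i hi y => (norm_iteratedFDeriv_slice_le h.smooth i p y).trans (hB i hi _)) ζ
  | succ N ih =>
    have hs' : tsupport (fun z => fderiv ℝ H z (0, v)) ⊆ tsupport H :=
      tsupport_fderiv_apply_subset ℝ _
    obtain ⟨C', hC'0, hC'⟩ := ih _ (h.lineDeriv (0, v)) ((image_mono hs').trans hs)
    refine ⟨C', hC'0, fun p ζ => (le_of_eq ?_).trans (hC' p ζ)⟩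
    have h1 : ∀ y, fderiv ℝ H (p, y) (0, v) = fderiv ℝ (fun y => H (p, y)) y v := fun y => by
      have h2 := ((h.smooth.differentiable (by simp) (p, y)).hasFDerivAt).comp y
        (hasFDerivAt_prodMk_right p y)
      have h3 : fderiv ℝ (fun y => H (p, y)) y = _ := h2.fderiv
      rw [h3]
      simp
    simp_rw [h1]
    rw [hS.pair_fderiv (h.slice p), norm_mul, norm_mul, Complex.norm_I, Complex.norm_real,
      Real.norm_eq_abs]
    ring

/-- Rapid decay of the Fourier transform on cones of covectors which are controlled by their
values on directions of invariance. -/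
theorem exists_decay_of_isInvariant {ι : Type*} [Finite ι] {S : Distr E} {v : ι → E}
    (hS : ∀ i, IsInvariant S (v i)) {c : ℝ} {V : Set (E →L[ℝ] ℝ)}
    (hV : ∀ ζ ∈ V, ζ = 0 ∨ ∃ i, ‖ζ‖ ≤ c * |ζ (v i)|) {H : P × E → ℂ} (h : IsTest H) (N : ℕ) :
    ∃ C, 0 ≤ C ∧ ∀ (p : P), ∀ ζ ∈ V,
      (1 + ‖ζ‖) ^ N * ‖pair S (fun y => H (p, y) * expChar ζ y)‖ ≤ C := by
  cases nonempty_fintype ι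
  have hK := h.compact.isCompact.image continuous_snd
  choose M hM using fun i => (hS i).exists_bound (P := P) hK
  -- Invariance along the zero vector is automatic; with exponent zero it supplies the plain
  -- polynomial bound.
  have hinv0 : IsInvariant S 0 := fun ψ _ => by simpa using pair_zero S
  obtain ⟨M₀, hM₀⟩ := hinv0.exists_bound (P := P) hK
  obtain ⟨C₀, hC₀0, hC₀⟩ := hM₀ H h subset_rfl 0
  -- The surplus `M i + M₀` absorbs the polynomial growth of both bounds and leaves the desired
  -- weight of order `N`.
  choose C hC0 hC using fun i => hM i H h subset_rfl (N + (M i + M₀))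
  let D : ι → ℝ := fun i => 2 ^ (N + (M i + M₀)) * (C₀ + |c| ^ (N + (M i + M₀)) * C i)
  have hD0 : ∀ i, 0 ≤ D i := fun i => by have := hC0 i; positivity
  refine ⟨C₀ + ∑ i, D i, add_nonneg hC₀0 (Finset.sum_nonneg fun i _ => hD0 i), fun p ζ hζ => ?_⟩
  set q := ‖pair S (fun y => H (p, y) * expChar ζ y)‖ with hq
  have hq0 : 0 ≤ q := norm_nonneg _
  have h0 : q ≤ C₀ * (1 + ‖ζ‖) ^ M₀ := by simpa using hC₀ p ζ
  rcases hV ζ hζ with hζ0 | ⟨i, hi⟩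
  · have hn : ‖ζ‖ = 0 := by rw [hζ0, norm_zero]
    rw [hn] at h0 ⊢
    simp only [add_zero, one_pow, one_mul, mul_one] at h0 ⊢
    linarith [Finset.sum_nonneg fun i (_ : i ∈ Finset.univ) => hD0 i]
  · set t := ‖ζ‖ with ht
    have ht0 : 0 ≤ t := norm_nonneg _
    set L := N + (M i + M₀) with hL
    have h1 : |ζ (v i)| ^ L * q ≤ C i * (1 + t) ^ M i := hC i p ζ
    have h2 : t ^ L ≤ |c| ^ L * |ζ (v i)| ^ L := by
      rw [← mul_pow]
      refine pow_le_pow_left₀ ht0 (hi.trans ?_) L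
      exact mul_le_mul_of_nonneg_right (le_abs_self c) (abs_nonneg _)
    have h3 : (1 + t) ^ L ≤ 2 ^ L * (1 + t ^ L) := by
      refine (add_pow_le zero_le_one ht0 L).trans ?_
      rw [one_pow]
      exact mul_le_mul_of_nonneg_right (pow_le_pow_right₀ (by norm_num) (Nat.sub_le _ _))
        (by positivity)
    have hm1 : (1 + t) ^ M₀ ≤ (1 + t) ^ (M i + M₀) :=
      pow_le_pow_right₀ (by linarith) (by omega)
    have hm2 : (1 + t) ^ M i ≤ (1 + t) ^ (M i + M₀) :=
      pow_le_pow_right₀ (by linarith) (by omega)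
    have h4 : (1 + t) ^ L * q ≤ D i * (1 + t) ^ (M i + M₀) := by
      calc (1 + t) ^ L * q ≤ 2 ^ L * (1 + t ^ L) * q := mul_le_mul_of_nonneg_right h3 hq0
        _ = 2 ^ L * (q + t ^ L * q) := by ring
        _ ≤ 2 ^ L * (C₀ * (1 + t) ^ M₀ + |c| ^ L * (C i * (1 + t) ^ M i)) := by
            refine mul_le_mul_of_nonneg_left (add_le_add h0 ?_) (by positivity)
            calc t ^ L * q ≤ (|c| ^ L * |ζ (v i)| ^ L) * q := mul_le_mul_of_nonneg_right h2 hq0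
              _ = |c| ^ L * (|ζ (v i)| ^ L * q) := by ring
              _ ≤ _ := mul_le_mul_of_nonneg_left h1 (by positivity)
        _ ≤ 2 ^ L * (C₀ * (1 + t) ^ (M i + M₀) + |c| ^ L * (C i * (1 + t) ^ (M i + M₀))) := by
            have := hC0 i
            gcongr
        _ = D i * (1 + t) ^ (M i + M₀) := by
            simp only [D]
            ring
    have h5 : (1 + t) ^ N * q ≤ D i := by
      have hpos : 0 < (1 + t) ^ (M i + M₀) := by positivity
      refine le_of_mul_le_mul_right ?_ hpos
      refine (le_of_eq ?_).trans h4
      rw [hL, pow_add]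
      ring
    have h6 : D i ≤ ∑ i, D i := Finset.single_le_sum (fun i _ => hD0 i) (Finset.mem_univ i)
    linarith

/-- Rapid decay on `V`, uniformly for small translations of `Φ`, of the Fourier transform of
`T` localized by `Φ`. -/
def UniformDecay (T : Distr E) (Φ : E → ℂ) (V : Set (E →L[ℝ] ℝ)) : Prop :=
  ∃ δ : ℝ, 0 < δ ∧ ∀ N : ℕ, ∃ C, 0 ≤ C ∧ ∀ s : E, ‖s‖ < δ → ∀ ζ ∈ V,
    (1 + ‖ζ‖) ^ N * ‖pair T (fun y => Φ (y + s) * expChar ζ y)‖ ≤ C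

theorem UniformDecay.add {T : Distr E} {Φ Φ' : E → ℂ} {V : Set (E →L[ℝ] ℝ)} (hΦ : IsTest Φ)
    (hΦ' : IsTest Φ') (h : UniformDecay T Φ V) (h' : UniformDecay T Φ' V) :
    UniformDecay T (fun y => Φ y + Φ' y) V := by
  obtain ⟨δ, hδ, H⟩ := h
  obtain ⟨δ', hδ', H'⟩ := h'
  refine ⟨min δ δ', lt_min hδ hδ', fun N => ?_⟩
  obtain ⟨C, hC0, hC⟩ := H N
  obtain ⟨C', hC0', hC'⟩ := H' N
  refine ⟨C + C', add_nonneg hC0 hC0', fun s hs ζ hζ => ?_⟩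
  simp_rw [add_mul]
  rw [pair_add T ((hΦ.comp_add_right s).mul (contDiff_expChar ζ))
    ((hΦ'.comp_add_right s).mul (contDiff_expChar ζ))]
  refine (mul_le_mul_of_nonneg_left (norm_add_le _ _) (by positivity)).trans ?_
  rw [mul_add]
  exact add_le_add (hC s (hs.trans_le (min_le_left _ _)) ζ hζ)
    (hC' s (hs.trans_le (min_le_right _ _)) ζ hζ)

/-- The factor `m` is absorbed into the cutoff, and the translation s becomes the parameter of the
family χ(s) Φ(y + s) m(y). For small s the translated support stays inside `O`, where T = m S. -/
theorem uniformDecay_of_eq_mul [FiniteDimensional ℝ E] {ι : Type*} [Finite ι] {S T : Distr E}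
    {v : ι → E} (hS : ∀ i, IsInvariant S (v i)) {c : ℝ} {V : Set (E →L[ℝ] ℝ)}
    (hV : ∀ ζ ∈ V, ζ = 0 ∨ ∃ i, ‖ζ‖ ≤ c * |ζ (v i)|) {Φ m : E → ℂ} (hΦ : IsTest Φ)
    (hm : ContDiff ℝ ∞ m) {O : Set E} (hO : IsOpen O) (hΦO : tsupport Φ ⊆ O)
    (hT : ∀ Ψ, IsTest Ψ → tsupport Ψ ⊆ O → pair T Ψ = pair S (fun y => Ψ y * m y)) :
    UniformDecay T Φ V := by
  obtain ⟨δ, hδ, hδO⟩ := hΦ.compact.isCompact.exists_thickening_subset_open hO hΦO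
  obtain ⟨χ, hχ, -, hχ1⟩ := exists_isTest_eq_one_nhdsSet (isCompact_singleton (x := (0 : E)))
    isOpen_univ (subset_univ _)
  rw [nhdsSet_singleton, Metric.eventually_nhds_iff] at hχ1
  obtain ⟨δ', hδ', hχ1⟩ := hχ1
  refine ⟨min δ δ', lt_min hδ hδ', fun N => ?_⟩
  have hH : IsTest (fun z : E × E => (χ z.1 : ℂ) * Φ (z.2 + z.1) * m z.2) :=
    (hχ.ofReal.mul_comp_add hΦ).mul (hm.comp contDiff_snd)
  obtain ⟨C, hC0, hC⟩ := exists_decay_of_isInvariant hS hV hH N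
  refine ⟨C, hC0, fun s hs ζ hζ => ?_⟩
  have h1 := hC s ζ hζ
  have h2 : χ s = 1 := hχ1 (by simpa using hs.trans_le (min_le_right _ _))
  have h3 : tsupport (fun y => Φ (y + s) * expChar ζ y) ⊆ O := by
    refine tsupport_mul_subset_left.trans fun y hy => hδO ?_
    have hy' : y + s ∈ tsupport Φ := by
      have := tsupport_comp_subset_preimage Φ (f := fun y : E => y + s) (by fun_prop) hy
      exact this
    rw [Metric.mem_thickening_iff]
    exact ⟨_, hy', by simpa using hs.trans_le (min_le_left _ _)⟩
  rw [hT _ ((hΦ.comp_add_right s).mul (contDiff_expChar ζ)) h3]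
  refine (le_of_eq ?_).trans h1
  congr 3
  ext y
  simp only [h2, Complex.ofReal_one, one_mul]
  ring

end Decay

/-! ### Criteria for wave front sets, and the case of smooth functions. -/

section WaveFront

variable {E F : Type*} [NormedAddCommGroup E] [NormedSpace ℝ E] [FiniteDimensional ℝ E]
  [NormedAddCommGroup F] [NormedSpace ℝ F]

theorem UniformDecay.notMem_waveFrontSet {T : Distr E} {φ : Test E} {V : Set (E →L[ℝ] ℝ)}
    (h : UniformDecay T (fun y => (φ y : ℂ)) V) (hV : IsOpen V) (hVc : IsConic V) {x : E}
    (hx : φ x ≠ 0) {ξ : E →L[ℝ] ℝ} (hξ : ξ ∈ V) : (x, ξ) ∉ waveFrontSet T := by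
  obtain ⟨δ, hδ, H⟩ := h
  rintro ⟨-, hne⟩
  refine hne ⟨φ, hx, V, hV, hVc, hξ, fun N => ?_⟩
  obtain ⟨C, -, hC⟩ := H N
  refine ⟨C, fun ζ hζ => ?_⟩
  rw [localFourier_eq_pair]
  simpa using hC 0 (by simpa using hδ) ζ hζ

/-- The norm of ζ ∘ A is comparable to its largest value on a basis of `E`. The alternative ζ = 0
covers a zero-dimensional `E`, which has no basis vectors. -/
theorem exists_direction (A : E →L[ℝ] F) (c : ℝ) : ∃ c' : ℝ, ∀ ζ : F →L[ℝ] ℝ,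
    ‖ζ‖ ≤ c * ‖ζ ∘L A‖ →
      ζ = 0 ∨ ∃ i, ‖ζ‖ ≤ c' * |ζ (A (Module.finBasis ℝ E i))| := by
  obtain ⟨C, hC0, hC⟩ := (Module.finBasis ℝ E).exists_opNorm_le (F := ℝ)
  refine ⟨|c| * C, fun ζ hζ => ?_⟩
  have h1 : ‖ζ‖ ≤ |c| * ‖ζ ∘L A‖ :=
    hζ.trans (mul_le_mul_of_nonneg_right (le_abs_self c) (norm_nonneg _))
  by_cases hne : Nonempty (Fin (Module.finrank ℝ E))
  · obtain ⟨i, -, hi⟩ := Finset.exists_max_image Finset.univ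
      (fun i => |ζ (A (Module.finBasis ℝ E i))|) Finset.univ_nonempty
    refine Or.inr ⟨i, h1.trans ?_⟩
    rw [mul_assoc]
    refine mul_le_mul_of_nonneg_left ?_ (abs_nonneg c)
    exact hC (u := ζ ∘L A) (abs_nonneg _) fun j => hi j (Finset.mem_univ _)
  · left
    have h2 : ‖ζ ∘L A‖ ≤ C * 0 :=
      hC (u := ζ ∘L A) (M := 0) le_rfl fun j => (hne ⟨j⟩).elim
    rw [mul_zero] at h2
    have h3 : ‖ζ ∘L A‖ = 0 := le_antisymm h2 (norm_nonneg _)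
    rw [h3, mul_zero] at h1
    exact norm_le_zero_iff.1 h1

variable [MeasureSpace E] [BorelSpace E] [(volume : Measure E).IsAddHaarMeasure]

theorem integral_fderiv_apply_eq_zero {ψ : E → ℂ} (h : IsTest ψ) (v : E) :
    ∫ x, fderiv ℝ ψ x v = 0 := by
  have h1 := integral_smul_fderiv_eq_neg_fderiv_smul_of_integrable (μ := (volume : Measure E))
    (𝕜 := ℝ) (f := fun _ => (1 : ℝ)) (g := ψ) (v := v) (by simp)
    (by
      simpa using (h.lineDeriv v).continuous.integrable_of_hasCompactSupport
        (h.lineDeriv v).compact)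
    (by simpa using h.continuous.integrable_of_hasCompactSupport h.compact)
    (fun _ _ => differentiableAt_const _) (fun x _ => h.smooth.differentiable (by simp) x)
  simpa using h1

theorem isInvariant_ofFunction_one (v : E) : IsInvariant (ofFunction fun _ : E => (1 : ℂ)) v := by
  intro ψ h
  rw [pair_ofFunction continuous_const (h.lineDeriv v)]
  simpa using integral_fderiv_apply_eq_zero h v

theorem pair_ofFunction_one {ψ : E → ℂ} (h : IsTest ψ) :
    pair (ofFunction fun _ : E => (1 : ℂ)) ψ = ∫ x, ψ x := by
  rw [pair_ofFunction continuous_const h]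
  simp

/-- The wave front set of a smooth function is empty. -/
theorem waveFrontSet_ofFunction {w : E → ℂ} (hw : ContDiff ℝ ∞ w) :
    waveFrontSet (ofFunction w) = ∅ := by
  rw [eq_empty_iff_forall_notMem]
  rintro ⟨x, ξ⟩
  obtain ⟨χ, hχ, -, hχ1⟩ := exists_isTest_eq_one_nhdsSet (isCompact_singleton (x := x))
    isOpen_univ (subset_univ _)
  rw [nhdsSet_singleton] at hχ1
  obtain ⟨c', hc'⟩ := exists_direction (ContinuousLinearMap.id ℝ E) 1
  refine UniformDecay.notMem_waveFrontSet (φ := toTest χ hχ) (V := univ) ?_ isOpen_univ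
    (fun _ _ _ _ => mem_univ _) ?_ (mem_univ _)
  -- A smooth function is `w` times the constant 1, which is invariant in every direction; hence
  -- decay holds on all covectors.
  · refine uniformDecay_of_eq_mul (S := ofFunction fun _ : E => (1 : ℂ))
      (fun i => isInvariant_ofFunction_one (Module.finBasis ℝ E i)) (c := c') ?_ hχ.ofReal hw
      isOpen_univ (subset_univ _) fun Ψ h _ => ?_
    · intro ζ _
      exact hc' ζ (by rw [one_mul]; rfl)
    · rw [pair_ofFunction hw.continuous h, pair_ofFunction_one (h.mul hw)]
  · rw [toTest_apply, hχ1.self_of_nhds]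
    exact one_ne_zero

end WaveFront

/-! ### The wave front set of a tensor product. -/

section Tensor

variable {E : Type*} [NormedAddCommGroup E] [NormedSpace ℝ E] [FiniteDimensional ℝ E]

/-- A closed cone containing the wave front set of a tensor product, in terms of the singular
supports of the factors. -/
def tensorCone (A B : Set E) : Set ((E × E) × (E × E →L[ℝ] ℝ)) :=
  {p | p.2 ≠ 0 ∧ ((p.1.1 ∈ A ∧ p.1.2 ∈ B) ∨
    p.2 ∘L ContinuousLinearMap.inl ℝ E E = 0 ∨ p.2 ∘L ContinuousLinearMap.inr ℝ E E = 0)}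

theorem isClosedCone_tensorCone {A B : Set E} (hA : IsClosed A) (hB : IsClosed B) :
    IsClosedCone (tensorCone A B) where
  ne_zero p hp := hp.1
  conic := by
    rintro ⟨z, ζ⟩ ⟨h0, h⟩ t ht
    refine ⟨smul_ne_zero ht.ne' h0, ?_⟩
    rcases h with h | h | h
    · exact Or.inl h
    · refine Or.inr (Or.inl ?_)
      simp only at h ⊢
      rw [ContinuousLinearMap.smul_comp, h, smul_zero]
    · refine Or.inr (Or.inr ?_)
      simp only at h ⊢
      rw [ContinuousLinearMap.smul_comp, h, smul_zero]
  closed := by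
    -- The zero covector has vanishing components, so adding the zero section merely drops the
    -- condition of being nonzero and leaves closed conditions.
    have h1 : tensorCone A B ∪ {p | p.2 = 0} =
        {p | (p.1.1 ∈ A ∧ p.1.2 ∈ B) ∨
          p.2 ∘L ContinuousLinearMap.inl ℝ E E = 0 ∨
            p.2 ∘L ContinuousLinearMap.inr ℝ E E = 0} := by
      ext ⟨z, ζ⟩
      by_cases h0 : ζ = 0
      · simp [h0]
      · simp [tensorCone, h0]
    rw [h1]
    refine IsClosed.union ?_ (IsClosed.union ?_ ?_)
    · exact (hA.preimage (continuous_fst.comp continuous_fst)).inter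
        (hB.preimage (continuous_snd.comp continuous_fst))
    · exact isClosed_eq (by fun_prop) continuous_const
    · exact isClosed_eq (by fun_prop) continuous_const

/-- The two components of a conormal are opposite, so if one vanishes both do. The remaining case
would put a diagonal point over A ∩ B. -/
theorem disjoint_tensorCone_diagonalConormal {A B : Set E} (hAB : A ∩ B = ∅) :
    Disjoint (tensorCone A B) diagonalConormal := by
  rw [Set.disjoint_left]
  rintro ⟨⟨x, y⟩, ζ⟩ ⟨h0, h⟩ ⟨hxy, -, hζ⟩
  simp only at hxy h0 h hζ
  subst hxy
  have hdec : ∀ v w, ζ (v, w) = ζ (v, 0) + ζ (0, w) := fun v w => by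
    rw [← map_add]
    simp
  have hd : ∀ v, ζ (v, 0) + ζ (0, v) = 0 := fun v => by rw [← hdec, hζ]
  rcases h with h | h | h
  · exact (eq_empty_iff_forall_notMem.1 hAB x) h
  · have hl : ∀ v, ζ (v, 0) = 0 := fun v => congrArg (fun q => q v) h
    refine h0 (ContinuousLinearMap.ext fun z => ?_)
    have := hd z.2
    rw [hl, zero_add] at this
    rw [show z = (z.1, z.2) from rfl, hdec, hl, this]
    simp
  · have hl : ∀ v, ζ (0, v) = 0 := fun v => congrArg (fun q => q v) h
    refine h0 (ContinuousLinearMap.ext fun z => ?_)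
    have := hd z.1
    rw [hl, add_zero] at this
    rw [show z = (z.1, z.2) from rfl, hdec, hl, this]
    simp

variable [MeasureSpace E] [BorelSpace E] [(volume : Measure E).IsAddHaarMeasure]

/-- `T` is given by the iterated pairing with `f` and `g`. -/
def IsIterated (f g : Distr E) (T : Distr (E × E)) : Prop :=
  ∀ Ψ, IsTest Ψ → pair T Ψ = pair f (fun x => pair g (fun y => Ψ (x, y)))

theorem tsupport_pair_slice_subset (g : Distr E) {Ψ : E × E → ℂ} (h : IsTest Ψ) :
    tsupport (fun x => pair g (fun y => Ψ (x, y))) ⊆ Prod.fst '' tsupport Ψ := by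
  refine closure_minimal (fun x hx => ?_) (h.compact.isCompact.image continuous_fst).isClosed
  by_contra hx'
  refine hx ?_
  change pair g (fun y => Ψ (x, y)) = 0
  rw [slice_eq_zero hx', pair_zero]

theorem IsIterated.isInvariant_fst {g : Distr E} {S : Distr (E × E)}
    (hS : IsIterated (ofFunction fun _ : E => (1 : ℂ)) g S) (v : E) : IsInvariant S (v, 0) := by
  intro Ψ h
  have h' := h.lineDeriv (v, 0)
  rw [hS _ h', pair_ofFunction_one (isTest_pair_slice g h'), ← pair_integral volume g h']
  have : (fun y => ∫ x, fderiv ℝ Ψ (x, y) (v, 0)) = fun _ => 0 := by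
    ext y
    have h1 : ∀ x, fderiv ℝ Ψ (x, y) (v, 0) = fderiv ℝ (fun x => Ψ (x, y)) x v := fun x => by
      have h2 := HasFDerivAt.comp (f := fun e : E => (e, y)) x
        ((h.smooth.differentiable (by simp) (x, y)).hasFDerivAt) (hasFDerivAt_prodMk_left x y)
      have h3 : fderiv ℝ (fun x => Ψ (x, y)) x = _ := h2.fderiv
      rw [h3]
      simp
    simp_rw [h1]
    exact integral_fderiv_apply_eq_zero (h.swap.slice y) v
  rw [this, pair_zero]

theorem IsIterated.isInvariant_snd {f : Distr E} {S : Distr (E × E)}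
    (hS : IsIterated f (ofFunction fun _ : E => (1 : ℂ)) S) (v : E) : IsInvariant S (0, v) := by
  intro Ψ h
  have h' := h.lineDeriv (0, v)
  rw [hS _ h']
  have : (fun x => pair (ofFunction fun _ : E => (1 : ℂ)) fun y => fderiv ℝ Ψ (x, y) (0, v)) =
      fun _ => 0 := by
    ext x
    have h1 : ∀ y, fderiv ℝ Ψ (x, y) (0, v) = fderiv ℝ (fun y => Ψ (x, y)) y v := fun y => by
      have h2 := ((h.smooth.differentiable (by simp) (x, y)).hasFDerivAt).comp y
        (hasFDerivAt_prodMk_right x y)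
      have h3 : fderiv ℝ (fun y => Ψ (x, y)) y = _ := h2.fderiv
      rw [h3]
      simp
    simp_rw [h1]
    exact isInvariant_ofFunction_one v _ (h.slice x)
  rw [this, pair_zero]

/-- Near the support of Φ, `T` is a(x) times 1 ⊗ g, which is invariant under translations of the
first variable, and on `V` the first component controls the covector. -/
theorem IsIterated.uniformDecay_fst {f g : Distr E} {T : Distr (E × E)} (hT : IsIterated f g T)
    {Φ : E × E → ℂ} (hΦ : IsTest Φ)
    (hΦf : Disjoint (Prod.fst '' tsupport Φ) (singularSupport f)) {c : ℝ}
    {V : Set (E × E →L[ℝ] ℝ)}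
    (hV : ∀ ζ ∈ V, ‖ζ‖ ≤ c * ‖ζ ∘L ContinuousLinearMap.inl ℝ E E‖) : UniformDecay T Φ V := by
  obtain ⟨a, ha, O, hO, hΦO, haf⟩ := exists_contDiff_eq_near f
    (hΦ.compact.isCompact.image continuous_fst).isClosed hΦf
  obtain ⟨S, hS⟩ : ∃ S, IsIterated (ofFunction fun _ : E => (1 : ℂ)) g S := exists_tensor _ _
  obtain ⟨c', hc'⟩ := exists_direction (ContinuousLinearMap.inl ℝ E E) c
  refine uniformDecay_of_eq_mul (fun i => hS.isInvariant_fst (Module.finBasis ℝ E i))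
    (c := c') (fun ζ hζ => hc' ζ (hV ζ hζ)) hΦ (ha.comp contDiff_fst)
    (hO.preimage continuous_fst) (fun z hz => hΦO ⟨z, hz, rfl⟩) fun Ψ h hs => ?_
  have h' := h.mul (ha.comp contDiff_fst)
  rw [hT _ h, hS _ h', pair_ofFunction_one (isTest_pair_slice g h'),
    haf _ (isTest_pair_slice g h) ((tsupport_pair_slice_subset g h).trans (by
      rintro _ ⟨z, hz, rfl⟩
      exact hs hz))]
  refine integral_congr_ae (ae_of_all _ fun x => ?_)
  simp only [Function.comp_apply]
  rw [mul_comm, ← pair_const_mul g (h.slice x)]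
  simp_rw [mul_comm]

theorem IsIterated.uniformDecay_snd {f g : Distr E} {T : Distr (E × E)} (hT : IsIterated f g T)
    {Φ : E × E → ℂ} (hΦ : IsTest Φ)
    (hΦg : Disjoint (Prod.snd '' tsupport Φ) (singularSupport g)) {c : ℝ}
    {V : Set (E × E →L[ℝ] ℝ)}
    (hV : ∀ ζ ∈ V, ‖ζ‖ ≤ c * ‖ζ ∘L ContinuousLinearMap.inr ℝ E E‖) : UniformDecay T Φ V := by
  obtain ⟨b, hb, O, hO, hΦO, hbg⟩ := exists_contDiff_eq_near g
    (hΦ.compact.isCompact.image continuous_snd).isClosed hΦg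
  obtain ⟨S, hS⟩ : ∃ S, IsIterated f (ofFunction fun _ : E => (1 : ℂ)) S := exists_tensor _ _
  obtain ⟨c', hc'⟩ := exists_direction (ContinuousLinearMap.inr ℝ E E) c
  refine uniformDecay_of_eq_mul (fun i => hS.isInvariant_snd (Module.finBasis ℝ E i))
    (c := c') (fun ζ hζ => hc' ζ (hV ζ hζ)) hΦ (hb.comp contDiff_snd)
    (hO.preimage continuous_snd) (fun z hz => hΦO ⟨z, hz, rfl⟩) fun Ψ h hs => ?_
  have h' := h.mul (hb.comp contDiff_snd)
  rw [hT _ h, hS _ h']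
  congr 1
  ext x
  rw [pair_ofFunction_one (h'.slice x), hbg _ (h.slice x) ((tsupport_slice_subset h x).trans (by
    rintro _ ⟨z, hz, rfl⟩
    exact hs hz))]
  rfl

/-- Off the cone both components of ζ₀ are nonzero, and at least one factor is smooth near its
point; the component belonging to that factor gives decay on an open cone around ζ₀. -/
theorem IsIterated.waveFrontSet_subset {f g : Distr E} {T : Distr (E × E)}
    (hT : IsIterated f g T) :
    waveFrontSet T ⊆ tensorCone (singularSupport f) (singularSupport g) := by
  rintro ⟨z, ζ₀⟩ hz
  refine ⟨hz.1, ?_⟩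
  by_contra! hcon
  obtain ⟨hAB, hl, hr⟩ := hcon
  simp only at hAB hl hr
  have hcone : ∀ A : E →L[ℝ] E × E, ζ₀ ∘L A ≠ 0 → ∃ (c : ℝ) (V : Set (E × E →L[ℝ] ℝ)),
      IsOpen V ∧ IsConic V ∧ ζ₀ ∈ V ∧ ∀ ζ ∈ V, ‖ζ‖ ≤ c * ‖ζ ∘L A‖ := by
    intro A hA
    have hpos : 0 < ‖ζ₀ ∘L A‖ := norm_pos_iff.2 hA
    -- The added 1 makes the inequality strict at ζ₀, so that the cone can be taken open.
    refine ⟨(‖ζ₀‖ + 1) / ‖ζ₀ ∘L A‖, {ζ | ‖ζ‖ < (‖ζ₀‖ + 1) / ‖ζ₀ ∘L A‖ * ‖ζ ∘L A‖}, ?_, ?_, ?_, ?_⟩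
    · exact isOpen_lt (by fun_prop) (by fun_prop)
    · intro ζ hζ t ht
      have hζ' : ‖ζ‖ < (‖ζ₀‖ + 1) / ‖ζ₀ ∘L A‖ * ‖ζ ∘L A‖ := hζ
      change ‖t • ζ‖ < (‖ζ₀‖ + 1) / ‖ζ₀ ∘L A‖ * ‖(t • ζ) ∘L A‖
      rw [ContinuousLinearMap.smul_comp, norm_smul, norm_smul]
      calc ‖t‖ * ‖ζ‖ < ‖t‖ * ((‖ζ₀‖ + 1) / ‖ζ₀ ∘L A‖ * ‖ζ ∘L A‖) :=
            mul_lt_mul_of_pos_left hζ' (norm_pos_iff.2 ht.ne')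
        _ = _ := by ring
    · change ‖ζ₀‖ < (‖ζ₀‖ + 1) / ‖ζ₀ ∘L A‖ * ‖ζ₀ ∘L A‖
      rw [div_mul_cancel₀ _ hpos.ne']
      linarith
    · exact fun ζ hζ => le_of_lt hζ
  have hbump : ∀ U : Set (E × E), IsOpen U → z ∈ U → ∃ χ : E × E → ℝ, IsTest χ ∧
      tsupport χ ⊆ U ∧ χ z ≠ 0 := by
    intro U hU hzU
    obtain ⟨χ, hχ, hs, hχ1⟩ := exists_isTest_eq_one_nhdsSet (isCompact_singleton (x := z))
      hU (singleton_subset_iff.2 hzU)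
    rw [nhdsSet_singleton] at hχ1
    exact ⟨χ, hχ, hs, by rw [hχ1.self_of_nhds]; exact one_ne_zero⟩
  by_cases hzA : z.1 ∈ singularSupport f
  · obtain ⟨c, V, hV, hVc, hζV, hVb⟩ := hcone _ hr
    obtain ⟨χ, hχ, hs, hχz⟩ := hbump (Prod.snd ⁻¹' (singularSupport g)ᶜ)
      ((isClosed_singularSupport g).isOpen_compl.preimage continuous_snd) (hAB hzA)
    refine UniformDecay.notMem_waveFrontSet (φ := toTest χ hχ) (V := V) ?_ hV hVc hχz hζV hz
    refine hT.uniformDecay_snd hχ.ofReal ?_ hVb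
    rw [Set.disjoint_left]
    rintro _ ⟨w, hw, rfl⟩
    exact hs (tsupport_comp_subset (g := ((↑) : ℝ → ℂ)) rfl _ hw)
  · obtain ⟨c, V, hV, hVc, hζV, hVb⟩ := hcone _ hl
    obtain ⟨χ, hχ, hs, hχz⟩ := hbump (Prod.fst ⁻¹' (singularSupport f)ᶜ)
      ((isClosed_singularSupport f).isOpen_compl.preimage continuous_fst) hzA
    refine UniformDecay.notMem_waveFrontSet (φ := toTest χ hχ) (V := V) ?_ hV hVc hχz hζV hz
    refine hT.uniformDecay_fst hχ.ofReal ?_ hVb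
    rw [Set.disjoint_left]
    rintro _ ⟨w, hw, rfl⟩
    exact hs (tsupport_comp_subset (g := ((↑) : ℝ → ℂ)) rfl _ hw)

end Tensor

/-! ### Convergence of mollifications in 𝓓'_Γ. -/

section Approximation

variable {E : Type*} [NormedAddCommGroup E] [NormedSpace ℝ E] [FiniteDimensional ℝ E]

theorem continuous_pair_translate_expChar (u : Distr E) {Φ : E → ℂ} (h : IsTest Φ) :
    Continuous (fun p : E × (E →L[ℝ] ℝ) =>
      pair u (fun y => Φ (y + p.1) * expChar p.2 (y + p.1))) := by
  rw [continuous_iff_continuousAt]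
  intro x
  obtain ⟨χ, hχ, -, hχ1⟩ := exists_isTest_eq_one_nhdsSet (isCompact_singleton (x := x)) isOpen_univ
    (subset_univ _)
  rw [nhdsSet_singleton] at hχ1
  have hΨ : IsTest (fun z : (E × (E →L[ℝ] ℝ)) × E =>
      (χ z.1 : ℂ) * (Φ (z.2 + z.1.1) * expChar z.1.2 (z.2 + z.1.1))) := by
    constructor
    · have hadd : ContDiff ℝ ∞ (fun z : (E × (E →L[ℝ] ℝ)) × E => z.2 + z.1.1) := by fun_prop
      have hexp : ContDiff ℝ ∞
          (fun z : (E × (E →L[ℝ] ℝ)) × E => expChar z.1.2 (z.2 + z.1.1)) := by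
        have h1 : ContDiff ℝ ∞ (fun z : (E × (E →L[ℝ] ℝ)) × E => z.1.2 (z.2 + z.1.1)) :=
          (contDiff_snd.comp contDiff_fst).clm_apply hadd
        exact (contDiff_const.mul (Complex.ofRealCLM.contDiff.comp h1)).neg.cexp
      exact (hχ.ofReal.smooth.comp contDiff_fst).mul ((h.smooth.comp hadd).mul hexp)
    · have hc : Continuous (fun z : (E × (E →L[ℝ] ℝ)) × E => (z.1, z.2 - z.1.1)) := by fun_prop
      refine HasCompactSupport.intro
        ((hχ.compact.isCompact.prod h.compact.isCompact).image hc) fun z hz => ?_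
      by_contra hne
      refine hz ⟨(z.1, z.2 + z.1.1), ⟨subset_tsupport _ fun h0 => hne ?_,
        subset_tsupport _ fun h0 => hne ?_⟩, by simp⟩
      · simp [h0]
      · simp [h0]
  refine (contDiff_pair_slice u hΨ).continuous.continuousAt.congr ?_
  filter_upwards [hχ1] with y hy
  simp [hy]

theorem expChar_add (ζ : E →L[ℝ] ℝ) (x y : E) : expChar ζ (x + y) = expChar ζ x * expChar ζ y := by
  rw [expChar, expChar, expChar, ← Complex.exp_add, map_add]
  push_cast
  ring_nf

/-- ‖ζ ∘ A‖ has a positive minimum on the compact set of unit covectors in `V`; homogeneity does the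
rest. -/
theorem exists_norm_le_of_isClosed_isConic {F : Type*} [NormedAddCommGroup F] [NormedSpace ℝ F]
    {V : Set (E →L[ℝ] ℝ)} (hV : IsClosed V) (hVc : IsConic V) (A : F →L[ℝ] E)
    (hA : ∀ ζ ∈ V, ζ ∘L A = 0 → ζ = 0) : ∃ c : ℝ, ∀ ζ ∈ V, ‖ζ‖ ≤ c * ‖ζ ∘L A‖ := by
  have hS : IsCompact (V ∩ Metric.sphere 0 1) := (isCompact_sphere 0 1).inter_left hV
  have hscale : ∀ ζ ∈ V, ζ ≠ 0 → ‖ζ‖⁻¹ • ζ ∈ V ∩ Metric.sphere 0 1 := fun ζ hζ h0 => by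
    refine ⟨hVc ζ hζ _ (inv_pos.2 (norm_pos_iff.2 h0)), ?_⟩
    rw [mem_sphere_zero_iff_norm, norm_smul, norm_inv, norm_norm,
      inv_mul_cancel₀ (norm_ne_zero_iff.2 h0)]
  rcases (V ∩ Metric.sphere 0 1).eq_empty_or_nonempty with he | hne
  · refine ⟨0, fun ζ hζ => ?_⟩
    have h0 : ζ = 0 := by
      by_contra h0
      exact (he ▸ hscale ζ hζ h0 : _ ∈ (∅ : Set (E →L[ℝ] ℝ)))
    simp [h0]
  · obtain ⟨ζ₀, hζ₀, hmin⟩ := hS.exists_isMinOn hne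
      (f := fun ζ => ‖ζ ∘L A‖) (by fun_prop)
    have hpos : 0 < ‖ζ₀ ∘L A‖ := norm_pos_iff.2 fun h => by
      have h1 := mem_sphere_zero_iff_norm.1 hζ₀.2
      rw [hA ζ₀ hζ₀.1 h, norm_zero] at h1
      exact zero_ne_one h1
    refine ⟨‖ζ₀ ∘L A‖⁻¹, fun ζ hζ => ?_⟩
    by_cases h0 : ζ = 0
    · simp [h0]
    · have h1 : ‖ζ₀ ∘L A‖ ≤ ‖(‖ζ‖⁻¹ • ζ) ∘L A‖ := hmin (hscale ζ hζ h0)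
      have hz : 0 < ‖ζ‖ := norm_pos_iff.2 h0
      rw [ContinuousLinearMap.smul_comp, norm_smul, norm_inv, norm_norm, inv_mul_eq_div,
        le_div_iff₀ hz] at h1
      rwa [inv_mul_eq_div, le_div_iff₀ hpos, mul_comm]

variable [MeasureSpace E] [BorelSpace E] [(volume : Measure E).IsAddHaarMeasure]

/-- The mollified transform is the average over small s of the transforms of `T` cut off by
translates of Φ, up to unimodular factors. Bounded frequencies are handled by joint continuity and
compactness, large ones by uniform decay with one extra power. -/
theorem IsMollifier.eventually_fourier_le {R : ℕ → E → ℝ} (hR : IsMollifier R) {T : Distr E}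
    {Φ : E → ℂ} (hΦ : IsTest Φ) {V : Set (E →L[ℝ] ℝ)} (h : UniformDecay T Φ V) (N : ℕ) {ε : ℝ}
    (hε : 0 < ε) : ∀ᶠ j in atTop, ∀ ζ ∈ V, ‖ζ‖ ^ N *
      ‖pair (ofFunction (mollify T (R j))) (fun y => Φ y * expChar ζ y) -
        pair T (fun y => Φ y * expChar ζ y)‖ ≤ ε := by
  obtain ⟨δ, hδ, H⟩ := h
  obtain ⟨C, hC0, hC⟩ := H (N + 1)
  let k : E × (E →L[ℝ] ℝ) → ℂ := fun p =>
    pair T (fun y => Φ (y + p.1) * expChar p.2 (y + p.1))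
  have hk : Continuous k := continuous_pair_translate_expChar T hΦ
  have hknorm : ∀ s ζ, ‖k (s, ζ)‖ = ‖pair T (fun y => Φ (y + s) * expChar ζ y)‖ := fun s ζ => by
    have h1 : (fun y => Φ (y + s) * expChar ζ (y + s)) =
        fun y => expChar ζ s * (Φ (y + s) * expChar ζ y) := by
      ext y
      rw [expChar_add]
      ring
    simp only [k]
    rw [h1, pair_const_mul T ((hΦ.comp_add_right s).mul (contDiff_expChar ζ)), norm_mul,
      norm_expChar, one_mul]
  -- Beyond this radius 2C / (1 + t)^(N + 1) is at most ε / (1 + t)^N.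
  let r := 2 * C / ε
  have hr : 0 ≤ r := by positivity
  have hsmall : ∀ᶠ s in 𝓝 (0 : E), ∀ ζ ∈ Metric.closedBall (0 : E →L[ℝ] ℝ) r,
      ‖k (s, ζ) - k (0, ζ)‖ ≤ ε / (1 + r) ^ N := by
    refine (isCompact_closedBall 0 r).eventually_forall_of_forall_eventually fun ζ _ => ?_
    have hc : Continuous (fun z : E × (E →L[ℝ] ℝ) => ‖k (z.1, z.2) - k (0, z.2)‖) := by fun_prop
    refine (hc.tendsto (0, ζ)).eventually_le_const ?_
    simp only [sub_self, norm_zero]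
    positivity
  obtain ⟨δ', hδ', hsmall⟩ := Metric.eventually_nhds_iff.1 hsmall
  filter_upwards [hR.support (min δ δ') (lt_min hδ hδ')] with j hj ζ hζ
  have hψ : IsTest (fun y => Φ y * expChar ζ y) := hΦ.mul (contDiff_expChar ζ)
  rw [pair_ofFunction_mollify T (hR.test j) hψ]
  have hk0 : pair T (fun y => Φ y * expChar ζ y) = k (0, ζ) := by simp [k]
  rw [hk0]
  set t := ‖ζ‖ with ht
  have ht0 : 0 ≤ t := norm_nonneg ζ
  have hkey : ∀ s, ‖s‖ < min δ δ' → ‖k (s, ζ) - k (0, ζ)‖ ≤ ε / (1 + t) ^ N := by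
    intro s hs
    by_cases htr : t ≤ r
    · refine (hsmall (by simpa using hs.trans_le (min_le_right _ _)) ζ (by simpa using htr)).trans ?_
      gcongr
    · push Not at htr
      have hb : ∀ s, ‖s‖ < δ → ‖k (s, ζ)‖ ≤ C / (1 + t) ^ (N + 1) := fun s hs => by
        rw [hknorm, le_div_iff₀ (by positivity), mul_comm]
        exact hC s hs ζ hζ
      refine (norm_sub_le _ _).trans ((add_le_add (hb s (hs.trans_le (min_le_left _ _)))
        (hb 0 (by simpa using hδ))).trans ?_)
      rw [← add_div, div_le_div_iff₀ (by positivity) (by positivity), pow_succ]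
      have h2 : 2 * C ≤ ε * (1 + t) := by
        have : 2 * C < t * ε := (div_lt_iff₀ hε).1 htr
        nlinarith
      nlinarith [mul_le_mul_of_nonneg_right h2 (show (0 : ℝ) ≤ (1 + t) ^ N by positivity)]
  have h3 := hR.norm_integral_sub_le j (h := fun s => k (s, ζ)) (by fun_prop) (k (0, ζ))
    (ε := ε / (1 + t) ^ N) fun s hs => hkey s (hj s hs)
  calc t ^ N * _ ≤ (1 + t) ^ N * (ε / (1 + t) ^ N) := by
        refine mul_le_mul ?_ h3 (norm_nonneg _) (by positivity)
        exact pow_le_pow_left₀ ht0 (by linarith) N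
    _ = ε := mul_div_cancel₀ _ (by positivity)

theorem uniformDecay_of_subset_zero (T : Distr E) {Φ : E → ℂ} (hΦ : IsTest Φ)
    {V : Set (E →L[ℝ] ℝ)} (hV : ∀ ζ ∈ V, ζ = 0) : UniformDecay T Φ V :=
  uniformDecay_of_eq_mul (ι := Fin 0) (S := T) (v := fun _ => 0) (fun i => i.elim0) (c := 0)
    (fun ζ hζ => Or.inl (hV ζ hζ)) hΦ (m := fun _ => 1) contDiff_const isOpen_univ
    (subset_univ _) fun _ _ _ => by simp

/-- If neither the support nor `V \ {0}` is empty, disjointness makes both components control the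
norm on `V` and keeps the support away from singsupp f × singsupp g. A partition `θ`, `1 - θ` then
splits φ into a piece over the smooth part of f and one over the smooth part of g. -/
theorem IsIterated.uniformDecay {f g : Distr E} {T : Distr (E × E)} (hT : IsIterated f g T)
    {φ : E × E → ℝ} (hφ : IsTest φ) {V : Set (E × E →L[ℝ] ℝ)} (hV : IsClosed V) (hVc : IsConic V)
    (hd : Disjoint (tensorCone (singularSupport f) (singularSupport g)) (tsupport φ ×ˢ V)) :
    UniformDecay T (fun z => (φ z : ℂ)) V := by
  -- The cone contains only nonzero covectors, so V ⊆ {0} gives no information about the support of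
  -- φ and is treated apart.
  by_cases hV0 : ∀ ζ ∈ V, ζ = 0
  · exact uniformDecay_of_subset_zero T hφ.ofReal hV0
  push Not at hV0
  obtain ⟨ζ₁, hζ₁, hζ₁0⟩ := hV0
  rcases (tsupport φ).eq_empty_or_nonempty with he | ⟨z₁, hz₁⟩
  · have h0 : φ = 0 := tsupport_eq_empty_iff.1 he
    refine ⟨1, one_pos, fun N => ⟨0, le_rfl, fun s _ ζ _ => ?_⟩⟩
    simp [h0, pair_zero]
  have key : ∀ z ∈ tsupport φ, ∀ ζ ∈ V, ζ ≠ 0 →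
      ¬((z.1 ∈ singularSupport f ∧ z.2 ∈ singularSupport g) ∨
        ζ ∘L ContinuousLinearMap.inl ℝ E E = 0 ∨ ζ ∘L ContinuousLinearMap.inr ℝ E E = 0) :=
    fun z hz ζ hζ h0 h => (Set.disjoint_left.1 hd) (show (z, ζ) ∈ tensorCone _ _ from ⟨h0, h⟩) ⟨hz, hζ⟩
  obtain ⟨c, hc⟩ := exists_norm_le_of_isClosed_isConic hV hVc (ContinuousLinearMap.inl ℝ E E)
    fun ζ hζ h => by
      by_contra h0
      exact key z₁ hz₁ ζ hζ h0 (Or.inr (Or.inl h))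
  obtain ⟨c', hc'⟩ := exists_norm_le_of_isClosed_isConic hV hVc (ContinuousLinearMap.inr ℝ E E)
    fun ζ hζ h => by
      by_contra h0
      exact key z₁ hz₁ ζ hζ h0 (Or.inr (Or.inr h))
  obtain ⟨θ, hθ, hθ0, hθ1⟩ := exists_contDiff_zero_one_nhdsSet
    (s := tsupport φ ∩ Prod.fst ⁻¹' singularSupport f)
    (t := tsupport φ ∩ Prod.snd ⁻¹' singularSupport g)
    ((isClosed_tsupport _).inter ((isClosed_singularSupport f).preimage continuous_fst))
    ((isClosed_tsupport _).inter ((isClosed_singularSupport g).preimage continuous_snd))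
    (Set.disjoint_left.2 fun z hz hz' => key z hz.1 ζ₁ hζ₁ hζ₁0 (Or.inl ⟨hz.2, hz'.2⟩))
  have hθc : ContDiff ℝ ∞ (fun z => (θ z : ℂ)) := Complex.ofRealCLM.contDiff.comp hθ
  have hφc : tsupport (fun z => (φ z : ℂ)) ⊆ tsupport φ :=
    tsupport_comp_subset (g := ((↑) : ℝ → ℂ)) rfl _
  have h1 : UniformDecay T (fun z => (φ z : ℂ) * θ z) V := by
    refine hT.uniformDecay_fst (hφ.ofReal.mul hθc) (Set.disjoint_left.2 ?_) hc
    rintro _ ⟨z, hz, rfl⟩ hzf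
    have h2 := tsupport_mul_subset_right hz
    refine (notMem_tsupport_iff_eventuallyEq.2 ?_) h2
    filter_upwards [eventually_nhdsSet_iff_forall.1 hθ0 z
      ⟨hφc (tsupport_mul_subset_left hz), hzf⟩] with w hw
    simp [hw]
  have h2 : UniformDecay T (fun z => (φ z : ℂ) * (1 - θ z)) V := by
    refine hT.uniformDecay_snd (hφ.ofReal.mul (contDiff_const.sub hθc))
      (Set.disjoint_left.2 ?_) hc'
    rintro _ ⟨z, hz, rfl⟩ hzf
    have h2 := tsupport_mul_subset_right hz
    refine (notMem_tsupport_iff_eventuallyEq.2 ?_) h2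
    filter_upwards [eventually_nhdsSet_iff_forall.1 hθ1 z
      ⟨hφc (tsupport_mul_subset_left hz), hzf⟩] with w hw
    simp [hw]
  have h3 := h1.add (hφ.ofReal.mul hθc) (hφ.ofReal.mul (contDiff_const.sub hθc)) h2
  convert h3 using 2
  ring

/-- Mollifications of `f ⊗ g` converge in the space of distributions with wave front set in
the canonical cone. -/
theorem IsIterated.tendstoIn_mollify {f g : Distr E} {T : Distr (E × E)} (hT : IsIterated f g T)
    {R : ℕ → E × E → ℝ} (hR : IsMollifier R) :
    TendstoIn (tensorCone (singularSupport f) (singularSupport g))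
      (fun j => ofFunction (mollify T (R j))) T where
  mem_seq j := by
    rw [waveFrontSet_ofFunction (contDiff_mollify T (hR.test j))]
    exact empty_subset _
  mem_limit := hT.waveFrontSet_subset
  weak φ := by
    have := hR.tendsto_pair T (isTest_test φ).ofReal
    simpa only [pair_ofReal] using this
  fourier φ V hV hVc hd N ε hε := by
    simp_rw [localFourier_eq_pair]
    exact hR.eventually_fourier_le (isTest_test φ).ofReal
      (hT.uniformDecay (isTest_test φ) hV hVc hd) N hε

end Approximation

/-! ### Diagonal values of product mollifications, and the candidate product. -/

section Diagonal

variable {E : Type*} [NormedAddCommGroup E] [NormedSpace ℝ E] [FiniteDimensional ℝ E]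

theorem continuous_pair_translate_mul (u : Distr E) {φ q : E → ℂ} (h : IsTest φ) (h' : IsTest q) :
    Continuous (fun p : E × E => pair u (fun y => φ (y + p.1) * q (y + p.1 - p.2))) := by
  rw [continuous_iff_continuousAt]
  intro x
  obtain ⟨χ, hχ, -, hχ1⟩ := exists_isTest_eq_one_nhdsSet (isCompact_singleton (x := x)) isOpen_univ
    (subset_univ _)
  rw [nhdsSet_singleton] at hχ1
  have hΨ : IsTest (fun z : (E × E) × E =>
      (χ z.1 : ℂ) * (φ (z.2 + z.1.1) * q (z.2 + z.1.1 - z.1.2))) := by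
    constructor
    · have h1 : ContDiff ℝ ∞ (fun z : (E × E) × E => z.2 + z.1.1) := by fun_prop
      have h2 : ContDiff ℝ ∞ (fun z : (E × E) × E => z.2 + z.1.1 - z.1.2) := by fun_prop
      exact (hχ.ofReal.smooth.comp contDiff_fst).mul ((h.smooth.comp h1).mul (h'.smooth.comp h2))
    · have hc : Continuous (fun z : (E × E) × E => (z.1, z.2 - z.1.1)) := by fun_prop
      refine HasCompactSupport.intro
        ((hχ.compact.isCompact.prod h.compact.isCompact).image hc) fun z hz => ?_
      by_contra hne
      refine hz ⟨(z.1, z.2 + z.1.1), ⟨subset_tsupport _ fun h0 => hne ?_,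
        subset_tsupport _ fun h0 => hne ?_⟩, by simp⟩
      · simp [h0]
      · simp [h0]
  refine (contDiff_pair_slice u hΨ).continuous.continuousAt.congr ?_
  filter_upwards [hχ1] with y hy
  simp [hy]

variable [MeasureSpace E] [BorelSpace E] [(volume : Measure E).IsAddHaarMeasure]

theorem mollify_ofFunction {q : E → ℂ} (hq : Continuous q) {r : E → ℝ} (hr : IsTest r) (x : E) :
    mollify (ofFunction q) r x = ∫ s, (r s : ℂ) * q (x - s) := by
  rw [mollify, pair_ofFunction hq (hr.comp_sub_left x).ofReal]
  rw [← integral_sub_left_eq_self _ _ x]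
  simp

theorem IsTest.integrable {ψ : E → ℂ} (h : IsTest ψ) : Integrable ψ :=
  h.continuous.integrable_of_hasCompactSupport h.compact

/-- Unfolding both mollifications gives one average over pairs of displacements of a quantity
continuous in the pair; its value at the origin is the limit sought. -/
theorem integral_mul_mollify_ofFunction_mul_mollify (g : Distr E) {φ q : E → ℂ} (hφ : IsTest φ)
    (hq : IsTest q) {r : E → ℝ} (hr : IsTest r) :
    ∫ x, φ x * mollify (ofFunction q) r x * mollify g r x =
      ∫ p : E × E, ((r p.1 * r p.2 : ℝ) : ℂ) *
        pair g (fun y => φ (y + p.1) * q (y + p.1 - p.2)) := by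
  have hψ : IsTest (fun x => φ x * mollify (ofFunction q) r x) :=
    hφ.mul (contDiff_mollify _ hr)
  rw [← pair_ofFunction (contDiff_mollify g hr).continuous hψ, pair_ofFunction_mollify g hr hψ]
  have hrr := hr.tensor_real hr
  have hint : Integrable (fun p : E × E => ((r p.1 * r p.2 : ℝ) : ℂ) *
      pair g (fun y => φ (y + p.1) * q (y + p.1 - p.2))) := by
    refine Continuous.integrable_of_hasCompactSupport ?_ hrr.ofReal.compact.mul_right
    exact hrr.ofReal.continuous.mul (continuous_pair_translate_mul g hφ hq)
  rw [Measure.volume_eq_prod, integral_prod _ hint]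
  refine integral_congr_ae (ae_of_all _ fun t => ?_)
  simp only
  have hΨ : IsTest (fun z : E × E => (r z.1 : ℂ) * (φ (z.2 + t) * q (z.2 + t - z.1))) := by
    constructor
    · have h1 : ContDiff ℝ ∞ (fun z : E × E => z.2 + t) := by fun_prop
      have h2 : ContDiff ℝ ∞ (fun z : E × E => z.2 + t - z.1) := by fun_prop
      exact (hr.ofReal.smooth.comp contDiff_fst).mul ((hφ.smooth.comp h1).mul (hq.smooth.comp h2))
    · refine HasCompactSupport.intro
        (hr.compact.isCompact.prod (hφ.comp_add_right t).compact.isCompact) fun z hz => ?_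
      by_contra hne
      refine hz ⟨subset_tsupport _ fun h0 => hne ?_, subset_tsupport _ fun h0 => hne ?_⟩
      · simp [h0]
      · simp [h0]
  have h1 : (fun y => φ (y + t) * mollify (ofFunction q) r (y + t)) =
      fun y => ∫ s, (r s : ℂ) * (φ (y + t) * q (y + t - s)) := by
    ext y
    rw [mollify_ofFunction hq.continuous hr, ← integral_const_mul]
    refine integral_congr_ae (ae_of_all _ fun s => ?_)
    simp only
    ring
  rw [h1, pair_integral volume g hΨ, ← integral_const_mul]
  refine integral_congr_ae (ae_of_all _ fun s => ?_)
  simp only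
  have hs : IsTest (fun y => φ (y + t) * q (y + t - s)) := by
    have := (hφ.comp_add_right t).mul ((hq.comp_add_right (t - s)).smooth)
    simpa [add_sub_assoc] using this
  rw [pair_const_mul g hs]
  push_cast
  ring

/-- Convergence of the product of the mollifications where one factor is smooth. -/
theorem IsMollifier.tendsto_integral_mul_mollify {R : ℕ → E → ℝ} (hR : IsMollifier R)
    (f g : Distr E) {a : E → ℂ} (ha : ContDiff ℝ ∞ a) {O : Set E} (hO : IsOpen O)
    (hfa : ∀ ψ, IsTest ψ → tsupport ψ ⊆ O → pair f ψ = ∫ y, ψ y * a y) {φ : E → ℂ}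
    (hφ : IsTest φ) (hφO : tsupport φ ⊆ O) :
    Tendsto (fun j => ∫ x, φ x * (mollify f (R j) x * mollify g (R j) x)) atTop
      (𝓝 (pair g (fun x => φ x * a x))) := by
  obtain ⟨θ, hθ, -, hθ1⟩ := exists_isTest_eq_one_nhdsSet hφ.compact.isCompact hO hφO
  obtain ⟨U, hU, hφU, hU1⟩ := mem_nhdsSet_iff_exists.1 hθ1
  obtain ⟨δ, hδ, hδU⟩ := hφ.compact.isCompact.exists_cthickening_subset_open (hO.inter hU)
    (subset_inter hφO hφU)
  -- The cutoff makes the density of `f` a test function. Once the kernel has radius below δ,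
  -- mollifying `f` or this function gives the same values on the support of φ.
  have hq : IsTest (fun y => (θ y : ℂ) * a y) := hθ.ofReal.mul ha
  have hlim := hR.prod.tendsto_integral (continuous_pair_translate_mul g hφ hq)
  have h0 : (fun y => φ (y + (0 : E × E).1) *
      ((θ (y + (0 : E × E).1 - (0 : E × E).2) : ℂ) * a (y + (0 : E × E).1 - (0 : E × E).2))) =
      fun y => φ y * a y := by
    ext y
    simp only [Prod.fst_zero, Prod.snd_zero, add_zero, sub_zero]
    by_cases hy : y ∈ tsupport φ
    · have : θ y = 1 := hU1 (hφU hy)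
      simp [this]
    · simp [image_eq_zero_of_notMem_tsupport hy]
  rw [h0] at hlim
  refine hlim.congr' ?_
  filter_upwards [hR.support δ hδ] with j hj
  rw [← integral_mul_mollify_ofFunction_mul_mollify g hφ hq (hR.test j)]
  refine integral_congr_ae (ae_of_all _ fun x => ?_)
  simp only
  rw [← mul_assoc]
  congr 1
  by_cases hx : x ∈ tsupport φ
  · congr 1
    have hball : ∀ y, ‖x - y‖ ≤ δ → y ∈ O ∩ U := fun y hy => hδU <|
      Metric.mem_cthickening_of_dist_le y x δ _ hx (by rwa [dist_comm, dist_eq_norm])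
    have hs : tsupport (fun y => (R j (x - y) : ℂ)) ⊆ {y | ‖x - y‖ ≤ δ} := by
      refine closure_minimal (fun y hy => (hj (x - y) ?_).le) (isClosed_le (by fun_prop) (by fun_prop))
      intro h
      exact hy (by simp [h])
    have ht := ((hR.test j).comp_sub_left x).ofReal
    rw [mollify, mollify, pair_ofFunction hq.continuous ht,
      hfa _ ht (hs.trans fun y hy => (hball y hy).1)]
    refine integral_congr_ae (ae_of_all _ fun y => ?_)
    simp only
    by_cases hy : y ∈ tsupport (fun y => (R j (x - y) : ℂ))
    · have : θ y = 1 := hU1 (hball y (hs hy)).2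
      simp [this]
    · have := image_eq_zero_of_notMem_tsupport hy
      simp [this]
  · simp [image_eq_zero_of_notMem_tsupport hx]

/-- The product of two distributions with disjoint singular supports, as a sum of products of a
distribution with a smooth function. -/
theorem exists_product (f g : Distr E) (hfg : Disjoint (singularSupport f) (singularSupport g)) :
    ∃ (p : Distr E) (m₁ m₂ : E → ℂ), ContDiff ℝ ∞ m₁ ∧ ContDiff ℝ ∞ m₂ ∧
      (∀ ψ, IsTest ψ → pair p ψ = pair g (fun x => ψ x * m₁ x) + pair f (fun x => ψ x * m₂ x)) ∧
      ∀ R : ℕ → E → ℝ, IsMollifier R → ∀ φ, IsTest φ →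
        Tendsto (fun j => ∫ x, φ x * (mollify f (R j) x * mollify g (R j) x)) atTop
          (𝓝 (pair p φ)) := by
  obtain ⟨χ, hχ, hχ0, hχ1⟩ := exists_contDiff_zero_one_nhdsSet (isClosed_singularSupport f)
    (isClosed_singularSupport g) hfg
  have hχc : ContDiff ℝ ∞ (fun x => (χ x : ℂ)) := Complex.ofRealCLM.contDiff.comp hχ
  have hχc' : ContDiff ℝ ∞ (fun x => 1 - (χ x : ℂ)) := contDiff_const.sub hχc
  have hd₁ : Disjoint (tsupport fun x => (χ x : ℂ)) (singularSupport f) := by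
    rw [Set.disjoint_left]
    intro x hx hxf
    refine (notMem_tsupport_iff_eventuallyEq.2 ?_) hx
    filter_upwards [eventually_nhdsSet_iff_forall.1 hχ0 x hxf] with w hw
    simp [hw]
  have hd₂ : Disjoint (tsupport fun x => 1 - (χ x : ℂ)) (singularSupport g) := by
    rw [Set.disjoint_left]
    intro x hx hxf
    refine (notMem_tsupport_iff_eventuallyEq.2 ?_) hx
    filter_upwards [eventually_nhdsSet_iff_forall.1 hχ1 x hxf] with w hw
    simp [hw]
  obtain ⟨a, ha, O₁, hO₁, hs₁, hfa⟩ := exists_contDiff_eq_near f (isClosed_tsupport _) hd₁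
  obtain ⟨b, hb, O₂, hO₂, hs₂, hgb⟩ := exists_contDiff_eq_near g (isClosed_tsupport _) hd₂
  have hm₁ : ContDiff ℝ ∞ (fun x => (χ x : ℂ) * a x) := hχc.mul ha
  have hm₂ : ContDiff ℝ ∞ (fun x => (1 - (χ x : ℂ)) * b x) := hχc'.mul hb
  obtain ⟨u, hu⟩ := exists_mul_distr g hm₁
  obtain ⟨v, hv⟩ := exists_mul_distr f hm₂
  have hp : ∀ ψ, IsTest ψ → pair (u + v) ψ = pair g (fun x => ψ x * ((χ x : ℂ) * a x)) +
      pair f (fun x => ψ x * ((1 - (χ x : ℂ)) * b x)) := fun ψ h => by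
    rw [pair_add_distr u v h, hu ψ h, hv ψ h]
  refine ⟨u + v, _, _, hm₁, hm₂, hp, fun R hR φ hφ => ?_⟩
  -- Split φ as φχ + φ(1 - χ): on the first piece `f` is smooth, on the second `g` is, with the
  -- roles exchanged.
  have h1 := hR.tendsto_integral_mul_mollify f g ha hO₁ hfa (hφ.mul hχc)
    (tsupport_mul_subset_right.trans hs₁)
  have h2 := hR.tendsto_integral_mul_mollify g f hb hO₂ hgb (hφ.mul hχc')
    (tsupport_mul_subset_right.trans hs₂)
  rw [hp φ hφ]
  simp_rw [← mul_assoc] at h1 h2 ⊢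
  refine (h1.add h2).congr fun j => ?_
  have hF := contDiff_mollify f (hR.test j)
  have hG := contDiff_mollify g (hR.test j)
  rw [← integral_add (((hφ.mul hχc).mul hF).mul hG).integrable
    (((hφ.mul hχc').mul hG).mul hF).integrable]
  refine integral_congr_ae (ae_of_all _ fun x => ?_)
  simp only
  ring

end Diagonal

/-! ### Hölder bounds under multiplication by smooth functions. -/

section HolderBounds

variable {d : ℕ}

theorem toTest_mem_unitTests {ψ : EuclideanSpace ℝ (Fin d) → ℂ} (h : IsTest ψ)
    (hs : tsupport ψ ⊆ Metric.ball 0 1) {r : ℕ} {B : ℝ} (hB0 : 0 < B)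
    (hB : ∀ i ≤ r, ∀ y, ‖iteratedFDeriv ℝ i ψ y‖ ≤ B) {L : ℂ →L[ℝ] ℝ} (hL : ‖L‖ ≤ B⁻¹)
    (hLψ : IsTest (L ∘ ψ)) : toTest (L ∘ ψ) hLψ ∈ unitTests d r := by
  refine ⟨(tsupport_comp_subset (map_zero L) ψ).trans hs, fun i hi x => ?_⟩
  refine (L.norm_iteratedFDeriv_comp_left (h.smooth.contDiffAt (x := x)) (n := i)
    (by exact_mod_cast le_top)).trans ?_
  calc ‖L‖ * ‖iteratedFDeriv ℝ i ψ x‖ ≤ B⁻¹ * B :=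
        mul_le_mul hL (hB i hi x) (norm_nonneg _) (inv_nonneg.2 hB0.le)
    _ = 1 := inv_mul_cancel₀ hB0.ne'

/-- The Hölder bound for complex test functions of arbitrary size. -/
theorem exists_bound_pair_rescale {u : Distr (EuclideanSpace ℝ (Fin d))} {α : ℝ}
    (hu : u ∈ negHolderLoc d α) {K : Set (EuclideanSpace ℝ (Fin d))} (hK : IsCompact K) :
    ∃ C, 0 ≤ C ∧ ∀ x ∈ K, ∀ lam : ℝ, 0 < lam → lam ≤ 1 →
      ∀ ψ : EuclideanSpace ℝ (Fin d) → ℂ, IsTest ψ → tsupport ψ ⊆ Metric.ball 0 1 →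
        ∀ B, 0 < B → (∀ i ≤ (-strictFloor α).toNat, ∀ y, ‖iteratedFDeriv ℝ i ψ y‖ ≤ B) →
          ‖pair u (fun y => ((lam ^ d)⁻¹ : ℝ) * ψ (lam⁻¹ • (x - y)))‖ ≤ C * B * lam ^ α := by
  obtain ⟨C, hC⟩ := hu K hK
  refine ⟨2 * |C|, by positivity, fun x hx lam hlam hlam1 ψ h hs B hB0 hB => ?_⟩
  have hnorm : ∀ L : ℂ →L[ℝ] ℝ, ‖L‖ ≤ 1 → ‖B⁻¹ • L‖ ≤ B⁻¹ := fun L hL => by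
    rw [norm_smul, Real.norm_of_nonneg (inv_nonneg.2 hB0.le)]
    exact mul_le_of_le_one_right (inv_nonneg.2 hB0.le) hL
  have htest : ∀ L : ℂ →L[ℝ] ℝ, IsTest (L ∘ ψ) := fun L =>
    ⟨L.contDiff.comp h.smooth, h.compact.comp_left (map_zero L)⟩
  have hbound : ∀ (L : ℂ →L[ℝ] ℝ) (hL : ‖L‖ ≤ 1),
      ‖u (rescale (toTest _ (htest (B⁻¹ • L))) x lam hlam)‖ ≤ |C| * lam ^ α := fun L hL =>
    (hC x hx lam hlam hlam1 _
      (toTest_mem_unitTests h hs hB0 hB (hnorm L hL) (htest _))).trans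
      (mul_le_mul_of_nonneg_right (le_abs_self C) (Real.rpow_nonneg hlam.le _))
  have hre := hbound Complex.reCLM Complex.reCLM_norm.le
  have him := hbound Complex.imCLM Complex.imCLM_norm.le
  set φ₁ := rescale (toTest _ (htest (B⁻¹ • Complex.reCLM))) x lam hlam with hφ₁
  set φ₂ := rescale (toTest _ (htest (B⁻¹ • Complex.imCLM))) x lam hlam with hφ₂
  have heq : (fun y => (((lam ^ d)⁻¹ : ℝ) : ℂ) * ψ (lam⁻¹ • (x - y))) =
      fun y => (B : ℂ) * (φ₁ y : ℂ) + (Complex.I * B) * (φ₂ y : ℂ) := by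
    ext y
    have h1 : φ₁ y = (lam ^ d)⁻¹ * (B⁻¹ * (ψ (lam⁻¹ • (x - y))).re) := rfl
    have h2 : φ₂ y = (lam ^ d)⁻¹ * (B⁻¹ * (ψ (lam⁻¹ • (x - y))).im) := rfl
    rw [h1, h2]
    have hBc : (B : ℂ) ≠ 0 := by exact_mod_cast hB0.ne'
    have hl : (lam : ℂ) ≠ 0 := by exact_mod_cast hlam.ne'
    conv_lhs => rw [← Complex.re_add_im (ψ (lam⁻¹ • (x - y)))]
    push_cast
    field_simp
  have t1 := (isTest_test φ₁).ofReal
  have t2 := (isTest_test φ₂).ofReal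
  rw [heq, pair_add u (t1.const_mul _) (t2.const_mul _), pair_const_mul u t1,
    pair_const_mul u t2, pair_ofReal, pair_ofReal]
  calc ‖(B : ℂ) * u φ₁ + Complex.I * B * u φ₂‖ ≤ B * ‖u φ₁‖ + B * ‖u φ₂‖ := by
        refine (norm_add_le _ _).trans (le_of_eq ?_)
        simp [abs_of_pos hB0]
    _ ≤ B * (|C| * lam ^ α) + B * (|C| * lam ^ α) := by gcongr
    _ = 2 * |C| * B * lam ^ α := by ring

/-- In the rescaled variable z the multiplier is m (x - λ z), whose derivatives are bounded
uniformly in λ ≤ 1 and x in `K`. So it can be absorbed into the test function. Lowering the exponent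
to γ requires at least as many derivatives and weakens the power of λ. -/
theorem exists_bound_pair_rescale_mul {u : Distr (EuclideanSpace ℝ (Fin d))} {α γ : ℝ}
    (hu : u ∈ negHolderLoc d α) (hγ : γ ≤ α) {m : EuclideanSpace ℝ (Fin d) → ℂ}
    (hm : ContDiff ℝ ∞ m) {K : Set (EuclideanSpace ℝ (Fin d))} (hK : IsCompact K) :
    ∃ C, ∀ x ∈ K, ∀ (lam : ℝ) (hlam : 0 < lam), lam ≤ 1 →
      ∀ φ ∈ unitTests d (-strictFloor γ).toNat,
        ‖pair u (fun y => (rescale φ x lam hlam y : ℂ) * m y)‖ ≤ C * lam ^ γ := by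
  obtain ⟨C, hC0, hC⟩ := exists_bound_pair_rescale hu hK
  have hr : (-strictFloor α).toNat ≤ (-strictFloor γ).toNat := by
    have := Int.ceil_mono hγ
    unfold strictFloor
    omega
  obtain ⟨C', hC'0, hC'⟩ := exists_bound_iteratedFDeriv_on hm (hK.cthickening (r := 1))
    (-strictFloor α).toNat
  -- The constant comes from Leibniz' rule; the added 1 makes the size bound strictly positive.
  refine ⟨C * (2 ^ (-strictFloor α).toNat * C' * 1 + 1), fun x hx lam hlam hlam1 φ hφ => ?_⟩
  let A : EuclideanSpace ℝ (Fin d) →L[ℝ] EuclideanSpace ℝ (Fin d) :=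
    (-lam) • ContinuousLinearMap.id ℝ _
  have hA : ‖A‖ ≤ 1 := by
    refine ContinuousLinearMap.opNorm_le_bound _ zero_le_one fun v => ?_
    simp only [A, _root_.smul_apply, ContinuousLinearMap.id_apply, norm_smul,
      norm_neg, Real.norm_of_nonneg hlam.le]
    exact mul_le_mul_of_nonneg_right hlam1 (norm_nonneg v)
  have hmA : ContDiff ℝ ∞ (fun z => m (x + A z)) := hm.comp (contDiff_const.add A.contDiff)
  have hφt := (isTest_test φ).ofReal
  have hφs : tsupport (fun z => (φ z : ℂ)) ⊆ Metric.ball 0 1 :=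
    (tsupport_comp_subset (g := ((↑) : ℝ → ℂ)) rfl _).trans hφ.1
  have hφb : ∀ i ≤ (-strictFloor α).toNat, ∀ y,
      ‖iteratedFDeriv ℝ i (fun z => (φ z : ℂ)) y‖ ≤ 1 := fun i hi y => by
    refine (Complex.ofRealCLM.norm_iteratedFDeriv_comp_left ((isTest_test φ).smooth.contDiffAt
      (x := y)) (n := i) (by exact_mod_cast le_top)).trans ?_
    rw [Complex.ofRealCLM_norm, one_mul]
    exact hφ.2 i (hi.trans hr) y
  have hmb : ∀ i ≤ (-strictFloor α).toNat, ∀ z ∈ Metric.ball (0 : EuclideanSpace ℝ (Fin d)) 1,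
      ‖iteratedFDeriv ℝ i (fun z => m (x + A z)) z‖ ≤ C' := fun i hi z hz => by
    refine (norm_iteratedFDeriv_comp_affine_le hm A x i z).trans
      ((mul_le_of_le_one_right (norm_nonneg _) (pow_le_one₀ (norm_nonneg _) hA)).trans
        (hC' i hi _ (Metric.mem_cthickening_of_dist_le _ x 1 K hx ?_)))
    rw [dist_eq_norm, add_sub_cancel_left]
    refine (A.le_opNorm z).trans ?_
    exact mul_le_one₀ hA (norm_nonneg _) (mem_ball_zero_iff.1 hz).le
  have hprod := norm_iteratedFDeriv_mul_le_of_tsupport_subset hφt hmA hφs hC'0 hφb hmb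
  have h1 := hC x hx lam hlam hlam1 _ (hφt.mul hmA) (tsupport_mul_subset_left.trans hφs)
    (2 ^ (-strictFloor α).toNat * C' * 1 + 1) (by positivity)
    fun i hi y => (hprod i hi y).trans (by linarith)
  have h2 : (fun y => (((lam ^ d)⁻¹ : ℝ) : ℂ) * ((φ (lam⁻¹ • (x - y)) : ℂ) *
      m (x + A (lam⁻¹ • (x - y))))) = fun y => (rescale φ x lam hlam y : ℂ) * m y := by
    ext y
    have h3 : x + A (lam⁻¹ • (x - y)) = y := by
      simp [A, smul_smul, hlam.ne']
    have h4 : rescale φ x lam hlam y = (lam ^ d)⁻¹ * φ (lam⁻¹ • (x - y)) := rfl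
    rw [h3, h4]
    push_cast
    ring
  rw [h2] at h1
  refine h1.trans (mul_le_mul_of_nonneg_left ?_ (by positivity))
  exact Real.rpow_le_rpow_of_exponent_ge hlam hlam1 hγ

theorem mem_negHolderLoc_of_pair {f g p : Distr (EuclideanSpace ℝ (Fin d))} {α β γ : ℝ}
    (hf : f ∈ negHolderLoc d α) (hg : g ∈ negHolderLoc d β) (hγα : γ ≤ α) (hγβ : γ ≤ β)
    {m₁ m₂ : EuclideanSpace ℝ (Fin d) → ℂ} (hm₁ : ContDiff ℝ ∞ m₁) (hm₂ : ContDiff ℝ ∞ m₂)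
    (hp : ∀ ψ, IsTest ψ → pair p ψ = pair g (fun x => ψ x * m₁ x) + pair f (fun x => ψ x * m₂ x)) :
    p ∈ negHolderLoc d γ := by
  intro K hK
  obtain ⟨C₁, hC₁⟩ := exists_bound_pair_rescale_mul hg hγβ hm₁ hK
  obtain ⟨C₂, hC₂⟩ := exists_bound_pair_rescale_mul hf hγα hm₂ hK
  refine ⟨C₁ + C₂, fun x hx lam hlam hlam1 φ hφ => ?_⟩
  rw [← pair_ofReal, hp _ (isTest_test _).ofReal, add_mul]
  exact (norm_add_le _ _).trans
    (add_le_add (hC₁ x hx lam hlam hlam1 φ hφ) (hC₂ x hx lam hlam hlam1 φ hφ))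

end HolderBounds

/-! ### Restriction to a subspace by Parseval's formula. -/

section Fourier

open scoped FourierTransform InnerProductSpace

variable {E W : Type*} [NormedAddCommGroup E] [InnerProductSpace ℝ E] [FiniteDimensional ℝ E]
  [MeasurableSpace E] [BorelSpace E] [NormedAddCommGroup W] [InnerProductSpace ℝ W]
  [FiniteDimensional ℝ W] [MeasurableSpace W] [BorelSpace W]

theorem IsTest.exists_fourier_eq {ψ : E → ℂ} (h : IsTest ψ) :
    ∃ S : SchwartzMap E ℂ, 𝓕 ψ = S :=
  ⟨𝓕 (h.compact.toSchwartzMap h.smooth), rfl⟩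

theorem IsTest.exists_fourier_decay {ψ : E → ℂ} (h : IsTest ψ) (N : ℕ) :
    ∃ C, 0 ≤ C ∧ ∀ ξ, (1 + ‖ξ‖) ^ N * ‖𝓕 ψ ξ‖ ≤ C := by
  obtain ⟨S, hS⟩ := h.exists_fourier_eq
  rw [hS]
  have h1 := S.one_add_le_sup_seminorm_apply (𝕜 := ℝ) (m := (N, 0)) (k := N) (n := 0) le_rfl le_rfl
  simp only [norm_iteratedFDeriv_zero] at h1
  exact ⟨_, (mul_nonneg (by positivity) (norm_nonneg _)).trans (h1 0), h1⟩

theorem IsTest.fourierInv_fourier {ψ : E → ℂ} (h : IsTest ψ) : 𝓕⁻ (𝓕 ψ) = ψ := by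
  obtain ⟨S, hS⟩ := h.exists_fourier_eq
  exact h.continuous.fourierInv_fourier_eq h.integrable (hS ▸ S.integrable)

/-- The integral of a function along a linear map in terms of Fourier transforms. -/
theorem integral_mul_comp_eq_integral_fourier (D : E →L[ℝ] W) {φ : E → ℂ} (hφ : IsTest φ)
    {H : W → ℂ} (hH : IsTest H) :
    ∫ x, φ x * H (D x) = ∫ ξ, 𝓕 φ (-(D.adjoint ξ)) * 𝓕 H ξ := by
  obtain ⟨S, hS⟩ := hH.exists_fourier_eq
  -- The bilinear form is -⟪D x, ξ⟫; with this sign the transform in ξ is the inverse one, which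
  -- turns 𝓕 H back into H (D x).
  have h1 := VectorFourier.integral_fourierIntegral_smul_eq_flip (e := Real.fourierChar)
    (μ := (volume : Measure E)) (ν := (volume : Measure W))
    (L := -((innerₗ W).comp D.toLinearMap)) (f := φ) (g := 𝓕 H) Real.continuous_fourierChar
    (by
      have : Continuous fun p : E × W => -⟪D p.1, p.2⟫_ℝ := by fun_prop
      exact this) hφ.integrable (hS ▸ S.integrable)
  have h2 : ∀ ξ, VectorFourier.fourierIntegral Real.fourierChar volume
      (-((innerₗ W).comp D.toLinearMap)) φ ξ = 𝓕 φ (-(D.adjoint ξ)) := fun ξ => by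
    rw [Real.fourier_eq, VectorFourier.fourierIntegral]
    simp [ContinuousLinearMap.adjoint_inner_right]
  have h3 : ∀ x, VectorFourier.fourierIntegral Real.fourierChar volume
      (-((innerₗ W).comp D.toLinearMap)).flip (𝓕 H) x = H (D x) := fun x => by
    rw [← congrFun hH.fourierInv_fourier (D x), Real.fourierInv_eq, VectorFourier.fourierIntegral]
    simp [real_inner_comm]
  simp_rw [h2, h3, smul_eq_mul] at h1
  exact h1.symm

theorem one_add_pow_mul_le {t q ε : ℝ} (ht : 0 ≤ t) (hq : 0 ≤ q) {n : ℕ} (h0 : q ≤ ε)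
    (hn : t ^ n * q ≤ ε) : (1 + t) ^ n * q ≤ 2 ^ n * (2 * ε) := by
  have h3 : (1 + t) ^ n ≤ 2 ^ n * (1 + t ^ n) := by
    refine (add_pow_le zero_le_one ht n).trans ?_
    rw [one_pow]
    exact mul_le_mul_of_nonneg_right (pow_le_pow_right₀ (by norm_num) (Nat.sub_le _ _))
      (by positivity)
  calc (1 + t) ^ n * q ≤ 2 ^ n * (1 + t ^ n) * q := mul_le_mul_of_nonneg_right h3 hq
    _ = 2 ^ n * (q + t ^ n * q) := by ring
    _ ≤ 2 ^ n * (2 * ε) := mul_le_mul_of_nonneg_left (by linarith) (by positivity)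

/-- Functions which converge weakly to zero, with decay of the Fourier transforms near the
conormal directions of a subspace, have restrictions to the subspace which converge to zero. -/
theorem tendsto_integral_mul_comp (D : E →L[ℝ] W) {c : ℝ} (hc : 0 < c) {H : ℕ → W → ℂ}
    (hH : ∀ j, IsTest (H j)) {χ : W → ℂ} (hχ : IsTest χ) (hχH : ∀ j w, H j w * χ w = H j w)
    (hweak : ∀ ψ, IsTest ψ → Tendsto (fun j => ∫ w, H j w * ψ w) atTop (𝓝 0))
    (hdecay : ∀ (N : ℕ) (ε : ℝ), 0 < ε → ∀ᶠ j in atTop, ∀ ξ, ‖D.adjoint ξ‖ ≤ c * ‖ξ‖ →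
      ‖ξ‖ ^ N * ‖𝓕 (H j) ξ‖ ≤ ε) {φ : E → ℂ} (hφ : IsTest φ) :
    Tendsto (fun j => ∫ x, φ x * H j (D x)) atTop (𝓝 0) := by
  obtain ⟨P, hP⟩ := hφ.exists_fourier_eq
  choose S hS using fun j => (hH j).exists_fourier_eq
  let m : W → ℂ := fun ξ => 𝓕 φ (-(D.adjoint ξ))
  have hm : Continuous m := by
    have : Continuous (𝓕 φ) := hP ▸ P.continuous
    fun_prop
  obtain ⟨C₀, hC₀0, hC₀⟩ := hφ.exists_fourier_decay 0
  simp only [pow_zero, one_mul] at hC₀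
  let A : Set W := {ξ | ‖D.adjoint ξ‖ ≤ c * ‖ξ‖}
  have hA : MeasurableSet A := (isClosed_le (by fun_prop) (by fun_prop)).measurableSet
  -- The part of the multiplier away from the conormals. There ‖D* ξ‖ > c ‖ξ‖, so the decay of 𝓕 φ
  -- becomes decay in ξ.
  let m₁ : W → ℂ := Aᶜ.indicator m
  have hm₁ : AEStronglyMeasurable m₁ volume := hm.aestronglyMeasurable.indicator hA.compl
  have hm₁le : ∀ ξ, ‖m₁ ξ‖ ≤ C₀ := fun ξ => (norm_indicator_le_norm_self _ _).trans (hC₀ _)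
  have hm₁decay : ∀ N : ℕ, ∃ C, ∀ ξ, ‖ξ‖ ^ N * ‖m₁ ξ‖ ≤ C := fun N => by
    obtain ⟨C, hC0, hC⟩ := hφ.exists_fourier_decay N
    refine ⟨c⁻¹ ^ N * C, fun ξ => ?_⟩
    by_cases hξ : ξ ∈ A
    · rw [show m₁ ξ = 0 from indicator_of_notMem (by simpa using hξ) _, norm_zero, mul_zero]
      positivity
    · rw [show m₁ ξ = m ξ from indicator_of_mem hξ _]
      have h1 : c * ‖ξ‖ < ‖D.adjoint ξ‖ := not_le.1 hξ
      have h2 : ‖ξ‖ ≤ c⁻¹ * (1 + ‖-(D.adjoint ξ)‖) := by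
        rw [norm_neg, inv_mul_eq_div, le_div_iff₀ hc]
        linarith
      calc ‖ξ‖ ^ N * ‖m ξ‖ ≤ (c⁻¹ * (1 + ‖-(D.adjoint ξ)‖)) ^ N * ‖m ξ‖ := by gcongr
        _ = c⁻¹ ^ N * ((1 + ‖-(D.adjoint ξ)‖) ^ N * ‖m ξ‖) := by
            rw [mul_pow, mul_assoc]
        _ ≤ c⁻¹ ^ N * C := mul_le_mul_of_nonneg_left (hC _) (by positivity)
  have hm₁int : ∀ N : ℕ, Integrable (fun ξ => ‖ξ‖ ^ N * ‖m₁ ξ‖) volume := fun N => by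
    obtain ⟨C, hC⟩ := hm₁decay (N + (volume : Measure W).integrablePower)
    exact integrable_of_le_of_pow_mul_le hm₁le hC hm₁
  have hm₁int0 : Integrable m₁ volume := by
    have := hm₁int 0
    simp only [pow_zero, one_mul] at this
    exact (integrable_norm_iff hm₁).1 this
  -- The truncated multiplier need not be continuous, but all its moments are integrable, so its
  -- transform is smooth. Multiplied by χ it is a test function, and weak convergence applies.
  have hK : ContDiff ℝ ∞ (𝓕 m₁) := Real.contDiff_fourier (N := ⊤) fun n _ => hm₁int n
  have hfar : Tendsto (fun j => ∫ ξ, m₁ ξ * 𝓕 (H j) ξ) atTop (𝓝 0) := by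
    refine (hweak _ (hχ.mul hK)).congr fun j => ?_
    have h1 := VectorFourier.integral_fourierIntegral_smul_eq_flip (e := Real.fourierChar)
      (μ := (volume : Measure W)) (ν := (volume : Measure W)) (L := innerₗ W) (f := m₁) (g := H j)
      Real.continuous_fourierChar continuous_inner hm₁int0 (hH j).integrable
    rw [flip_innerₗ] at h1
    refine Eq.trans ?_ h1
    refine integral_congr_ae (ae_of_all _ fun w => ?_)
    simp only [smul_eq_mul]
    rw [← mul_assoc, hχH, mul_comm]
    rfl
  have hnear : Tendsto (fun j => ∫ ξ, (m ξ - m₁ ξ) * 𝓕 (H j) ξ) atTop (𝓝 0) := by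
    let n := (volume : Measure W).integrablePower
    let I := ∫ ξ : W, (1 + ‖ξ‖) ^ (-(n : ℝ))
    have hI : 0 ≤ I := integral_nonneg fun ξ => by positivity
    rw [Metric.tendsto_nhds]
    intro ε hε
    -- Chosen to cancel the constants of the integral estimate; the added 1 keeps the denominator
    -- positive and the final inequality strict.
    let ε' := ε / (2 ^ n * 2 * (C₀ * I + 1))
    have hε' : 0 < ε' := by positivity
    filter_upwards [hdecay 0 ε' hε', hdecay n ε' hε'] with j h0 hn
    rw [dist_zero_right]
    have hb : ∀ ξ, ‖(m ξ - m₁ ξ) * 𝓕 (H j) ξ‖ ≤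
        C₀ * (2 ^ n * (2 * ε')) * (1 + ‖ξ‖) ^ (-(n : ℝ)) := fun ξ => by
      by_cases hξ : ξ ∈ A
      · rw [show m₁ ξ = 0 from indicator_of_notMem (by simpa using hξ) _, sub_zero, norm_mul,
          mul_assoc]
        refine mul_le_mul (hC₀ _) ?_ (norm_nonneg _) hC₀0
        rw [Real.rpow_neg (by positivity), Real.rpow_natCast, ← div_eq_mul_inv,
          le_div_iff₀ (by positivity), mul_comm]
        exact one_add_pow_mul_le (norm_nonneg _) (norm_nonneg _) (by simpa using h0 ξ hξ) (hn ξ hξ)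
      · rw [show m₁ ξ = m ξ from indicator_of_mem hξ _, sub_self, zero_mul, norm_zero]
        positivity
    calc ‖∫ ξ, (m ξ - m₁ ξ) * 𝓕 (H j) ξ‖ ≤
          ∫ ξ : W, C₀ * (2 ^ n * (2 * ε')) * (1 + ‖ξ‖) ^ (-(n : ℝ)) :=
          norm_integral_le_of_norm_le
            ((Measure.integrable_pow_neg_integrablePower volume).const_mul _) (ae_of_all _ hb)
      _ = ε * (C₀ * I / (C₀ * I + 1)) := by
          rw [integral_const_mul]
          simp only [ε']
          field_simp
          rfl
      _ < ε * 1 := by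
          refine mul_lt_mul_of_pos_left ?_ hε
          rw [div_lt_one (by positivity)]
          linarith
      _ = ε := mul_one ε
  have hsum := hnear.add hfar
  rw [add_zero] at hsum
  refine hsum.congr fun j => ?_
  have hSj : Integrable (𝓕 (H j)) volume := hS j ▸ (S j).integrable
  have i1 : Integrable (fun ξ => m₁ ξ * 𝓕 (H j) ξ) volume :=
    hSj.bdd_mul hm₁ (ae_of_all _ hm₁le)
  have i2 : Integrable (fun ξ => m ξ * 𝓕 (H j) ξ) volume :=
    hSj.bdd_mul hm.aestronglyMeasurable (ae_of_all _ fun ξ => hC₀ _)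
  rw [integral_mul_comp_eq_integral_fourier D hφ (hH j)]
  simp_rw [sub_mul]
  rw [integral_sub i2 i1, sub_add_cancel]

end Fourier

/-! ### Closed cones near the conormals of the diagonal. -/

section Cones

variable {E : Type*} [NormedAddCommGroup E] [NormedSpace ℝ E]

theorem IsClosedCone.union {Γ Γ' : Set (E × (E →L[ℝ] ℝ))} (h : IsClosedCone Γ)
    (h' : IsClosedCone Γ') : IsClosedCone (Γ ∪ Γ') where
  ne_zero p hp := hp.elim (h.ne_zero p) (h'.ne_zero p)
  conic p hp t ht := hp.imp (fun hp => h.conic p hp t ht) fun hp => h'.conic p hp t ht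
  closed := by
    rw [union_union_distrib_right]
    exact h.closed.union h'.closed

theorem TendstoIn.mono {Γ Γ' : Set (E × (E →L[ℝ] ℝ))} {U : ℕ → Distr E} {u : Distr E}
    (h : TendstoIn Γ U u) (hΓ : Γ ⊆ Γ') : TendstoIn Γ' U u where
  mem_seq j := (h.mem_seq j).trans hΓ
  mem_limit := h.mem_limit.trans hΓ
  weak := h.weak
  fourier φ V hV hVc hd := h.fourier φ V hV hVc (hd.mono_left hΓ)

/-- The diagonal map as a continuous linear map. -/
def diagL (E : Type*) [NormedAddCommGroup E] [NormedSpace ℝ E] : E →L[ℝ] E × E :=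
  (ContinuousLinearMap.id ℝ E).prod (ContinuousLinearMap.id ℝ E)

/-- The covectors close to the conormal directions of the diagonal. -/
def nearConormal (E : Type*) [NormedAddCommGroup E] [NormedSpace ℝ E] (c : ℝ) :
    Set (E × E →L[ℝ] ℝ) :=
  {ζ | ‖ζ ∘L diagL E‖ ≤ c * ‖ζ‖}

theorem isClosed_nearConormal (c : ℝ) : IsClosed (nearConormal E c) :=
  isClosed_le (by fun_prop) (by fun_prop)

theorem isConic_nearConormal (c : ℝ) : IsConic (nearConormal E c) := by
  intro ζ hζ t ht
  have hζ' : ‖ζ ∘L diagL E‖ ≤ c * ‖ζ‖ := hζ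
  change ‖(t • ζ) ∘L diagL E‖ ≤ c * ‖t • ζ‖
  rw [ContinuousLinearMap.smul_comp, norm_smul, norm_smul, mul_left_comm]
  exact mul_le_mul_of_nonneg_left hζ' (norm_nonneg t)

/-- A closed cone which does not meet the conormal bundle of the diagonal stays away from it,
locally uniformly. -/
theorem exists_disjoint_nearConormal [FiniteDimensional ℝ E]
    {Γ : Set ((E × E) × (E × E →L[ℝ] ℝ))} (hΓ : IsClosedCone Γ) (hd : Disjoint Γ diagonalConormal)
    {K : Set E} (hK : IsCompact K) : ∃ U : Set (E × E), IsOpen U ∧ diagL E '' K ⊆ U ∧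
      ∃ c : ℝ, 0 < c ∧ Disjoint Γ (U ×ˢ nearConormal E c) := by
  -- The real coordinate encodes the aperture. The open set `n` contains {0} × diagonal of `K` ×
  -- unit sphere, because over the diagonal `Γ` has no covector vanishing on it. Two uses of the
  -- tube lemma give a uniform aperture and neighbourhood, and homogeneity removes the
  -- normalization.
  let n : Set ((ℝ × (E × E)) × (E × E →L[ℝ] ℝ)) :=
    {q | (q.1.2, q.2) ∉ Γ ∪ {p | p.2 = 0} ∨ q.1.1 < ‖q.2 ∘L diagL E‖}
  have hn : IsOpen n := by
    refine IsOpen.union ?_ (isOpen_lt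
      (f := fun q : (ℝ × (E × E)) × (E × E →L[ℝ] ℝ) => q.1.1)
      (g := fun q : (ℝ × (E × E)) × (E × E →L[ℝ] ℝ) => ‖q.2 ∘L diagL E‖)
      (by fun_prop) (by fun_prop))
    exact hΓ.closed.isOpen_compl.preimage
      (f := fun q : (ℝ × (E × E)) × (E × E →L[ℝ] ℝ) => (q.1.2, q.2)) (by fun_prop)
  obtain ⟨u, v, hu, -, hsu, htv, huv⟩ := generalized_tube_lemma
    ((isCompact_singleton (x := (0 : ℝ))).prod (hK.image (diagL E).continuous))
    (isCompact_sphere (0 : E × E →L[ℝ] ℝ) 1) hn (by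
      rintro ⟨⟨t, z⟩, ζ⟩ ⟨⟨ht, x, -, hx⟩, hζ⟩
      simp only [mem_singleton_iff] at ht hx
      subst ht
      have hζ1 : ‖ζ‖ = 1 := mem_sphere_zero_iff_norm.1 hζ
      have hζ0 : ζ ≠ 0 := fun h => by simp [h] at hζ1
      by_cases h0 : ζ ∘L diagL E = 0
      · refine Or.inl ?_
        rintro (h | h)
        · refine Set.disjoint_left.1 hd h ⟨?_, hζ0, fun v => congrArg (fun q => q v) h0⟩
          rw [← hx]
          rfl
        · exact hζ0 h
      · exact Or.inr (norm_pos_iff.2 h0))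
  obtain ⟨u₁, u₂, hu₁, hu₂, h0u₁, hKu₂, huu⟩ := generalized_tube_lemma
    (isCompact_singleton (x := (0 : ℝ))) (hK.image (diagL E).continuous) hu hsu
  obtain ⟨c, hc, hcu⟩ := Metric.isOpen_iff.1 hu₁ 0 (h0u₁ rfl)
  refine ⟨u₂, hu₂, hKu₂, c / 2, by positivity, Set.disjoint_left.2 ?_⟩
  rintro ⟨z, ζ⟩ hz ⟨hzu, hζ⟩
  have hζ' : ‖ζ ∘L diagL E‖ ≤ c / 2 * ‖ζ‖ := hζ
  have hpos : 0 < ‖ζ‖ := norm_pos_iff.2 (hΓ.ne_zero _ hz)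
  have h1 : ((c / 2, z), ‖ζ‖⁻¹ • ζ) ∈ n := by
    refine huv ⟨huu ⟨hcu ?_, hzu⟩, htv ?_⟩
    · rw [mem_ball_zero_iff, Real.norm_of_nonneg (by positivity)]
      linarith
    · rw [mem_sphere_zero_iff_norm, norm_smul, norm_inv, norm_norm, inv_mul_cancel₀ hpos.ne']
  rcases h1 with h1 | h1
  · exact h1 (Or.inl (hΓ.conic _ hz _ (inv_pos.2 hpos)))
  · simp only [ContinuousLinearMap.smul_comp, norm_smul, norm_inv, norm_norm] at h1
    rw [inv_mul_eq_div, lt_div_iff₀ hpos] at h1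
    exact absurd hζ' (not_le.2 h1)

end Cones

/-! ### Uniqueness of restrictions to the diagonal. -/

section Restriction

open scoped FourierTransform InnerProductSpace

variable {E : Type*} [NormedAddCommGroup E] [InnerProductSpace ℝ E] [FiniteDimensional ℝ E]
  [MeasurableSpace E] [BorelSpace E]

/-- The diagonal map into the `L²` product. -/
def diagLp (E : Type*) [NormedAddCommGroup E] [InnerProductSpace ℝ E] :
    E →L[ℝ] WithLp 2 (E × E) :=
  (WithLp.prodContinuousLinearEquiv 2 ℝ E E).symm.toContinuousLinearMap ∘L diagL E

/-- The covector on `E × E` corresponding to the frequency `ξ`. -/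
def frequency (ξ : WithLp 2 (E × E)) : E × E →L[ℝ] ℝ :=
  (2 * Real.pi) • ((innerSL ℝ ξ) ∘L
    (WithLp.prodContinuousLinearEquiv 2 ℝ E E).symm.toContinuousLinearMap)

/-- Evaluate the covector at ξ itself: the sup norm on `E × E` is at most the Euclidean norm of
`WithLp 2`, on which the Fourier transform is taken. -/
theorem norm_le_norm_frequency (ξ : WithLp 2 (E × E)) :
    2 * Real.pi * ‖ξ‖ ≤ ‖frequency ξ‖ := by
  by_cases h0 : ξ = 0
  · rw [h0, norm_zero, mul_zero]
    positivity
  have hpos : 0 < ‖ξ‖ := norm_pos_iff.2 h0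
  have h1 : frequency ξ (WithLp.ofLp ξ) = 2 * Real.pi * ‖ξ‖ ^ 2 := by
    have : frequency ξ (WithLp.ofLp ξ) = 2 * Real.pi * ⟪ξ, ξ⟫_ℝ := rfl
    rw [this, real_inner_self_eq_norm_sq]
  have h2 : ‖WithLp.ofLp ξ‖ ≤ ‖ξ‖ := by
    rw [Prod.norm_def, max_le_iff]
    have h3 : ‖ξ‖ ^ 2 = ‖ξ.ofLp.1‖ ^ 2 + ‖ξ.ofLp.2‖ ^ 2 := WithLp.prod_norm_sq_eq_of_L2 ξ
    exact ⟨abs_le_of_sq_le_sq' (by linarith [sq_nonneg ‖ξ.ofLp.2‖]) hpos.le |>.2,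
      abs_le_of_sq_le_sq' (by linarith [sq_nonneg ‖ξ.ofLp.1‖]) hpos.le |>.2⟩
  have h3 := (le_abs_self _).trans ((frequency ξ).le_opNorm (WithLp.ofLp ξ))
  rw [h1] at h3
  have h4 := h3.trans (mul_le_mul_of_nonneg_left h2 (norm_nonneg _))
  refine le_of_mul_le_mul_right ?_ hpos
  linarith

theorem frequency_comp_diagL (ξ : WithLp 2 (E × E)) :
    ‖frequency ξ ∘L diagL E‖ = 2 * Real.pi * ‖(diagLp E).adjoint ξ‖ := by
  have h1 : frequency ξ ∘L diagL E = (2 * Real.pi) • innerSL ℝ ((diagLp E).adjoint ξ) := by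
    ext v
    have h2 : (frequency ξ ∘L diagL E) v = 2 * Real.pi * ⟪ξ, diagLp E v⟫_ℝ := rfl
    rw [h2, ← ContinuousLinearMap.adjoint_inner_left]
    rfl
  rw [h1, norm_smul, innerSL_apply_norm, Real.norm_of_nonneg (by positivity)]

/-- Two sequences of smooth functions with the same limit have restrictions to the diagonal with
the same limit. -/
theorem TendstoIn.tendsto_integral_diagonal {Γ : Set ((E × E) × (E × E →L[ℝ] ℝ))}
    (hΓ : IsClosedCone Γ) (hd : Disjoint Γ diagonalConormal) {T : Distr (E × E)}
    {w w' : ℕ → E × E → ℂ} (hw : ∀ j, ContDiff ℝ ∞ (w j)) (hw' : ∀ j, ContDiff ℝ ∞ (w' j))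
    (h : TendstoIn Γ (fun j => ofFunction (w j)) T)
    (h' : TendstoIn Γ (fun j => ofFunction (w' j)) T) {φ : E → ℂ} (hφ : IsTest φ) :
    Tendsto (fun j => ∫ x, φ x * (w j (x, x) - w' j (x, x))) atTop (𝓝 0) := by
  obtain ⟨U, hU, hKU, c, hc, hdc⟩ := exists_disjoint_nearConormal hΓ hd hφ.compact.isCompact
  -- `Φ` is one on the diagonal over supp φ, so the diagonal integral is unchanged, and it is
  -- supported where `Γ` avoids the near-conormal covectors. `X` equals one near supp Φ and supplies
  -- the cutoff required by `tendsto_integral_mul_comp`.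
  obtain ⟨Φ, hΦ, hΦU, hΦ1⟩ := exists_isTest_eq_one_nhdsSet
    (hφ.compact.isCompact.image (diagL E).continuous) hU hKU
  obtain ⟨X, hX, -, hX1⟩ := exists_isTest_eq_one_nhdsSet hΦ.compact.isCompact isOpen_univ
    (subset_univ _)
  let e : WithLp 2 (E × E) ≃L[ℝ] E × E := WithLp.prodContinuousLinearEquiv 2 ℝ E E
  have hv : ∀ j, ContDiff ℝ ∞ (fun z => w j z - w' j z) := fun j => (hw j).sub (hw' j)
  have hH : ∀ j, IsTest (fun z => (Φ z : ℂ) * (w j z - w' j z)) := fun j => hΦ.ofReal.mul (hv j)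
  have hint : ∀ F : E × E → ℂ, ∫ q : WithLp 2 (E × E), F (e q) = ∫ z, F z := fun F =>
    (WithLp.volume_preserving_symm_measurableEquiv_toLp_prod E E).integral_comp' F
  have hpair : ∀ (j) (ψ : E × E → ℂ), IsTest ψ →
      ∫ q : WithLp 2 (E × E), (Φ (e q) : ℂ) * (w j (e q) - w' j (e q)) * ψ (e q) =
        pair (ofFunction (w j)) (fun z => (Φ z : ℂ) * ψ z) -
          pair (ofFunction (w' j)) (fun z => (Φ z : ℂ) * ψ z) := fun j ψ hψ => by
    have ht := hΦ.ofReal.mul hψ.smooth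
    rw [hint fun z => (Φ z : ℂ) * (w j z - w' j z) * ψ z, pair_ofFunction (hw j).continuous ht,
      pair_ofFunction (hw' j).continuous ht,
      ← integral_sub (ht.mul (hw j)).integrable (ht.mul (hw' j)).integrable]
    refine integral_congr_ae (ae_of_all _ fun z => ?_)
    simp only
    ring
  have hfour : ∀ (j) (ξ : WithLp 2 (E × E)),
      𝓕 (fun q : WithLp 2 (E × E) => (Φ (e q) : ℂ) * (w j (e q) - w' j (e q))) ξ =
        localFourier (ofFunction (w j)) (toTest Φ hΦ) (frequency ξ) -
          localFourier (ofFunction (w' j)) (toTest Φ hΦ) (frequency ξ) := fun j ξ => by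
    rw [localFourier_eq_pair, localFourier_eq_pair]
    have ht := hΦ.ofReal.mul (contDiff_expChar (frequency ξ))
    simp only [toTest_apply]
    rw [pair_ofFunction (hw j).continuous ht,
      pair_ofFunction (hw' j).continuous ht,
      ← integral_sub (ht.mul (hw j)).integrable (ht.mul (hw' j)).integrable,
      ← hint, Real.fourier_eq']
    refine integral_congr_ae (ae_of_all _ fun q => ?_)
    have h1 : frequency ξ (e q) = 2 * Real.pi * ⟪ξ, q⟫_ℝ := rfl
    simp only [expChar, h1, smul_eq_mul, real_inner_comm ξ q]
    push_cast
    ring_nf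
  have main := tendsto_integral_mul_comp (diagLp E) hc (fun j => (hH j).comp_equiv e)
    (hX.ofReal.comp_equiv e) (fun j q => ?_) (fun ψ hψ => ?_) (fun N ε hε => ?_) hφ
  · refine main.congr fun j => ?_
    refine integral_congr_ae (ae_of_all _ fun x => ?_)
    have h1 : e (diagLp E x) = (x, x) := rfl
    simp only [h1]
    by_cases hx : x ∈ tsupport φ
    · have h2 : Φ (x, x) = 1 := eventually_nhdsSet_iff_forall.1 hΦ1 (x, x) ⟨x, hx, rfl⟩
        |>.self_of_nhds
      simp [h2]
    · simp [image_eq_zero_of_notMem_tsupport hx]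
  · by_cases hq : e q ∈ tsupport Φ
    · have h2 : X (e q) = 1 := (eventually_nhdsSet_iff_forall.1 hX1 _ hq).self_of_nhds
      simp [h2]
    · simp [image_eq_zero_of_notMem_tsupport hq]
  · have hψe := hψ.comp_equiv e.symm
    have ht := hΦ.ofReal.mul hψe.smooth
    have key : ∀ (u : ℕ → Distr (E × E)), (∀ φ : Test (E × E),
        Tendsto (fun j => u j φ) atTop (𝓝 (T φ))) → ∀ {η : E × E → ℂ}, IsTest η →
        Tendsto (fun j => pair (u j) η) atTop (𝓝 (pair T η)) := fun u hu η hη => by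
      simp_rw [pair_eq _ hη]
      exact (hu _).add ((hu _).const_mul _)
    have h1 := (key _ h.weak ht).sub (key _ h'.weak ht)
    rw [sub_self] at h1
    refine h1.congr fun j => ?_
    rw [← hpair j _ hψe]
    simp
  · have hdΦ : Disjoint Γ (tsupport (toTest Φ hΦ) ×ˢ nearConormal E c) :=
      hdc.mono_right (prod_mono_left hΦU)
    filter_upwards [h.fourier _ _ (isClosed_nearConormal c) (isConic_nearConormal c) hdΦ N (ε / 2)
      (by positivity), h'.fourier _ _ (isClosed_nearConormal c) (isConic_nearConormal c) hdΦ N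
      (ε / 2) (by positivity)] with j hj hj' ξ hξ
    have hpi : 0 < 2 * Real.pi := by positivity
    have hfr := norm_le_norm_frequency ξ
    -- The adjoint condition scales by 2π, and `norm_le_norm_frequency` bounds 2π‖ξ‖ by the norm of
    -- the covector.
    have hmem : frequency ξ ∈ nearConormal E c := by
      change ‖frequency ξ ∘L diagL E‖ ≤ c * ‖frequency ξ‖
      rw [frequency_comp_diagL]
      nlinarith [mul_le_mul_of_nonneg_left hξ hpi.le, mul_le_mul_of_nonneg_left hfr hc.le]
    have hle : ‖ξ‖ ≤ ‖frequency ξ‖ := by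
      nlinarith [Real.pi_gt_three, norm_nonneg ξ]
    rw [hfour]
    have h1 := hj _ hmem
    have h2 := hj' _ hmem
    set a := localFourier (ofFunction (w j)) (toTest Φ hΦ) (frequency ξ)
    set b := localFourier (ofFunction (w' j)) (toTest Φ hΦ) (frequency ξ)
    set t := localFourier T (toTest Φ hΦ) (frequency ξ)
    calc ‖ξ‖ ^ N * ‖a - b‖ ≤ ‖frequency ξ‖ ^ N * (‖a - t‖ + ‖b - t‖) := by
          refine mul_le_mul (pow_le_pow_left₀ (norm_nonneg _) hle N) ?_ (norm_nonneg _)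
            (by positivity)
          rw [norm_sub_rev b t]
          exact norm_sub_le_norm_sub_add_norm_sub a t b
      _ ≤ ε := by
          rw [mul_add]
          linarith

end Restriction

/-! ### Existence and uniqueness of the canonical product. -/

section CanonicalProduct

variable {d : ℕ}

/-- Two distributions with disjoint singular supports have a unique canonical product, which is a
sum of products of distributions with smooth functions. -/
theorem existsUnique_canonicalProduct (f g : Distr (EuclideanSpace ℝ (Fin d)))
    (hfg : singularSupport f ∩ singularSupport g = ∅) :
    ∃ p, IsCanonicalProduct f g p ∧ (∀ q, IsCanonicalProduct f g q → q = p) ∧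
      ∃ m₁ m₂ : EuclideanSpace ℝ (Fin d) → ℂ, ContDiff ℝ ∞ m₁ ∧ ContDiff ℝ ∞ m₂ ∧
        ∀ ψ, IsTest ψ →
          pair p ψ = pair g (fun x => ψ x * m₁ x) + pair f (fun x => ψ x * m₂ x) := by
  obtain ⟨p, m₁, m₂, hm₁, hm₂, hp, hlim⟩ := exists_product f g
    (Set.disjoint_iff_inter_eq_empty.2 hfg)
  obtain ⟨T, hT⟩ : ∃ T, IsIterated f g T := exists_tensor f g
  have hTt : IsTensorProduct f g T := isTensorProduct_of_pair hT
  obtain ⟨R, hR⟩ := exists_isMollifier (E := EuclideanSpace ℝ (Fin d))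
  let Γ₀ := tensorCone (singularSupport f) (singularSupport g)
  have hΓ₀ : IsClosedCone Γ₀ :=
    isClosedCone_tensorCone (isClosed_singularSupport f) (isClosed_singularSupport g)
  have hΓ₀d : Disjoint Γ₀ diagonalConormal := disjoint_tensorCone_diagonalConormal hfg
  have hadm : IsAdmissible T Γ₀ := ⟨hΓ₀, hΓ₀d, hT.waveFrontSet_subset⟩
  let W : ℕ → EuclideanSpace ℝ (Fin d) × EuclideanSpace ℝ (Fin d) → ℂ := fun j =>
    mollify T fun z => R j z.1 * R j z.2
  have hW : ∀ j, ContDiff ℝ ∞ (W j) := fun j => contDiff_mollify T (hR.prod.test j)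
  have hWT : TendstoIn Γ₀ (fun j => ofFunction (W j)) T := hT.tendstoIn_mollify hR.prod
  have hWlim : ∀ φ, IsTest φ → Tendsto (fun j => ∫ x, φ x * W j (x, x)) atTop (𝓝 (pair p φ)) := by
    intro φ hφ
    simp only [W, hTt.mollify_eq (hR.test _)]
    exact hlim R hR φ hφ
  have hdiag : ∀ w : EuclideanSpace ℝ (Fin d) × EuclideanSpace ℝ (Fin d) → ℂ, ContDiff ℝ ∞ w →
      ContDiff ℝ ∞ fun x => w (x, x) := fun w hw => hw.comp (contDiff_id.prodMk contDiff_id)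
  have hoF : ∀ w : EuclideanSpace ℝ (Fin d) × EuclideanSpace ℝ (Fin d) → ℂ, ContDiff ℝ ∞ w →
      ∀ φ : Test (EuclideanSpace ℝ (Fin d)),
        ofFunction (fun x => w (x, x)) φ = ∫ x, (φ x : ℂ) * w (x, x) := fun w hw φ => by
    rw [← pair_ofReal, pair_ofFunction (hdiag w hw).continuous (isTest_test φ).ofReal]
  have hpull : IsDiagonalPullback T p := by
    refine ⟨⟨Γ₀, hadm, W, hW, hWT⟩, fun Γ hΓ w hw hwT φ => ?_⟩
    have hφ := (isTest_test φ).ofReal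
    -- The given sequence and the mollifications both converge for the union of the two cones, which
    -- still avoids the conormals; hence their diagonal values have the same limit.
    have h1 := TendstoIn.tendsto_integral_diagonal (hΓ.1.union hΓ₀)
      (disjoint_union_left.2 ⟨hΓ.2.1, hΓ₀d⟩) hw hW (hwT.mono subset_union_left)
      (hWT.mono subset_union_right) hφ
    have h2 := h1.add (hWlim _ hφ)
    rw [zero_add, pair_ofReal] at h2
    refine h2.congr fun j => ?_
    rw [hoF _ (hw j), ← integral_add
      (hφ.mul ((hdiag _ (hw j)).sub (hdiag _ (hW j)))).integrable
      (hφ.mul (hdiag _ (hW j))).integrable]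
    refine integral_congr_ae (ae_of_all _ fun x => ?_)
    simp only
    ring
  refine ⟨p, ⟨T, hTt, hpull⟩, ?_, m₁, m₂, hm₁, hm₂, hp⟩
  rintro q ⟨T', hT', hq⟩
  -- Both pull-backs are now taken of the same distribution and are limits along the same
  -- mollifications.
  obtain rfl := hTt.unique hT'
  exact DFunLike.ext q p fun φ =>
    tendsto_nhds_unique (hq.2 Γ₀ hadm W hW hWT φ) (hpull.2 Γ₀ hadm W hW hWT φ)

end CanonicalProduct

end

end HolderProduct

theorem mainTheorem7 (d : ℕ) (α β : ℝ) (hα : α < 0) (hβ : β < 0)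
    (f g : HolderProduct.Distr (EuclideanSpace ℝ (Fin d)))
    (hf : f ∈ HolderProduct.negHolderLoc d α) (hg : g ∈ HolderProduct.negHolderLoc d β)
    (hfg : HolderProduct.singularSupport f ∩ HolderProduct.singularSupport g = ∅) :
    ∃ p : HolderProduct.Distr (EuclideanSpace ℝ (Fin d)),
      HolderProduct.IsCanonicalProduct f g p ∧
      (∀ q : HolderProduct.Distr (EuclideanSpace ℝ (Fin d)),
        HolderProduct.IsCanonicalProduct f g q → q = p) ∧
      p ∈ HolderProduct.negHolderLoc d (α + β) := by
  obtain ⟨p, hp, huniq, m₁, m₂, hm₁, hm₂, hpm⟩ :=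
    HolderProduct.existsUnique_canonicalProduct f g hfg
  -- Negativity of both exponents gives α + β ≤ α and α + β ≤ β, all that the Hölder bound needs.
  exact ⟨p, hp, huniq, HolderProduct.mem_negHolderLoc_of_pair hf hg (by linarith) (by linarith)
    hm₁ hm₂ hpm⟩
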